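/- Vector fields on $\mathbb{R}^2$. A homogeneous polynomial vector field $X=(P,Q)$ is in $\mathcal{V}^{hom}$ if the origin is an isolated zero of $X$ and every real projective root $[a:b]$ (characteristic direction) of the polynomial $xQ(x,y)-yP(x,y)$ has multiplicity one. The class $\mathcal{V}$ consists of the smooth planar vector fields whose lowest-order non-zero homogeneous Taylor component at $0$ is in $\mathcal{V}^{hom}$. An isolating block for $X$ is a compact smooth two-dimensional submanifold with boundary $B\subset\mathbb{R}^2$, with boundary $b$, such that $b=b^+\cup b^-$ and $b^+\cap b^-=t$, where $b^+$ (respectively $b^-$) is the set of points of $b$ whose orbit lies outside $B$ for all sufficiently small negative (respectively positive) times, and $t$, the set of points of $b$ where $X$ is tangent to $b$, is finite. Let $a^+\subset b^+$ be the set of entry points whose forward orbit stays in $B$ for all time. The map across the block $\pi$ sends $z\in b^+\setminus a^+$ to the point of $b^-$ at which the orbit of $z$ first leaves $B$ (so $\pi(z)=z$ for $z\in t$). The vector field $X$ is $C^0$-regularisable (at $0$) if there is an isolating block $B$ for which $\{0\}$ is the maximal invariant set in $B$ and $\pi$ extends uniquely to a homeomorphism $b^+\to b^-$. Proposition. Let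 $X\in\mathcal{V}$ be a homogeneous quadratic vector field. Then $X$ is $C^0$-regularisable if and only if there are $T\in GL(2,\mathbb{R})$ and $\kappa_1,\kappa_2\in\mathbb{R}$ with $\kappa_1<0$ such that $$T\,X\bigl(T^{-1}(x,y)\bigr)=\left(\kappa_1x^2+\kappa_2xy-y^2,\ (\kappa_1+1)xy+\kappa_2y^2\right)\quad\text{for all }(x,y)\in\mathbb{R}^2 .$$ -/

import Mathlib

open Set Filter Topology Asymptotics
open scoped ContDiff

namespace PlanarReg

/-! ### Classes of planar vector fields

A planar vector field is a map `X : ℝ × ℝ → ℝ × ℝ`. -/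

/-- The polynomial vector field `(P(x,y), Q(x,y))`. -/
noncomputable def polyField (P Q : MvPolynomial (Fin 2) ℝ) : ℝ × ℝ → ℝ × ℝ :=
  fun z => (MvPolynomial.eval ![z.1, z.2] P, MvPolynomial.eval ![z.1, z.2] Q)

/-- `X` is a homogeneous polynomial vector field of degree `n`. -/
def IsHomogeneousField (n : ℕ) (X : ℝ × ℝ → ℝ × ℝ) : Prop :=
  ∃ P Q : MvPolynomial (Fin 2) ℝ, P.IsHomogeneous n ∧ Q.IsHomogeneous n ∧ X = polyField P Q

/-- `p` is an isolated singular point of `X`. -/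
def IsIsolatedSingularPoint (X : ℝ × ℝ → ℝ × ℝ) (p : ℝ × ℝ) : Prop :=
  X p = 0 ∧ ∀ᶠ z in 𝓝[≠] p, X z ≠ 0

/-- The directional polynomial `x Q(x,y) - y P(x,y)`. -/
noncomputable def directionalPoly (P Q : MvPolynomial (Fin 2) ℝ) : MvPolynomial (Fin 2) ℝ :=
  MvPolynomial.X 0 * Q - MvPolynomial.X 1 * P

/-- `[a : b]` is a characteristic direction of `(P, Q)`: a real projective root of the
directional polynomial. -/
def IsCharacteristicDirection (P Q : MvPolynomial (Fin 2) ℝ) (a b : ℝ) : Prop :=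
  (a, b) ≠ (0, 0) ∧ MvPolynomial.eval ![a, b] (directionalPoly P Q) = 0

/-- The multiplicity of `[a : b]` as a projective root of the directional polynomial, that is,
the multiplicity of the linear factor `b x - a y` (it is `⊤` if the polynomial is zero). -/
noncomputable def directionMultiplicity (P Q : MvPolynomial (Fin 2) ℝ) (a b : ℝ) : ℕ∞ :=
  emultiplicity (MvPolynomial.C b * MvPolynomial.X 0 - MvPolynomial.C a * MvPolynomial.X 1)
    (directionalPoly P Q)

/-- The class `𝓥^hom`: homogeneous vector fields with an isolated singular point at the origin,
all of whose characteristic directions have multiplicity one. -/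
def MemVHom (X : ℝ × ℝ → ℝ × ℝ) : Prop :=
  IsIsolatedSingularPoint X 0 ∧
    ∃ (n : ℕ) (P Q : MvPolynomial (Fin 2) ℝ), P.IsHomogeneous n ∧ Q.IsHomogeneous n ∧
      X = polyField P Q ∧
      ∀ a b : ℝ, IsCharacteristicDirection P Q a b → directionMultiplicity P Q a b = 1

/-- `Y` is the leading order homogeneous component of `X` at the origin: the first nonzero
homogeneous term of its Taylor expansion. -/
def IsLeadingComponent (Y X : ℝ × ℝ → ℝ × ℝ) : Prop :=
  ∃ n : ℕ, IsHomogeneousField n Y ∧ Y ≠ 0 ∧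
    (fun z => X z - Y z) =O[𝓝 0] fun z => ‖z‖ ^ (n + 1)

/-- The class `𝓥`: smooth planar vector fields whose leading order homogeneous component is
in `𝓥^hom`. -/
def MemV (X : ℝ × ℝ → ℝ × ℝ) : Prop :=
  ContDiff ℝ ∞ X ∧ ∃ Y, IsLeadingComponent Y X ∧ MemVHom Y

/-! ### Isolating blocks and block regularisation -/

/-- `γ` is a solution of `γ' = X(γ)` on the time set `I`. -/
def IsSolutionOn (X : ℝ × ℝ → ℝ × ℝ) (γ : ℝ → ℝ × ℝ) (I : Set ℝ) : Prop :=
  IsIntegralCurveOn γ (fun _ => X) I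

/-- `g` is a smooth local defining function of the domain `B` at `z`. -/
def IsLocalDefiningFunction (B : Set (ℝ × ℝ)) (g : ℝ × ℝ → ℝ) (z : ℝ × ℝ) : Prop :=
  ContDiff ℝ ∞ g ∧ fderiv ℝ g z ≠ 0 ∧ ∀ᶠ w in 𝓝 z, (w ∈ B ↔ g w ≤ 0)

/-- `B` is a compact smooth two-dimensional submanifold with boundary of the plane; its boundary
is then `frontier B`. -/
def IsCompactSmoothDomain (B : Set (ℝ × ℝ)) : Prop :=
  IsCompact B ∧ ∀ z ∈ frontier B, ∃ g, IsLocalDefiningFunction B g z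

/-- `b⁺`: the boundary points at which orbits enter `B`. -/
def entrySet (X : ℝ × ℝ → ℝ × ℝ) (B : Set (ℝ × ℝ)) : Set (ℝ × ℝ) :=
  {z | z ∈ frontier B ∧ ∃ ε > 0, ∃ γ : ℝ → ℝ × ℝ,
    IsSolutionOn X γ (Ioo (-ε) ε) ∧ γ 0 = z ∧ ∀ t ∈ Ioo (-ε) 0, γ t ∉ B}

/-- `b⁻`: the boundary points at which orbits leave `B`. -/
def exitSet (X : ℝ × ℝ → ℝ × ℝ) (B : Set (ℝ × ℝ)) : Set (ℝ × ℝ) :=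
  {z | z ∈ frontier B ∧ ∃ ε > 0, ∃ γ : ℝ → ℝ × ℝ,
    IsSolutionOn X γ (Ioo (-ε) ε) ∧ γ 0 = z ∧ ∀ t ∈ Ioo 0 ε, γ t ∉ B}

/-- `t`: the boundary points at which `X` is tangent to the boundary of `B`. -/
def tangencySet (X : ℝ × ℝ → ℝ × ℝ) (B : Set (ℝ × ℝ)) : Set (ℝ × ℝ) :=
  {z | z ∈ frontier B ∧ ∃ g, IsLocalDefiningFunction B g z ∧ fderiv ℝ g z (X z) = 0}

/-- The maximal invariant set in `B`: the points whose orbit exists for all time and stays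
in `B`. -/
def maximalInvariantSet (X : ℝ × ℝ → ℝ × ℝ) (B : Set (ℝ × ℝ)) : Set (ℝ × ℝ) :=
  {z | ∃ γ : ℝ → ℝ × ℝ, IsSolutionOn X γ univ ∧ γ 0 = z ∧ ∀ t, γ t ∈ B}

/-- `B` is an isolating block (in the sense of Conley and Easton) for `X`. The tangency set is
required to be a submanifold of codimension one of the compact one-dimensional boundary, that is,
a finite set. -/
def IsIsolatingBlock (X : ℝ × ℝ → ℝ × ℝ) (B : Set (ℝ × ℝ)) : Prop :=
  IsCompactSmoothDomain B ∧
    entrySet X B ∪ exitSet X B = frontier B ∧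
    entrySet X B ∩ exitSet X B = tangencySet X B ∧
    (tangencySet X B).Finite

/-- `a⁺`: the entry points whose forward orbit stays in `B` for all time. -/
def asymptoticEntrySet (X : ℝ × ℝ → ℝ × ℝ) (B : Set (ℝ × ℝ)) : Set (ℝ × ℝ) :=
  {z | z ∈ entrySet X B ∧ ∃ γ : ℝ → ℝ × ℝ,
    IsSolutionOn X γ (Ici 0) ∧ γ 0 = z ∧ ∀ t ∈ Ici (0 : ℝ), γ t ∈ B}

/-- The graph of the map `π : b⁺ \ a⁺ → b⁻` across the block: the orbit of the entry point `z`
stays in `B` until it leaves at the exit point `w` (the two coincide at a tangency). -/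
def CrossesTo (X : ℝ × ℝ → ℝ × ℝ) (B : Set (ℝ × ℝ)) (z w : ℝ × ℝ) : Prop :=
  z ∈ entrySet X B ∧ w ∈ exitSet X B ∧ ∃ T : ℝ, 0 ≤ T ∧ ∃ γ : ℝ → ℝ × ℝ,
    IsSolutionOn X γ (Icc 0 T) ∧ γ 0 = z ∧ γ T = w ∧ ∀ t ∈ Icc 0 T, γ t ∈ B

/-- `B` is `C⁰`-trivialisable: the map across the block extends uniquely to a homeomorphism
`b⁺ → b⁻`. -/
def IsC0Trivialisable (X : ℝ × ℝ → ℝ × ℝ) (B : Set (ℝ × ℝ)) : Prop :=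
  ∃! h : entrySet X B ≃ₜ exitSet X B,
    ∀ z : entrySet X B, (z : ℝ × ℝ) ∉ asymptoticEntrySet X B → CrossesTo X B z (h z)

/-- The singular point `p` of `X` is `C⁰`-regularisable: there is a `C⁰`-trivialisable isolating
block that isolates `{p}`. -/
def IsC0RegularisableAt (X : ℝ × ℝ → ℝ × ℝ) (p : ℝ × ℝ) : Prop :=
  ∃ B : Set (ℝ × ℝ), IsIsolatingBlock X B ∧ maximalInvariantSet X B = {p} ∧
    IsC0Trivialisable X B

/-! ### The quadratic canonical form -/

/-- `(κ₁ x² + κ₂ x y - y², (κ₁ + 1) x y + κ₂ y²)`. -/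
def canonicalQuadratic (κ₁ κ₂ : ℝ) : ℝ × ℝ → ℝ × ℝ :=
  fun z => (κ₁ * z.1 ^ 2 + κ₂ * (z.1 * z.2) - z.2 ^ 2, (κ₁ + 1) * (z.1 * z.2) + κ₂ * z.2 ^ 2)

/-- The vector field `X` in the linear coordinates given by `T`, namely `T X(T⁻¹ z)`. -/
def linearPush (T : (ℝ × ℝ) ≃ₗ[ℝ] (ℝ × ℝ)) (X : ℝ × ℝ → ℝ × ℝ) : ℝ × ℝ → ℝ × ℝ :=
  fun z => T (X (T.symm z))

end PlanarReg

namespace PlanarReg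

/-! ### Scalar differential inequalities on an interval -/

/-! For a quadratic field the form `xQ - yP` is a binary cubic; by hypothesis its real linear
factors are simple. A linear change of coordinates only multiplies it by the determinant, so it can
be brought to `y(x² + y²)` or `xy(y - x)`. This fixes four of the six coefficients of the field,
leaving `canonicalQuadratic κ₁ κ₂` with `κ₁ ≠ 0` or `triField p q` with `p`, `q`, `1 - p - q`
nonzero (`exists_normalForm`). Regularisability is linearly invariant, so it is decided on these two
families.

Canonical field, `κ₁ > 0`: a first integral bounds the orbit of `(0, 1)`. By homogeneity its
rescaled copies are orbits in every neighbourhood of the origin, so no block isolates `0`.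

Canonical field, `κ₁ < 0`: the unit disc is a block. The radial rate has the sign of `κ₁x + κ₂y` and
tangencies are exterior, so `b⁺` and `b⁻` are opposite closed half circles. Every orbit off the line
`y = 0` crosses. The exponential of the first integral, signed by `y`, gives `crossingFun`: it is
continuous even at `y = 0` because `-κ₁ > 0`, preserved by the map across the disc, and injective on
each half circle. Composing one restriction with the inverse of the other gives the extension.

Three invariant lines: the field on them is governed by `p`, `q`, `1 - p - q`, which linear maps
permute. Consider the first boundary point `z` on an inward ray. If crossing points accumulate at
`z`, a continuous extension cannot send `z` to the line of the ray, since `rayFun` decreases along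
orbits (`IsFirstRayPoint.snd_ne_zero`). If one coefficient is negative, slopes contract towards the
ray, so crossings would force exactly that; hence all entry points near `z` are asymptotic, and
sliding them along `b⁺` yields a second extension. If all three are positive, entry points on the
two sides of the ray cross on their own sides, and continuity again forces the image of `z` onto the
line. -/

theorem antitoneOn_of_hasDerivWithinAt {I : Set ℝ} (hI : I.OrdConnected) {f f' : ℝ → ℝ}
    (hf : ∀ s ∈ I, HasDerivWithinAt f (f' s) I s) (h : ∀ s ∈ I, f' s ≤ 0) : AntitoneOn f I := by
  refine antitoneOn_of_hasDerivWithinAt_nonpos hI.convex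
    (fun s hs => (hf s hs).continuousWithinAt)
    (fun s hs => (hf s (interior_subset hs)).mono interior_subset)
    (fun s hs => h s (interior_subset hs))

theorem monotoneOn_of_hasDerivWithinAt {I : Set ℝ} (hI : I.OrdConnected) {f f' : ℝ → ℝ}
    (hf : ∀ s ∈ I, HasDerivWithinAt f (f' s) I s) (h : ∀ s ∈ I, 0 ≤ f' s) : MonotoneOn f I := by
  refine monotoneOn_of_hasDerivWithinAt_nonneg hI.convex
    (fun s hs => (hf s hs).continuousWithinAt)
    (fun s hs => (hf s (interior_subset hs)).mono interior_subset)
    (fun s hs => h s (interior_subset hs))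

theorem eq_of_hasDerivWithinAt_zero {I : Set ℝ} (hI : I.OrdConnected) {f : ℝ → ℝ}
    (hf : ∀ s ∈ I, HasDerivWithinAt f 0 I s) {a b : ℝ} (ha : a ∈ I) (hb : b ∈ I) :
    f a = f b := by
  rcases le_total a b with hab | hab
  · exact le_antisymm (monotoneOn_of_hasDerivWithinAt hI hf (fun _ _ => le_rfl) ha hb hab)
      (antitoneOn_of_hasDerivWithinAt hI hf (fun _ _ => le_rfl) ha hb hab)
  · exact le_antisymm (antitoneOn_of_hasDerivWithinAt hI hf (fun _ _ => le_rfl) hb ha hab)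
      (monotoneOn_of_hasDerivWithinAt hI hf (fun _ _ => le_rfl) hb ha hab)

theorem le_sub_of_le_hasDerivWithinAt {I : Set ℝ} (hI : I.OrdConnected) {f f' : ℝ → ℝ} {c : ℝ}
    (hf : ∀ s ∈ I, HasDerivWithinAt f (f' s) I s) (h : ∀ s ∈ I, c ≤ f' s)
    {a b : ℝ} (ha : a ∈ I) (hb : b ∈ I) (hab : a ≤ b) : c * (b - a) ≤ f b - f a := by
  have := monotoneOn_of_hasDerivWithinAt (f := fun s => f s - c * s) (f' := fun s => f' s - c * 1) hI
    (fun s hs => (hf s hs).sub ((hasDerivWithinAt_id s I).const_mul c))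
    (fun s hs => by linarith [h s hs]) ha hb hab
  simp only at this
  linarith

/-- A function on `[0, ∞)` with derivative bounded below by a positive constant is unbounded. -/
theorem not_bounded_of_le_hasDerivWithinAt {f f' : ℝ → ℝ} {c M : ℝ} (hc : 0 < c)
    (hf : ∀ s ∈ Ici (0 : ℝ), HasDerivWithinAt f (f' s) (Ici 0) s)
    (h : ∀ s ∈ Ici (0 : ℝ), c ≤ f' s) (hM : ∀ s ∈ Ici (0 : ℝ), |f s| ≤ M) : False := by
  have hM0 : 0 ≤ M := (abs_nonneg _).trans (hM 0 (by simp))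
  have hb : (2 * M + 1) / c ∈ Ici (0 : ℝ) := by simp only [mem_Ici]; positivity
  have := le_sub_of_le_hasDerivWithinAt ordConnected_Ici hf h (a := 0) (by simp) hb hb
  rw [sub_zero, mul_div_cancel₀ _ hc.ne'] at this
  have h1 := abs_le.1 (hM _ hb)
  have h2 := abs_le.1 (hM 0 (by simp))
  linarith

/-- A solution of a scalar linear equation `f' = f k` is a positive multiple of its value at
another time. -/
theorem exists_pos_eq_mul {I : Set ℝ} (hI : I.OrdConnected) {f k : ℝ → ℝ}
    (hf : ∀ s ∈ I, HasDerivWithinAt f (f s * k s) I s) (hk : ContinuousOn k I)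
    {a b : ℝ} (ha : a ∈ I) (hb : b ∈ I) : ∃ c > 0, f b = f a * c := by
  have hsub : uIcc a b ⊆ I := hI.uIcc_subset ha hb
  set m := min a b with hm
  set M := max a b with hM
  have hmM : m ≤ M := min_le_max
  have hU : uIcc a b = Icc m M := rfl
  -- `k` is continuous only on `I`; extending it from the compact interval makes its integral
  -- differentiable everywhere.
  let kk : ℝ → ℝ := Set.IccExtend hmM ((Icc m M).domRestrict k)
  have hkk : Continuous kk := by
    refine Continuous.Icc_extend' ?_
    rw [← continuousOn_iff_continuous_domRestrict]
    exact hk.mono hsub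
  have hkeq : ∀ s ∈ Icc m M, kk s = k s := fun s hs => by
    simp only [kk, IccExtend_of_mem _ _ hs, domRestrict_apply]
  let K : ℝ → ℝ := fun s => ∫ x in a..s, kk x
  have hK : ∀ s, HasDerivAt K (kk s) s := fun s =>
    intervalIntegral.integral_hasDerivAt_right (hkk.intervalIntegrable _ _)
      (hkk.stronglyMeasurableAtFilter _ _) hkk.continuousAt
  -- Integrating factor: `f · exp(-K)` is constant, so the required ratio is `exp (K b)`.
  have hg : ∀ s ∈ Icc m M,
      HasDerivWithinAt (fun s => f s * Real.exp (-K s)) 0 (Icc m M) s := by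
    intro s hs
    have h1 := ((hf s (hsub hs)).mono hsub).fun_mul (hK s).hasDerivWithinAt.fun_neg.exp
    refine h1.congr_deriv ?_
    rw [hkeq s hs]; ring
  have := eq_of_hasDerivWithinAt_zero ordConnected_Icc hg (a := a) (b := b)
    (hU ▸ left_mem_uIcc) (hU ▸ right_mem_uIcc)
  have hKa : K a = 0 := by simp [K]
  refine ⟨Real.exp (K b), Real.exp_pos _, ?_⟩
  simp only [hKa, neg_zero, Real.exp_zero, mul_one] at this
  rw [this, mul_assoc, ← Real.exp_add]; simp

/-! ### Solutions of planar differential equations -/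

section Solutions

variable {X : ℝ × ℝ → ℝ × ℝ} {γ : ℝ → ℝ × ℝ} {I J : Set ℝ}

theorem IsSolutionOn.mono (h : IsSolutionOn X γ I) (hJ : J ⊆ I) : IsSolutionOn X γ J :=
  IsIntegralCurveOn.mono h hJ

theorem IsSolutionOn.fst (h : IsSolutionOn X γ I) {t : ℝ} (ht : t ∈ I) :
    HasDerivWithinAt (fun s => (γ s).1) (X (γ t)).1 I t :=
  (hasFDerivAt_fst (𝕜 := ℝ) (p := γ t)).comp_hasDerivWithinAt t (h t ht)

theorem IsSolutionOn.snd (h : IsSolutionOn X γ I) {t : ℝ} (ht : t ∈ I) :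
    HasDerivWithinAt (fun s => (γ s).2) (X (γ t)).2 I t :=
  (hasFDerivAt_snd (𝕜 := ℝ) (p := γ t)).comp_hasDerivWithinAt t (h t ht)

theorem IsSolutionOn.continuousOn (h : IsSolutionOn X γ I) : ContinuousOn γ I :=
  IsIntegralCurveOn.continuousOn h

theorem IsSolutionOn.congr_field {Y : ℝ × ℝ → ℝ × ℝ} (h : IsSolutionOn X γ I)
    (hXY : ∀ t ∈ I, X (γ t) = Y (γ t)) : IsSolutionOn Y γ I := fun t ht => by
  have := h t ht
  simp only at this ⊢
  rwa [← hXY t ht]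

theorem exists_isSolutionOn_univ_of_lipschitz {K : NNReal} (hX : LipschitzWith K X) {L : ℝ}
    (hb : ∀ z, ‖X z‖ ≤ L) (z : ℝ × ℝ) : ∃ γ, IsSolutionOn X γ univ ∧ γ 0 = z := by
  have hL : 0 ≤ L := (norm_nonneg _).trans (hb z)
  have key : ∀ R : ℝ, 0 < R → ∃ γ : ℝ → ℝ × ℝ, γ 0 = z ∧
      ∀ t ∈ Ioo (-R) R, HasDerivAt γ (X (γ t)) t := by
    intro R hR
    have hpl : IsPicardLindelof (fun _ => X) (tmin := -R) (tmax := R)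
        ⟨0, by simp [hR.le]⟩ z ⟨L * R, by positivity⟩ 0 ⟨L, hL⟩ K := by
      refine IsPicardLindelof.of_time_independent (fun x _ => hb x) hX.lipschitzOnWith ?_
      simp only [sub_zero, zero_sub, neg_neg, max_self, NNReal.coe_zero]
      exact le_rfl
    obtain ⟨γ, h0, hγ⟩ := hpl.exists_eq_forall_mem_Icc_hasDerivWithinAt₀
    exact ⟨γ, h0, fun t ht => (hγ t (Ioo_subset_Icc_self ht)).hasDerivAt (Icc_mem_nhds ht.1 ht.2)⟩
  choose! γ h0 hγ using key
  have huniq : ∀ R S, 0 < R → R ≤ S → EqOn (γ R) (γ S) (Ioo (-R) R) := by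
    intro R S hR hRS
    refine ODE_solution_unique_of_mem_Ioo (v := fun _ => X) (s := fun _ => univ) (K := K)
      (t₀ := 0) (fun _ _ => hX.lipschitzOnWith) (by simp [hR])
      (fun t ht => ⟨hγ R hR t ht, mem_univ _⟩) (fun t ht => ⟨hγ S (hR.trans_le hRS) t ?_, mem_univ _⟩)
      (by rw [h0 R hR, h0 S (hR.trans_le hRS)])
    exact ⟨by linarith [ht.1], by linarith [ht.2]⟩
  -- Near `t` all these local solutions agree with the single one of radius `|t| + 2`, which
  -- supplies the derivative.
  refine ⟨fun t => γ (|t| + 1) t, fun t _ => ?_, h0 _ (by positivity)⟩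
  have hpos : 0 < |t| + 1 := by positivity
  have hpos2 : 0 < |t| + 2 := by positivity
  have hev : (fun s => γ (|s| + 1) s) =ᶠ[𝓝 t] γ (|t| + 2) := by
    have : ∀ᶠ s in 𝓝 t, |s| < |t| + 1 := continuous_abs.continuousAt.eventually_lt
      continuousAt_const (by linarith)
    filter_upwards [this] with s hs
    exact huniq _ _ (by positivity) (by linarith) (abs_lt.1 (by linarith))
  have hd := hγ _ hpos2 t (abs_lt.1 (by linarith))
  have := hd.congr_of_eventuallyEq hev
  rw [← hev.self_of_nhds] at this
  exact this.hasDerivWithinAt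

/-- Orbits of quadratic fields may escape in finite time; the cut-off field is complete and
unchanged on the ball of radius `R`. -/
theorem exists_lipschitz_cutoff (hX : ContDiff ℝ ∞ X) (R : ℝ) :
    ∃ (χ : ℝ × ℝ → ℝ) (K : NNReal) (L : ℝ), Continuous χ ∧ (∀ z, ‖z‖ ≤ R → χ z = 1) ∧
      LipschitzWith K (fun z => χ z • X z) ∧ ∀ z, ‖χ z • X z‖ ≤ L := by
  let f : ContDiffBump (0 : ℝ × ℝ) :=
    ⟨max R 1, max R 1 + 1, by positivity, by linarith⟩
  have hsm : ContDiff ℝ ∞ (fun z => f z • X z) := f.contDiff.smul hX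
  have hcs : HasCompactSupport (fun z => f z • X z) := f.hasCompactSupport.smul_right
  obtain ⟨K, hK⟩ := hsm.lipschitzWith_of_hasCompactSupport hcs (by simp)
  obtain ⟨L, hL⟩ := hcs.exists_bound_of_continuous hsm.continuous
  refine ⟨f, K, L, f.continuous, fun z hz => f.one_of_mem_closedBall ?_, hK, hL⟩
  simp only [Metric.mem_closedBall, dist_zero_right]
  exact hz.trans (le_max_left _ _)

theorem exists_isSolutionOn_Ioo (hX : ContDiff ℝ ∞ X) (z : ℝ × ℝ) :
    ∃ ε > 0, ∃ γ, IsSolutionOn X γ (Ioo (-ε) ε) ∧ γ 0 = z := by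
  obtain ⟨γ, h0, ε, hε, hγ⟩ :=
    ((hX.contDiffAt (x := z)).of_le
      (by simp : (1 : WithTop ℕ∞) ≤ ∞)).exists_forall_mem_closedBall_exists_eq_forall_mem_Ioo_hasDerivAt₀ 0
  refine ⟨ε, hε, γ, fun t ht => (hγ t ?_).hasDerivWithinAt, h0⟩
  simpa using ht

end Solutions

/-! ### Invariance under linear changes of coordinates -/

section LinearPush

variable {X : ℝ × ℝ → ℝ × ℝ} {B : Set (ℝ × ℝ)} (T : (ℝ × ℝ) ≃ₗ[ℝ] (ℝ × ℝ))

theorem linearPush_symm_linearPush : linearPush T.symm (linearPush T X) = X := by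
  funext z; simp [linearPush]

theorem linearPush_trans (S : (ℝ × ℝ) ≃ₗ[ℝ] (ℝ × ℝ)) :
    linearPush (T.trans S) X = linearPush S (linearPush T X) := rfl

theorem symm_image_image : T.symm '' (T '' B) = B := by
  rw [← image_comp]; simp

theorem IsSolutionOn.linearPush {γ : ℝ → ℝ × ℝ} {I : Set ℝ} (h : IsSolutionOn X γ I) :
    IsSolutionOn (linearPush T X) (fun t => T (γ t)) I := fun t ht => by
  have := (T.toContinuousLinearEquiv.hasFDerivAt (x := γ t)).comp_hasDerivWithinAt t (h t ht)
  simpa [PlanarReg.linearPush] using! this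

theorem image_frontier_linear : frontier (T '' B) = T '' frontier B :=
  (T.toContinuousLinearEquiv.toHomeomorph.image_frontier B).symm

/-- Using one implication for both `T` and `T.symm` gives the equivalence, so each notion need only
be transported forwards. -/
theorem iff_of_forall_linearPush
    {R : (ℝ × ℝ → ℝ × ℝ) → Set (ℝ × ℝ) → ℝ × ℝ → Prop}
    (h : ∀ (T : (ℝ × ℝ) ≃ₗ[ℝ] (ℝ × ℝ)) X B z, R X B z → R (linearPush T X) (T '' B) (T z))
    {z : ℝ × ℝ} : R (linearPush T X) (T '' B) (T z) ↔ R X B z := by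
  refine ⟨fun hz => ?_, h T X B z⟩
  have := h T.symm _ _ _ hz
  rwa [linearPush_symm_linearPush, symm_image_image, T.symm_apply_apply] at this

theorem mem_frontier_linearPush {z : ℝ × ℝ} : T z ∈ frontier (T '' B) ↔ z ∈ frontier B := by
  rw [image_frontier_linear, T.injective.mem_set_image]

theorem mem_entrySet_linearPush {z : ℝ × ℝ} :
    T z ∈ entrySet (linearPush T X) (T '' B) ↔ z ∈ entrySet X B := by
  refine iff_of_forall_linearPush T (R := fun X B z => z ∈ entrySet X B) ?_
  rintro T X B z ⟨hz, ε, hε, γ, hγ, h0, h⟩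
  refine ⟨(mem_frontier_linearPush T).2 hz, ε, hε, _, hγ.linearPush T, by rw [h0], fun t ht => ?_⟩
  rw [T.injective.mem_set_image]
  exact h t ht

theorem mem_exitSet_linearPush {z : ℝ × ℝ} :
    T z ∈ exitSet (linearPush T X) (T '' B) ↔ z ∈ exitSet X B := by
  refine iff_of_forall_linearPush T (R := fun X B z => z ∈ exitSet X B) ?_
  rintro T X B z ⟨hz, ε, hε, γ, hγ, h0, h⟩
  refine ⟨(mem_frontier_linearPush T).2 hz, ε, hε, _, hγ.linearPush T, by rw [h0], fun t ht => ?_⟩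
  rw [T.injective.mem_set_image]
  exact h t ht

theorem IsLocalDefiningFunction.comp_symm {g : ℝ × ℝ → ℝ} {z : ℝ × ℝ}
    (h : IsLocalDefiningFunction B g z) :
    IsLocalDefiningFunction (T '' B) (fun w => g (T.symm w)) (T z) ∧
      fderiv ℝ (fun w => g (T.symm w)) (T z) (linearPush T X (T z)) = fderiv ℝ g z (X z) := by
  obtain ⟨hg, hd, hB⟩ := h
  have hdiff : DifferentiableAt ℝ g (T.symm (T z)) := (hg.differentiable (by simp)).differentiableAt
  have hfd : fderiv ℝ (fun w => g (T.symm w)) (T z) =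
      (fderiv ℝ g z).comp (T.symm.toContinuousLinearEquiv : (ℝ × ℝ) →L[ℝ] (ℝ × ℝ)) := by
    have h1 : HasFDerivAt g (fderiv ℝ g z) (T.symm.toContinuousLinearEquiv (T z)) := by
      have := hdiff.hasFDerivAt
      simpa using this
    exact (h1.comp (T z) T.symm.toContinuousLinearEquiv.hasFDerivAt).fderiv
  refine ⟨⟨hg.comp T.symm.toContinuousLinearEquiv.contDiff, fun h0 => hd ?_, ?_⟩, ?_⟩
  · rw [hfd] at h0
    ext
    · have := DFunLike.congr_fun h0 (T (1, 0)); simpa using this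
    · have := DFunLike.congr_fun h0 (T (0, 1)); simpa using this
  · have hc : Tendsto T.symm (𝓝 (T z)) (𝓝 z) := by
      have := T.symm.toContinuousLinearEquiv.continuous.tendsto (T z)
      simpa using! this
    filter_upwards [hc.eventually hB] with w hw
    rw [← hw]
    constructor
    · rintro ⟨u, hu, rfl⟩; simpa using hu
    · exact fun hu => ⟨_, hu, by simp⟩
  · rw [hfd]; simp [linearPush]

theorem mem_tangencySet_linearPush {z : ℝ × ℝ} :
    T z ∈ tangencySet (linearPush T X) (T '' B) ↔ z ∈ tangencySet X B := by
  refine iff_of_forall_linearPush T (R := fun X B z => z ∈ tangencySet X B) ?_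
  rintro T X B z ⟨hz, g, hg, h⟩
  obtain ⟨h1, h2⟩ := hg.comp_symm (X := X) T
  exact ⟨(mem_frontier_linearPush T).2 hz, _, h1, h2.trans h⟩

theorem mem_maximalInvariantSet_linearPush {z : ℝ × ℝ} :
    T z ∈ maximalInvariantSet (linearPush T X) (T '' B) ↔ z ∈ maximalInvariantSet X B := by
  refine iff_of_forall_linearPush T (R := fun X B z => z ∈ maximalInvariantSet X B) ?_
  rintro T X B z ⟨γ, hγ, h0, h⟩
  exact ⟨_, hγ.linearPush T, by rw [h0], fun t => mem_image_of_mem _ (h t)⟩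

theorem mem_asymptoticEntrySet_linearPush {z : ℝ × ℝ} :
    T z ∈ asymptoticEntrySet (linearPush T X) (T '' B) ↔ z ∈ asymptoticEntrySet X B := by
  refine iff_of_forall_linearPush T (R := fun X B z => z ∈ asymptoticEntrySet X B) ?_
  rintro T X B z ⟨hz, γ, hγ, h0, h⟩
  exact ⟨(mem_entrySet_linearPush T).2 hz, _, hγ.linearPush T, by rw [h0],
    fun t ht => mem_image_of_mem _ (h t ht)⟩

theorem crossesTo_linearPush {z w : ℝ × ℝ} :
    CrossesTo (linearPush T X) (T '' B) (T z) (T w) ↔ CrossesTo X B z w := by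
  have key : ∀ (T : (ℝ × ℝ) ≃ₗ[ℝ] (ℝ × ℝ)) X B z w, CrossesTo X B z w →
      CrossesTo (linearPush T X) (T '' B) (T z) (T w) := by
    rintro T X B z w ⟨hz, hw, τ, hτ, γ, hγ, h0, h1, h⟩
    exact ⟨(mem_entrySet_linearPush T).2 hz, (mem_exitSet_linearPush T).2 hw, τ, hτ, _,
      hγ.linearPush T, by rw [h0], by rw [h1], fun t ht => mem_image_of_mem _ (h t ht)⟩
  refine ⟨fun h => ?_, key T X B z w⟩
  have := key T.symm _ _ _ _ h
  rwa [linearPush_symm_linearPush, symm_image_image, T.symm_apply_apply, T.symm_apply_apply] at this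

theorem IsIsolatingBlock.linearPush (h : IsIsolatingBlock X B) :
    IsIsolatingBlock (linearPush T X) (T '' B) := by
  obtain ⟨⟨hc, hB⟩, hu, hi, hf⟩ := h
  refine ⟨⟨hc.image T.toContinuousLinearEquiv.continuous, ?_⟩, ?_, ?_, ?_⟩
  · intro w hw
    obtain ⟨z, rfl⟩ := T.surjective w
    obtain ⟨g, hg⟩ := hB z ((mem_frontier_linearPush T).1 hw)
    exact ⟨_, (hg.comp_symm (X := X) T).1⟩
  · ext w
    obtain ⟨z, rfl⟩ := T.surjective w
    rw [mem_union, mem_entrySet_linearPush, mem_exitSet_linearPush, mem_frontier_linearPush, ← hu,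
      mem_union]
  · ext w
    obtain ⟨z, rfl⟩ := T.surjective w
    rw [mem_inter_iff, mem_entrySet_linearPush, mem_exitSet_linearPush, mem_tangencySet_linearPush,
      ← hi, mem_inter_iff]
  · refine (hf.image T).subset fun w hw => ?_
    obtain ⟨z, rfl⟩ := T.surjective w
    exact mem_image_of_mem _ ((mem_tangencySet_linearPush T).1 hw)

theorem IsC0Trivialisable.linearPush (h : IsC0Trivialisable X B) :
    IsC0Trivialisable (linearPush T X) (T '' B) := by
  obtain ⟨f, hf, hu⟩ := h
  let Th : (ℝ × ℝ) ≃ₜ (ℝ × ℝ) := T.toContinuousLinearEquiv.toHomeomorph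
  let eE : entrySet X B ≃ₜ entrySet (PlanarReg.linearPush T X) (T '' B) :=
    Th.subtype fun z => (mem_entrySet_linearPush T).symm
  let eX : exitSet X B ≃ₜ exitSet (PlanarReg.linearPush T X) (T '' B) :=
    Th.subtype fun z => (mem_exitSet_linearPush T).symm
  have heE : ∀ z, (eE z : ℝ × ℝ) = T z := fun z => rfl
  have heX : ∀ z, (eX z : ℝ × ℝ) = T z := fun z => rfl
  refine ⟨eE.symm.trans (f.trans eX), fun z hz => ?_, fun k hk => ?_⟩
  · obtain ⟨z, rfl⟩ := eE.surjective z
    rw [heE, mem_asymptoticEntrySet_linearPush] at hz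
    simp only [Homeomorph.trans_apply, Homeomorph.symm_apply_apply, heE, heX]
    exact (crossesTo_linearPush T).2 (hf z hz)
  · have : (eE.trans (k.trans eX.symm)) = f := by
      refine hu _ fun z hz => ?_
      have := hk (eE z) (by rwa [heE, mem_asymptoticEntrySet_linearPush])
      obtain ⟨w, hw⟩ := eX.surjective (k (eE z))
      simp only [Homeomorph.trans_apply]
      rw [← hw, heE, heX, crossesTo_linearPush] at this
      rw [← hw, Homeomorph.symm_apply_apply]
      exact this
    rw [← this]
    refine Homeomorph.ext fun z => ?_
    simp

theorem IsC0RegularisableAt.linearPush (h : IsC0RegularisableAt X 0) :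
    IsC0RegularisableAt (linearPush T X) 0 := by
  obtain ⟨B, h1, h2, h3⟩ := h
  refine ⟨T '' B, h1.linearPush T, ?_, h3.linearPush T⟩
  ext w
  obtain ⟨z, rfl⟩ := T.surjective w
  rw [mem_maximalInvariantSet_linearPush, h2]
  simp

end LinearPush

/-! ### Quadratic fields and their normal forms -/

/-- The quadratic vector field with the given coefficients. -/
def quadField (p₀ p₁ p₂ q₀ q₁ q₂ : ℝ) : ℝ × ℝ → ℝ × ℝ :=
  fun z => (p₀ * z.1 ^ 2 + p₁ * (z.1 * z.2) + p₂ * z.2 ^ 2,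
    q₀ * z.1 ^ 2 + q₁ * (z.1 * z.2) + q₂ * z.2 ^ 2)

/-- `X` is given by two quadratic forms. -/
def IsQuadField (X : ℝ × ℝ → ℝ × ℝ) : Prop :=
  ∃ p₀ p₁ p₂ q₀ q₁ q₂, X = quadField p₀ p₁ p₂ q₀ q₁ q₂

/-- The function `x Q(x, y) - y P(x, y)` of the vector field `X = (P, Q)`. -/
def dirForm (X : ℝ × ℝ → ℝ × ℝ) (z : ℝ × ℝ) : ℝ := z.1 * (X z).2 - z.2 * (X z).1

/-- A quadratic field vanishing only at the origin, with simple characteristic directions. -/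
structure IsSimpleQuad (X : ℝ × ℝ → ℝ × ℝ) : Prop where
  isQuadField : IsQuadField X
  ne_zero : ∀ z ≠ 0, X z ≠ 0
  not_double : ∀ a b m₀ m₁ : ℝ, (a, b) ≠ (0, 0) →
    ¬ ∀ z, dirForm X z = (b * z.1 - a * z.2) ^ 2 * (m₀ * z.1 + m₁ * z.2)

/-- The quadratic field with invariant lines `x = 0`, `y = 0` and `x = y`. -/
def triField (p q : ℝ) : ℝ × ℝ → ℝ × ℝ :=
  fun z => (z.1 * (p * z.1 + (q - 1) * z.2), z.2 * ((p - 1) * z.1 + q * z.2))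

/-- The linear automorphism of the plane with matrix `!![a, b; c, d]`. -/
noncomputable def matEquiv (a b c d : ℝ) (h : a * d - b * c ≠ 0) : (ℝ × ℝ) ≃ₗ[ℝ] (ℝ × ℝ) where
  toFun z := (a * z.1 + b * z.2, c * z.1 + d * z.2)
  map_add' z w := by ext <;> simp <;> ring
  map_smul' t z := by ext <;> simp <;> ring
  invFun z := ((d * z.1 - b * z.2) / (a * d - b * c), (a * z.2 - c * z.1) / (a * d - b * c))
  left_inv z := by
    ext <;> simp only <;> rw [div_eq_iff h] <;> ring
  right_inv z := by
    ext <;> simp only <;> rw [mul_div_assoc', mul_div_assoc', ← add_div, div_eq_iff h] <;> ring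

section MatEquiv

variable {a b c d : ℝ} (h : a * d - b * c ≠ 0) {X : ℝ × ℝ → ℝ × ℝ}

theorem matEquiv_apply (z : ℝ × ℝ) :
    matEquiv a b c d h z = (a * z.1 + b * z.2, c * z.1 + d * z.2) := rfl

theorem matEquiv_symm_apply (z : ℝ × ℝ) :
    (matEquiv a b c d h).symm z =
      ((d * z.1 - b * z.2) / (a * d - b * c), (a * z.2 - c * z.1) / (a * d - b * c)) := rfl

/-- This reduces the classification of the fields to that of binary cubics. -/
theorem dirForm_linearPush (z : ℝ × ℝ) :
    dirForm (linearPush (matEquiv a b c d h) X) (matEquiv a b c d h z) =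
      (a * d - b * c) * dirForm X z := by
  simp only [dirForm, linearPush, LinearEquiv.symm_apply_apply]
  simp only [matEquiv_apply]
  ring

theorem IsQuadField.linearPush (hX : IsQuadField X) :
    IsQuadField (linearPush (matEquiv a b c d h) X) := by
  obtain ⟨p₀, p₁, p₂, q₀, q₁, q₂, rfl⟩ := hX
  set D := a * d - b * c with hD
  let A : ℝ → ℝ → ℝ → ℝ := fun u v w => (u * d ^ 2 - v * (d * c) + w * c ^ 2) / D ^ 2
  let E : ℝ → ℝ → ℝ → ℝ := fun u v w =>
    (-2 * u * (d * b) + v * (a * d + b * c) - 2 * w * (a * c)) / D ^ 2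
  let F : ℝ → ℝ → ℝ → ℝ := fun u v w => (u * b ^ 2 - v * (a * b) + w * a ^ 2) / D ^ 2
  refine ⟨a * A p₀ p₁ p₂ + b * A q₀ q₁ q₂, a * E p₀ p₁ p₂ + b * E q₀ q₁ q₂,
    a * F p₀ p₁ p₂ + b * F q₀ q₁ q₂, c * A p₀ p₁ p₂ + d * A q₀ q₁ q₂,
    c * E p₀ p₁ p₂ + d * E q₀ q₁ q₂, c * F p₀ p₁ p₂ + d * F q₀ q₁ q₂, ?_⟩
  funext z
  simp only [PlanarReg.linearPush, matEquiv_apply, matEquiv_symm_apply, quadField, A, E, F, ← hD]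
  ext <;> simp only <;> field_simp <;> ring

theorem IsSimpleQuad.linearPush (hX : IsSimpleQuad X) :
    IsSimpleQuad (linearPush (matEquiv a b c d h) X) := by
  refine ⟨hX.isQuadField.linearPush h, fun z hz h0 => ?_, fun α β m₀ m₁ hne hf => ?_⟩
  · simp only [PlanarReg.linearPush, LinearEquiv.map_eq_zero_iff] at h0
    exact hX.ne_zero _ (by simpa using hz) h0
  -- Up to the determinant, the direction is the preimage of `(α, β)`; the remaining factor is the
  -- pulled-back linear form divided by the determinant.
  · refine hX.not_double (d * α - b * β) (a * β - c * α)
      ((m₀ * a + m₁ * c) / (a * d - b * c)) ((m₀ * b + m₁ * d) / (a * d - b * c)) ?_ fun z => ?_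
    · intro h0
      simp only [Prod.mk.injEq] at h0
      refine hne ?_
      have h1 : (a * d - b * c) * α = 0 := by linear_combination a * h0.1 + b * h0.2
      have h2 : (a * d - b * c) * β = 0 := by linear_combination c * h0.1 + d * h0.2
      simp only [mul_eq_zero, h, false_or] at h1 h2
      rw [h1, h2]
    · have := hf (matEquiv a b c d h z)
      rw [dirForm_linearPush, matEquiv_apply] at this
      simp only at this
      rw [← mul_right_inj' h, this]
      field_simp
      ring

end MatEquiv

/-! ### Reduction of the cubic form and of the field to normal form. -/

theorem exists_dirForm_root {X : ℝ × ℝ → ℝ × ℝ} (hX : IsQuadField X) :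
    ∃ c s : ℝ, c ^ 2 + s ^ 2 = 1 ∧ dirForm X (c, s) = 0 := by
  obtain ⟨p₀, p₁, p₂, q₀, q₁, q₂, rfl⟩ := hX
  set f : ℝ → ℝ := fun θ => dirForm (quadField p₀ p₁ p₂ q₀ q₁ q₂) (Real.cos θ, Real.sin θ) with hf
  have hcont : Continuous f := by
    simp only [hf, dirForm, quadField]
    fun_prop
  -- The form has odd degree, so it takes opposite values at antipodal points.
  have hpi : f Real.pi = -f 0 := by
    simp [hf, dirForm, quadField]
  have : (0 : ℝ) ∈ uIcc (f 0) (f Real.pi) := by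
    rw [hpi, mem_uIcc]
    rcases le_total (f 0) 0 with h | h
    · left; constructor <;> linarith
    · right; constructor <;> linarith
  obtain ⟨θ, -, hθ⟩ := intermediate_value_uIcc hcont.continuousOn this
  exact ⟨Real.cos θ, Real.sin θ, Real.cos_sq_add_sin_sq θ, hθ⟩

/-- The cubic determines four coefficients; `p₀` and `p₁` survive as the two parameters of each
normal form. -/
theorem quadField_eq_of_dirForm {p₀ p₁ p₂ q₀ q₁ q₂ d₁ d₂ d₃ : ℝ}
    (h : ∀ z, dirForm (quadField p₀ p₁ p₂ q₀ q₁ q₂) z =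
      z.2 * (d₁ * z.1 ^ 2 + d₂ * (z.1 * z.2) + d₃ * z.2 ^ 2)) :
    q₀ = 0 ∧ q₁ = p₀ + d₁ ∧ q₂ = p₁ + d₂ ∧ p₂ = -d₃ := by
  have h1 := h (1, 0)
  have h2 := h (0, 1)
  have h3 := h (1, 1)
  have h4 := h (1, -1)
  simp only [dirForm, quadField] at h1 h2 h3 h4
  refine ⟨?_, ?_, ?_, ?_⟩ <;> linarith

theorem exists_normalForm {X : ℝ × ℝ → ℝ × ℝ} (hX : IsSimpleQuad X) :
    ∃ T : (ℝ × ℝ) ≃ₗ[ℝ] (ℝ × ℝ),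
      (∃ κ₁ κ₂, κ₁ ≠ 0 ∧ linearPush T X = canonicalQuadratic κ₁ κ₂) ∨
      (∃ p q, p ≠ 0 ∧ q ≠ 0 ∧ 1 - p - q ≠ 0 ∧ linearPush T X = triField p q) := by
  obtain ⟨c, s, hcs, hroot⟩ := exists_dirForm_root hX.isQuadField
  have hdet1 : c * c - s * (-s) ≠ 0 := by
    have : c * c - s * (-s) = 1 := by linarith
    rw [this]; exact one_ne_zero
  set T₁ := matEquiv c s (-s) c hdet1 with hT₁
  have hX₁ : IsSimpleQuad (linearPush T₁ X) := hX.linearPush hdet1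
  have hroot₁ : dirForm (linearPush T₁ X) (1, 0) = 0 := by
    have := dirForm_linearPush (X := X) hdet1 (c, s)
    rw [hroot, mul_zero, matEquiv_apply] at this
    convert this using 2
    ext <;> simp only <;> linarith
  obtain ⟨p₀, p₁, p₂, q₀, q₁, q₂, hX₁q⟩ := hX₁.isQuadField
  rw [hX₁q] at hroot₁
  have hq₀ : q₀ = 0 := by simpa [dirForm, quadField] using hroot₁
  subst hq₀
  obtain ⟨α, hα⟩ : ∃ α, α = q₁ - p₀ := ⟨_, rfl⟩
  obtain ⟨β, hβ⟩ : ∃ β, β = q₂ - p₁ := ⟨_, rfl⟩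
  have hD : ∀ z, dirForm (linearPush T₁ X) z =
      z.2 * (α * z.1 ^ 2 + β * (z.1 * z.2) - p₂ * z.2 ^ 2) := fun z => by
    rw [hX₁q]; simp only [dirForm, quadField, hα, hβ]; ring
  -- Otherwise `y²` would divide the cubic.
  have hα0 : α ≠ 0 := fun h0 => hX₁.not_double 1 0 β (-p₂) (by simp) fun z => by
    rw [hD, h0]; ring
  obtain ⟨σ, hσ⟩ : ∃ σ, σ = β / (2 * α) := ⟨_, rfl⟩
  have hβσ : β = 2 * α * σ := by rw [hσ]; field_simp
  -- Completing the square in `x`; if `δ` vanished, `x + σy` would be a double factor.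
  obtain ⟨δ, hδ⟩ : ∃ δ, δ = -p₂ - α * σ ^ 2 := ⟨_, rfl⟩
  have hD' : ∀ z, dirForm (linearPush T₁ X) z =
      z.2 * (α * (z.1 + σ * z.2) ^ 2 + δ * z.2 ^ 2) := fun z => by
    rw [hD, hβσ, hδ]; ring
  have hδ0 : δ ≠ 0 := fun h0 => hX₁.not_double (-σ) 1 0 α (by simp) fun z => by
    rw [hD', h0]; ring
  obtain ⟨ε, hε, hεδ⟩ : ∃ ε : ℝ, (ε = 1 ∨ ε = -1) ∧ ε * |δ * α| = δ * α := by
    rcases le_total 0 (δ * α) with h | h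
    · exact ⟨1, Or.inl rfl, by rw [abs_of_nonneg h, one_mul]⟩
    · exact ⟨-1, Or.inr rfl, by rw [abs_of_nonpos h]; ring⟩
  obtain ⟨ρ, hρ⟩ : ∃ ρ, ρ = Real.sqrt |δ * α| := ⟨_, rfl⟩
  have hρ0 : 0 < ρ := by rw [hρ]; positivity
  have hρ2 : ρ ^ 2 = |δ * α| := by rw [hρ]; exact Real.sq_sqrt (abs_nonneg _)
  have hdet2 : α * ρ - (α * σ) * 0 ≠ 0 := by
    rw [mul_zero, sub_zero]; positivity
  -- In the coordinates `α(x + σy)`, `ρy`, of determinant `αρ`, the cubic becomes `y(x² + εy²)` with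
  -- `ε` the sign of `δα`.
  set T₂ := matEquiv α (α * σ) 0 ρ hdet2 with hT₂
  have hX₂ := hX₁.linearPush hdet2
  rw [← hT₂] at hX₂
  have hD₂ : ∀ z, dirForm (linearPush T₂ (linearPush T₁ X)) z =
      z.2 * (1 * z.1 ^ 2 + 0 * (z.1 * z.2) + ε * z.2 ^ 2) := fun w => by
    obtain ⟨z, rfl⟩ := T₂.surjective w
    rw [dirForm_linearPush, hD', hT₂, matEquiv_apply]
    simp only
    linear_combination (-ρ * z.2 ^ 3 * hεδ) - ρ * z.2 ^ 3 * ε * hρ2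
  obtain ⟨a₀, a₁, a₂, b₀, b₁, b₂, hX₂q⟩ := hX₂.isQuadField
  rw [hX₂q] at hD₂
  obtain ⟨e1, e2, e3, e4⟩ := quadField_eq_of_dirForm hD₂
  rcases hε with rfl | rfl
  · refine ⟨T₁.trans T₂, Or.inl ⟨a₀, a₁, fun h0 => ?_, ?_⟩⟩
    · refine hX₂.ne_zero (1, 0) (by simp) ?_
      rw [hX₂q, e1, h0]
      simp [quadField]
    · rw [linearPush_trans, hX₂q, e1, e2, e3, e4]
      funext z
      ext <;> simp only [quadField, canonicalQuadratic] <;> ring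
  · have hdet3 : (-1 : ℝ) * (-2) - (-1) * 0 ≠ 0 := by norm_num
    -- The coordinates `-(x + y)`, `-2y` carry the three lines of `y(x² - y²)` to `x = 0`, `y = 0`
    -- and `x = y`.
    set T₃ := matEquiv (-1) (-1) 0 (-2) hdet3 with hT₃
    have hX₃ := hX₂.linearPush hdet3
    rw [← hT₃] at hX₃
    have hD₃ : ∀ z, dirForm (linearPush T₃ (linearPush T₂ (linearPush T₁ X))) z =
        z.2 * ((-1) * z.1 ^ 2 + 1 * (z.1 * z.2) + 0 * z.2 ^ 2) := fun w => by
      obtain ⟨z, rfl⟩ := T₃.surjective w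
      rw [dirForm_linearPush, hX₂q, hD₂, hT₃, matEquiv_apply]
      simp only
      ring
    obtain ⟨p, u₁, u₂, v₀, v₁, v₂, hX₃q⟩ := hX₃.isQuadField
    rw [hX₃q] at hD₃
    obtain ⟨f1, f2, f3, f4⟩ := quadField_eq_of_dirForm hD₃
    have htri : linearPush T₃ (linearPush T₂ (linearPush T₁ X)) = triField p (u₁ + 1) := by
      rw [hX₃q, f1, f2, f3, f4]
      funext z
      ext <;> simp only [quadField, triField] <;> ring
    rw [htri] at hX₃
    refine ⟨(T₁.trans T₂).trans T₃, Or.inr ⟨p, u₁ + 1, fun h0 => ?_, fun h0 => ?_, fun h0 => ?_, htri⟩⟩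
    · exact hX₃.ne_zero (1, 0) (by simp) (by simp [triField, h0])
    · exact hX₃.ne_zero (0, 1) (by simp) (by simp [triField, h0])
    · refine hX₃.ne_zero (1, 1) (by simp) ?_
      ext <;> simp only [triField, Prod.fst_zero, Prod.snd_zero] <;> linarith

/-- Exchanging the first two invariant lines of `triField`. -/
theorem exists_linearPush_triField_swap (p q : ℝ) :
    ∃ T : (ℝ × ℝ) ≃ₗ[ℝ] (ℝ × ℝ), linearPush T (triField p q) = triField q p := by
  have h : (0 : ℝ) * 0 - 1 * 1 ≠ 0 := by norm_num
  refine ⟨matEquiv 0 1 1 0 h, ?_⟩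
  funext z
  simp only [linearPush, matEquiv_apply, matEquiv_symm_apply, triField]
  ext <;> simp only <;> ring

/-- Exchanging the first and the third invariant line of `triField`. -/
theorem exists_linearPush_triField_rotate (p q : ℝ) :
    ∃ T : (ℝ × ℝ) ≃ₗ[ℝ] (ℝ × ℝ), linearPush T (triField p q) = triField (1 - p - q) q := by
  have h : (-1 : ℝ) * 1 - 0 * (-1) ≠ 0 := by norm_num
  refine ⟨matEquiv (-1) 0 (-1) 1 h, ?_⟩
  funext z
  simp only [linearPush, matEquiv_apply, matEquiv_symm_apply, triField]
  ext <;> simp only <;> ring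

/-! ### Homogeneous polynomial fields -/

theorem _root_.MvPolynomial.IsHomogeneous.add_eq_of_mem_support {n : ℕ}
    {P : MvPolynomial (Fin 2) ℝ} (hP : P.IsHomogeneous n) {d : Fin 2 →₀ ℕ} (hd : d ∈ P.support) :
    d 0 + d 1 = n := by
  have h : d.degree = n := by
    rw [Finsupp.degree_eq_weight_one]
    exact hP (MvPolynomial.mem_support_iff.1 hd)
  simpa [Finsupp.degree_eq_sum] using h

theorem IsHomogeneousField.map_smul {n : ℕ} {X : ℝ × ℝ → ℝ × ℝ} (h : IsHomogeneousField n X)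
    (t : ℝ) (z : ℝ × ℝ) : X (t • z) = t ^ n • X z := by
  obtain ⟨P, Q, hP, hQ, rfl⟩ := h
  have hv : ![(t • z).1, (t • z).2] = t • ![z.1, z.2] := by
    ext i; fin_cases i <;> simp
  simp only [polyField, hv]
  have key : ∀ R : MvPolynomial (Fin 2) ℝ, R.IsHomogeneous n →
      MvPolynomial.eval (t • ![z.1, z.2]) R = t ^ n * MvPolynomial.eval ![z.1, z.2] R := by
    intro R hR
    rw [MvPolynomial.eval_eq', MvPolynomial.eval_eq', Finset.mul_sum]
    refine Finset.sum_congr rfl fun d hd => ?_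
    rw [← hR.add_eq_of_mem_support hd]
    simp only [Fin.prod_univ_two, Pi.smul_apply, smul_eq_mul]
    ring
  rw [key P hP, key Q hQ]
  rfl

theorem exists_quadratic_form {P : MvPolynomial (Fin 2) ℝ} (hP : P.IsHomogeneous 2) :
    ∃ a b c : ℝ, ∀ x y : ℝ,
      MvPolynomial.eval ![x, y] P = a * x ^ 2 + b * (x * y) + c * y ^ 2 := by
  have key : ∀ s : Finset (Fin 2 →₀ ℕ), (∀ d ∈ s, d 0 + d 1 = 2) → ∃ a b c : ℝ, ∀ x y : ℝ,
      ∑ d ∈ s, P.coeff d * (x ^ d 0 * y ^ d 1) = a * x ^ 2 + b * (x * y) + c * y ^ 2 := by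
    intro s
    induction s using Finset.induction_on with
    | empty => exact fun _ => ⟨0, 0, 0, fun x y => by simp⟩
    | insert d s hd ih =>
      intro h
      obtain ⟨a, b, c, habc⟩ := ih fun e he => h e (Finset.mem_insert_of_mem he)
      have h2 := h d (Finset.mem_insert_self _ _)
      have hcase : (d 0 = 2 ∧ d 1 = 0) ∨ (d 0 = 1 ∧ d 1 = 1) ∨ (d 0 = 0 ∧ d 1 = 2) := by omega
      rcases hcase with ⟨h0, h1⟩ | ⟨h0, h1⟩ | ⟨h0, h1⟩
      · exact ⟨a + P.coeff d, b, c, fun x y => by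
          rw [Finset.sum_insert hd, habc, h0, h1]; ring⟩
      · exact ⟨a, b + P.coeff d, c, fun x y => by
          rw [Finset.sum_insert hd, habc, h0, h1]; ring⟩
      · exact ⟨a, b, c + P.coeff d, fun x y => by
          rw [Finset.sum_insert hd, habc, h0, h1]; ring⟩
  obtain ⟨a, b, c, h⟩ := key P.support fun d hd => hP.add_eq_of_mem_support hd
  refine ⟨a, b, c, fun x y => ?_⟩
  rw [← h, MvPolynomial.eval_eq']
  simp [Fin.prod_univ_two]

theorem IsHomogeneousField.isQuadField {X : ℝ × ℝ → ℝ × ℝ} (h : IsHomogeneousField 2 X) :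
    IsQuadField X := by
  obtain ⟨P, Q, hP, hQ, rfl⟩ := h
  obtain ⟨p₀, p₁, p₂, hp⟩ := exists_quadratic_form hP
  obtain ⟨q₀, q₁, q₂, hq⟩ := exists_quadratic_form hQ
  exact ⟨p₀, p₁, p₂, q₀, q₁, q₂, funext fun z => by simp only [polyField, quadField, hp, hq]⟩

/-- After division by `t ^ n` the function is `O(t)`, yet it tends to `v`. -/
theorem eq_zero_of_pow_smul_isBigO {n : ℕ} {v : ℝ × ℝ} {f : ℝ → ℝ × ℝ}
    (hf : Tendsto f (𝓝[>] 0) (𝓝 v))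
    (h : (fun t : ℝ => t ^ n • f t) =O[𝓝[>] 0] fun t => t ^ (n + 1)) : v = 0 := by
  have h1 : f =O[𝓝[>] 0] fun t : ℝ => t := by
    have h2 : (fun t : ℝ => (t ^ n)⁻¹ • (t ^ n • f t)) =O[𝓝[>] 0]
        fun t => (t ^ n)⁻¹ • t ^ (n + 1) := (isBigO_refl _ _).smul h
    refine h2.congr' ?_ ?_
    · filter_upwards [self_mem_nhdsWithin] with t ht
      have : t ^ n ≠ 0 := pow_ne_zero _ (ne_of_gt ht)
      rw [smul_smul, inv_mul_cancel₀ this, one_smul]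
    · filter_upwards [self_mem_nhdsWithin] with t ht
      have : t ^ n ≠ 0 := pow_ne_zero _ (ne_of_gt ht)
      rw [pow_succ, smul_eq_mul, ← mul_assoc, inv_mul_cancel₀ this, one_mul]
  have h3 : Tendsto (fun t : ℝ => t) (𝓝[>] 0) (𝓝 0) := tendsto_nhdsWithin_of_tendsto_nhds tendsto_id
  exact tendsto_nhds_unique hf (h1.trans_tendsto h3)

/-- Along a ray the fields are `t ^ m • X z` and `t ^ n • Y z`, equal up to `O(t ^ (n + 1))`.
Different degrees would force `Y = 0`; equal degrees force equality. -/
theorem IsLeadingComponent.eq_of_isHomogeneousField {X Y : ℝ × ℝ → ℝ × ℝ} {m : ℕ}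
    (hX : IsHomogeneousField m X) (h : IsLeadingComponent Y X) : Y = X := by
  obtain ⟨n, hY, hY0, hO⟩ := h
  have key : ∀ z, (fun t : ℝ => t ^ m • X z - t ^ n • Y z) =O[𝓝[>] 0] fun t => t ^ (n + 1) := by
    intro z
    have hz : Tendsto (fun t : ℝ => t • z) (𝓝[>] 0) (𝓝 0) := by
      have : Tendsto (fun t : ℝ => t • z) (𝓝 0) (𝓝 ((0 : ℝ) • z)) :=
        (continuous_id.smul continuous_const).tendsto 0
      rw [zero_smul] at this
      exact tendsto_nhdsWithin_of_tendsto_nhds this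
    have h1 := hO.comp_tendsto hz
    have h2 : ((fun w => ‖w‖ ^ (n + 1)) ∘ fun t : ℝ => t • z) =O[𝓝[>] 0]
        fun t => t ^ (n + 1) := by
      refine IsBigO.of_bound (‖z‖ ^ (n + 1)) (Eventually.of_forall fun t => ?_)
      simp only [Function.comp, norm_smul, norm_pow, norm_mul, norm_norm, mul_pow]
      rw [mul_comm]
    refine (h1.trans h2).congr_left fun t => ?_
    simp only [Function.comp, hX.map_smul, hY.map_smul]
  have hpow : ∀ k : ℕ, 0 < k → ∀ v : ℝ × ℝ,
      Tendsto (fun t : ℝ => t ^ k • v) (𝓝[>] 0) (𝓝 0) := by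
    intro k hk v
    have : Tendsto (fun t : ℝ => t ^ k • v) (𝓝 0) (𝓝 ((0 : ℝ) ^ k • v)) :=
      ((continuous_pow k).smul continuous_const).tendsto 0
    rw [zero_pow hk.ne', zero_smul] at this
    exact tendsto_nhdsWithin_of_tendsto_nhds this
  rcases lt_trichotomy m n with hmn | rfl | hmn
  · exfalso
    obtain ⟨k, hk0, rfl⟩ : ∃ k, 0 < k ∧ n = m + k := ⟨n - m, by omega, by omega⟩
    have hX0 : ∀ z, X z = 0 := fun z => by
      refine eq_zero_of_pow_smul_isBigO (n := m) (f := fun t => X z - t ^ k • Y z) ?_ ?_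
      · simpa using tendsto_const_nhds.sub (hpow k hk0 (Y z))
      · have h1 : (fun t : ℝ => t ^ (m + k + 1)) =O[𝓝[>] 0] fun t => t ^ (m + 1) := by
          refine IsBigO.of_bound 1 ?_
          filter_upwards [Ioo_mem_nhdsGT (zero_lt_one (α := ℝ))] with t ht
          rw [one_mul, norm_pow, norm_pow, Real.norm_of_nonneg ht.1.le]
          exact pow_le_pow_of_le_one ht.1.le ht.2.le (by omega)
        refine ((key z).trans h1).congr_left fun t => ?_
        rw [smul_sub, smul_smul, pow_add]
    refine hY0 (funext fun z => neg_eq_zero.1 ?_)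
    refine eq_zero_of_pow_smul_isBigO (n := m + k) (f := fun _ => -Y z) tendsto_const_nhds ?_
    refine (key z).congr_left fun t => ?_
    rw [hX0, smul_zero, zero_sub, smul_neg]
  · refine funext fun z => (sub_eq_zero.1 ?_).symm
    refine eq_zero_of_pow_smul_isBigO (n := m) (f := fun _ => X z - Y z) tendsto_const_nhds ?_
    refine (key z).congr_left fun t => ?_
    rw [smul_sub]
  · exfalso
    obtain ⟨k, hk0, rfl⟩ : ∃ k, 0 < k ∧ m = n + k := ⟨m - n, by omega, by omega⟩
    refine hY0 (funext fun z => neg_eq_zero.1 ?_)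
    refine eq_zero_of_pow_smul_isBigO (n := n) (f := fun t => t ^ k • X z - Y z) ?_ ?_
    · simpa using (hpow k hk0 (X z)).sub (tendsto_const_nhds (x := Y z))
    · refine (key z).congr_left fun t => ?_
      rw [smul_sub, smul_smul, pow_add]

/-- By homogeneity, a zero off the origin would produce zeros along its ray accumulating at the
origin. A squared linear factor would have multiplicity at least two. -/
theorem MemVHom.isSimpleQuad {X : ℝ × ℝ → ℝ × ℝ} (hV : MemVHom X)
    (hX : IsHomogeneousField 2 X) : IsSimpleQuad X := by
  obtain ⟨⟨-, hiso⟩, n, P, Q, -, -, rfl, hmult⟩ := hV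
  refine ⟨hX.isQuadField, fun z hz h0 => ?_, fun a b m₀ m₁ hab hD => ?_⟩
  · have ht : Tendsto (fun t : ℝ => t • z) (𝓝[>] 0) (𝓝[≠] 0) := by
      refine tendsto_nhdsWithin_iff.2 ⟨?_, ?_⟩
      · have : Tendsto (fun t : ℝ => t • z) (𝓝 0) (𝓝 ((0 : ℝ) • z)) :=
          (continuous_id.smul continuous_const).tendsto 0
        rw [zero_smul] at this
        exact tendsto_nhdsWithin_of_tendsto_nhds this
      · filter_upwards [self_mem_nhdsWithin] with t ht
        exact smul_ne_zero (ne_of_gt ht) hz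
    obtain ⟨t, ht⟩ := (ht.eventually hiso).exists
    exact ht (by rw [hX.map_smul, h0, smul_zero])
  · have heq : directionalPoly P Q =
        (MvPolynomial.C b * MvPolynomial.X 0 - MvPolynomial.C a * MvPolynomial.X 1) ^ 2 *
          (MvPolynomial.C m₀ * MvPolynomial.X 0 + MvPolynomial.C m₁ * MvPolynomial.X 1) := by
      refine MvPolynomial.funext fun v => ?_
      have hv : v = ![v 0, v 1] := by ext i; fin_cases i <;> rfl
      have := hD (v 0, v 1)
      simp only [dirForm, polyField, ← hv] at this
      simpa [directionalPoly] using this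
    have hroot : IsCharacteristicDirection P Q a b := by
      refine ⟨hab, ?_⟩
      rw [heq]
      simp [mul_comm]
    have h1 := hmult a b hroot
    have h2 := le_emultiplicity_of_pow_dvd (Dvd.intro _ heq.symm)
    rw [directionMultiplicity] at h1
    rw [h1] at h2
    norm_cast at h2

theorem MemV.isSimpleQuad {X : ℝ × ℝ → ℝ × ℝ} (hV : MemV X)
    (hX : IsHomogeneousField 2 X) : IsSimpleQuad X := by
  obtain ⟨-, Y, hY, hYV⟩ := hV
  rw [hY.eq_of_isHomogeneousField hX] at hYV
  exact hYV.isSimpleQuad hX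

/-! ### The two normal forms: smoothness, homogeneity, invariant lines -/

theorem contDiff_canonicalQuadratic (κ₁ κ₂ : ℝ) : ContDiff ℝ ∞ (canonicalQuadratic κ₁ κ₂) := by
  unfold canonicalQuadratic; fun_prop

theorem contDiff_triField (p q : ℝ) : ContDiff ℝ ∞ (triField p q) := by
  unfold triField; fun_prop

theorem canonicalQuadratic_smul (κ₁ κ₂ c : ℝ) (z : ℝ × ℝ) :
    canonicalQuadratic κ₁ κ₂ (c • z) = c ^ 2 • canonicalQuadratic κ₁ κ₂ z := by
  ext <;> simp [canonicalQuadratic] <;> ring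

/-! ### Isolating blocks around the origin -/

section Block

variable {X : ℝ × ℝ → ℝ × ℝ} {B : Set (ℝ × ℝ)} {γ : ℝ → ℝ × ℝ} {p : ℝ × ℝ}

theorem IsSolutionOn.hasDerivAt {I : Set ℝ} (h : IsSolutionOn X γ I) {t : ℝ} (ht : I ∈ 𝓝 t) :
    HasDerivAt γ (X (γ t)) t :=
  (h t (mem_of_mem_nhds ht)).hasDerivAt ht

theorem IsSolutionOn.eventually_eq_const (hX : ContDiff ℝ ∞ X) {ε : ℝ} (hε : 0 < ε)
    (h : IsSolutionOn X γ (Ioo (-ε) ε)) (h0 : γ 0 = p) (hp : X p = 0) :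
    ∀ᶠ t in 𝓝 0, γ t = p := by
  obtain ⟨K, s, hs, hK⟩ :=
    ((hX.contDiffAt (x := p)).of_le (by simp : (1 : WithTop ℕ∞) ≤ ∞)).exists_lipschitzOnWith
  have hI : Ioo (-ε) ε ∈ 𝓝 (0 : ℝ) := Ioo_mem_nhds (by linarith) hε
  have hc : ContinuousAt γ 0 := (h.hasDerivAt hI).continuousAt
  refine ODE_solution_unique_of_eventually (v := fun _ => X) (s := fun _ => s) (K := K)
    (g := fun _ => p) (t₀ := 0) (Eventually.of_forall fun _ => hK) ?_ ?_ h0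
  · have h1 : ∀ᶠ t in 𝓝 (0 : ℝ), γ t ∈ s := hc (by rwa [h0])
    filter_upwards [h1, Ioo_mem_nhds (neg_lt_zero.2 hε) hε] with t ht ht'
    exact ⟨h.hasDerivAt (Ioo_mem_nhds ht'.1 ht'.2), ht⟩
  · refine Eventually.of_forall fun t => ⟨?_, mem_of_mem_nhds hs⟩
    simp only [hp]
    exact hasDerivAt_const t p

theorem mem_of_maximalInvariantSet_eq (h : maximalInvariantSet X B = {p}) : p ∈ B := by
  have : p ∈ maximalInvariantSet X B := by rw [h]; rfl
  obtain ⟨γ, -, h0, hB⟩ := this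
  exact h0 ▸ hB 0

/-- The orbit of a singular point of `B` is constant near time `0`, so the point is neither an entry
nor an exit point, while these exhaust the frontier. -/
theorem IsIsolatingBlock.mem_interior (hX : ContDiff ℝ ∞ X) (hB : IsIsolatingBlock X B)
    (hp : X p = 0) (hpB : p ∈ B) : p ∈ interior B := by
  by_contra hint
  have hfr : p ∈ frontier B := ⟨subset_closure hpB, hint⟩
  rw [← hB.2.1] at hfr
  rcases hfr with ⟨-, ε, hε, γ, hγ, h0, hout⟩ | ⟨-, ε, hε, γ, hγ, h0, hout⟩
  · have h1 : ∀ᶠ t in 𝓝[<] 0, γ t = p :=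
      (hγ.eventually_eq_const hX hε h0 hp).filter_mono nhdsWithin_le_nhds
    obtain ⟨t, ht, ht'⟩ := (h1.and (Ioo_mem_nhdsLT (neg_lt_zero.2 hε))).exists
    exact hout t ht' (ht ▸ hpB)
  · have h1 : ∀ᶠ t in 𝓝[>] 0, γ t = p :=
      (hγ.eventually_eq_const hX hε h0 hp).filter_mono nhdsWithin_le_nhds
    obtain ⟨t, ht, ht'⟩ := (h1.and (Ioo_mem_nhdsGT hε)).exists
    exact hout t ht' (ht ▸ hpB)

/-- A quadratic field with a nonzero bounded orbit has no block isolating the origin. -/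
theorem not_bounded_of_isolatingBlock (hX : ContDiff ℝ ∞ X)
    (hhom : ∀ (c : ℝ) z, X (c • z) = c ^ 2 • X z) (hB : IsIsolatingBlock X B)
    (hinv : maximalInvariantSet X B = {0}) {M : ℝ} (hγ : IsSolutionOn X γ univ)
    (h0 : γ 0 ≠ 0) (hM : ∀ t, ‖γ t‖ ≤ M) : False := by
  have hX0 : X 0 = 0 := by simpa using hhom 0 0
  have hint := hB.mem_interior hX hX0 (mem_of_maximalInvariantSet_eq hinv)
  obtain ⟨r, hr, hrB⟩ := Metric.mem_nhds_iff.1 (mem_interior_iff_mem_nhds.1 hint)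
  have hM0 : 0 ≤ M := (norm_nonneg _).trans (hM 0)
  obtain ⟨c, hc, hcM⟩ : ∃ c > 0, c * M < r :=
    ⟨r / (M + 1), by positivity, by rw [div_mul_eq_mul_div, div_lt_iff₀ (by positivity)]; nlinarith⟩
  have hmem : c • γ 0 ∈ maximalInvariantSet X B := by
    -- Degree two makes `c γ(ct)` a solution, and small `c` puts it inside a ball contained in `B`.
    refine ⟨fun t => c • γ (c * t), fun t _ => ?_, by simp, fun t => hrB ?_⟩
    · have h1 : HasDerivAt γ (X (γ (c * t))) (c * t) := hγ.hasDerivAt univ_mem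
      have h2 := (h1.scomp t ((hasDerivAt_id t).const_mul c)).const_smul c
      refine (h2.congr_deriv ?_).hasDerivWithinAt
      simp only [hhom, smul_smul]
      congr 1; ring
    · rw [mem_ball_zero_iff, norm_smul, Real.norm_of_nonneg hc.le]
      exact (mul_le_mul_of_nonneg_left (hM _) hc.le).trans_lt hcM
  rw [hinv] at hmem
  exact (smul_ne_zero hc.ne' h0) hmem

/-- A solution that is a priori bounded, for all reparametrisations of the field, exists for
all time. -/
theorem exists_bounded_solution (hX : ContDiff ℝ ∞ X) (z : ℝ × ℝ) (R : ℝ)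
    (h : ∀ (χ : ℝ × ℝ → ℝ) γ, Continuous χ → IsSolutionOn (fun w => χ w • X w) γ univ → γ 0 = z →
      ∀ t, ‖γ t‖ ≤ R) : ∃ γ, IsSolutionOn X γ univ ∧ γ 0 = z ∧ ∀ t, ‖γ t‖ ≤ R := by
  obtain ⟨χ, K, L, hχ, hχ1, hK, hL⟩ := exists_lipschitz_cutoff hX R
  obtain ⟨γ, hγ, h0⟩ := exists_isSolutionOn_univ_of_lipschitz hK hL z
  have hb := h χ γ hχ hγ h0
  -- The a priori bound keeps the orbit where the cut-off equals one.
  exact ⟨γ, hγ.congr_field fun t _ => by rw [hχ1 _ (hb t), one_smul], h0, hb⟩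

end Block

/-! ### First integrals -/

section Canonical

variable {κ₁ κ₂ : ℝ} {γ : ℝ → ℝ × ℝ} {χ : ℝ × ℝ → ℝ} {I : Set ℝ}

/-- The logarithm of a first integral of the canonical quadratic field. -/
noncomputable def canonicalIntegral (κ₁ κ₂ : ℝ) (z : ℝ × ℝ) : ℝ :=
  (1 + κ₁) / 2 * Real.log (z.1 ^ 2 + z.2 ^ 2) - κ₁ * Real.log z.2 + κ₂ * Real.arctan (z.1 / z.2)

theorem hasDerivWithinAt_normSq_canonical
    (h : IsSolutionOn (fun w => χ w • canonicalQuadratic κ₁ κ₂ w) γ I) {t : ℝ} (ht : t ∈ I) :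
    HasDerivWithinAt (fun s => (γ s).1 ^ 2 + (γ s).2 ^ 2)
      (2 * χ (γ t) * (κ₁ * (γ t).1 + κ₂ * (γ t).2) * ((γ t).1 ^ 2 + (γ t).2 ^ 2)) I t := by
  refine (((h.fst ht).fun_pow 2).fun_add ((h.snd ht).fun_pow 2)).congr_deriv ?_
  simp [canonicalQuadratic]
  ring

theorem hasDerivWithinAt_arctan_canonical
    (h : IsSolutionOn (fun w => χ w • canonicalQuadratic κ₁ κ₂ w) γ I) {t : ℝ} (ht : t ∈ I)
    (hy : (γ t).2 ≠ 0) :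
    HasDerivWithinAt (fun s => Real.arctan ((γ s).1 / (γ s).2)) (-(χ (γ t) * (γ t).2)) I t := by
  refine ((h.fst ht).fun_div (h.snd ht) hy).arctan.congr_deriv ?_
  have h1 : (γ t).1 ^ 2 + (γ t).2 ^ 2 ≠ 0 := by positivity
  have h2 : 1 + ((γ t).1 / (γ t).2) ^ 2 ≠ 0 := by positivity
  have h3 : 1 + ((γ t).1 / (γ t).2) ^ 2 = ((γ t).1 ^ 2 + (γ t).2 ^ 2) / (γ t).2 ^ 2 := by
    field_simp; ring
  rw [h3]
  simp [canonicalQuadratic]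
  field_simp
  ring

/-- The second component is divisible by `y`, so `y` keeps its sign along orbits. -/
theorem snd_canonical_eq_mul (hI : I.OrdConnected) (hχ : Continuous χ)
    (h : IsSolutionOn (fun w => χ w • canonicalQuadratic κ₁ κ₂ w) γ I) {a b : ℝ} (ha : a ∈ I)
    (hb : b ∈ I) : ∃ c > 0, (γ b).2 = (γ a).2 * c := by
  refine exists_pos_eq_mul (f := fun s => (γ s).2)
    (k := fun s => χ (γ s) * ((κ₁ + 1) * (γ s).1 + κ₂ * (γ s).2)) hI (fun s hs => ?_) ?_ ha hb
  · refine (h.snd hs).congr_deriv ?_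
    simp [canonicalQuadratic]
    ring
  · have := h.continuousOn
    fun_prop

theorem canonicalIntegral_eq (hI : I.OrdConnected) (hχ : Continuous χ)
    (h : IsSolutionOn (fun w => χ w • canonicalQuadratic κ₁ κ₂ w) γ I) {a b : ℝ} (ha : a ∈ I)
    (hb : b ∈ I) (hy : (γ a).2 ≠ 0) :
    canonicalIntegral κ₁ κ₂ (γ a) = canonicalIntegral κ₁ κ₂ (γ b) := by
  have hne : ∀ s ∈ I, (γ s).2 ≠ 0 := fun s hs => by
    obtain ⟨c, hc, hcs⟩ := snd_canonical_eq_mul hI hχ h ha hs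
    rw [hcs]; positivity
  refine eq_of_hasDerivWithinAt_zero (f := fun s => canonicalIntegral κ₁ κ₂ (γ s)) hI
    (fun s hs => ?_) ha hb
  have hys := hne s hs
  have h1 : (γ s).1 ^ 2 + (γ s).2 ^ 2 ≠ 0 := by positivity
  refine (((((hasDerivWithinAt_normSq_canonical h hs).log h1).const_mul ((1 + κ₁) / 2)).fun_sub
    (((h.snd hs).log hys).const_mul κ₁)).fun_add
    ((hasDerivWithinAt_arctan_canonical h hs hys).const_mul κ₂)).congr_deriv ?_
  simp [canonicalQuadratic]
  field_simp
  ring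

theorem exists_bounded_canonical (hκ : 0 < κ₁) (κ₂ : ℝ) :
    ∃ γ R, IsSolutionOn (canonicalQuadratic κ₁ κ₂) γ univ ∧ γ 0 = (0, 1) ∧ ∀ t, ‖γ t‖ ≤ R := by
  refine (exists_bounded_solution (contDiff_canonicalQuadratic κ₁ κ₂) (0, 1)
    (Real.exp (|κ₂| * Real.pi)) ?_).imp fun γ h => ⟨_, h⟩
  intro χ γ hχ hγ h0 t
  have hint := canonicalIntegral_eq ordConnected_univ hχ hγ (mem_univ 0) (mem_univ t)
    (by rw [h0]; simp)
  obtain ⟨c, hc, hct⟩ := snd_canonical_eq_mul ordConnected_univ hχ hγ (mem_univ 0) (mem_univ t)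
  rw [h0] at hct
  simp only [one_mul] at hct
  have hy : 0 < (γ t).2 := hct ▸ hc
  rw [h0] at hint
  simp only [canonicalIntegral] at hint
  norm_num at hint
  set x := (γ t).1
  set y := (γ t).2
  -- The integral is `0` at `(0, 1)`. With `N = x² + y²` and `κ₁ > 0`, `log N ≥ 2 log y` bounds its
  -- logarithmic part below by `(log N) / 2`, and the arctangent term is bounded.
  have hlog : 2 * Real.log y ≤ Real.log (x ^ 2 + y ^ 2) := by
    have : Real.log (y ^ 2) ≤ Real.log (x ^ 2 + y ^ 2) :=
      Real.log_le_log (by positivity) (by nlinarith)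
    simpa using this
  have harc : -(|κ₂| * (Real.pi / 2)) ≤ κ₂ * Real.arctan (x / y) := by
    have h1 : |Real.arctan (x / y)| ≤ Real.pi / 2 :=
      abs_le.2 ⟨(Real.neg_pi_div_two_lt_arctan _).le, (Real.arctan_lt_pi_div_two _).le⟩
    have h2 : |κ₂ * Real.arctan (x / y)| ≤ |κ₂| * (Real.pi / 2) := by
      rw [abs_mul]; gcongr
    exact (abs_le.1 h2).1
  have hL : Real.log (x ^ 2 + y ^ 2) ≤ |κ₂| * Real.pi := by nlinarith
  have hr : x ^ 2 + y ^ 2 ≤ Real.exp (|κ₂| * Real.pi) := by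
    rwa [← Real.log_le_iff_le_exp (by positivity)]
  have hE : 1 ≤ Real.exp (|κ₂| * Real.pi) := Real.one_le_exp (by positivity)
  rw [Prod.norm_def, max_le_iff, Real.norm_eq_abs, Real.norm_eq_abs]
  constructor <;> refine abs_le_of_sq_le_sq ?_ (by positivity) <;> nlinarith [sq_nonneg x, sq_nonneg y]

end Canonical

section Tri

variable {p q : ℝ} {γ : ℝ → ℝ × ℝ} {I : Set ℝ}

theorem fst_tri_eq_mul (hI : I.OrdConnected) (h : IsSolutionOn (triField p q) γ I) {a b : ℝ}
    (ha : a ∈ I) (hb : b ∈ I) : ∃ c > 0, (γ b).1 = (γ a).1 * c := by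
  refine exists_pos_eq_mul (f := fun s => (γ s).1)
    (k := fun s => p * (γ s).1 + (q - 1) * (γ s).2) hI (fun s hs => h.fst hs) ?_ ha hb
  have := h.continuousOn
  fun_prop

theorem snd_tri_eq_mul (hI : I.OrdConnected) (h : IsSolutionOn (triField p q) γ I) {a b : ℝ}
    (ha : a ∈ I) (hb : b ∈ I) : ∃ c > 0, (γ b).2 = (γ a).2 * c := by
  refine exists_pos_eq_mul (f := fun s => (γ s).2)
    (k := fun s => (p - 1) * (γ s).1 + q * (γ s).2) hI (fun s hs => h.snd hs) ?_ ha hb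
  have := h.continuousOn
  fun_prop

theorem snd_sub_fst_tri_eq_mul (hI : I.OrdConnected) (h : IsSolutionOn (triField p q) γ I)
    {a b : ℝ} (ha : a ∈ I) (hb : b ∈ I) :
    ∃ c > 0, (γ b).2 - (γ b).1 = ((γ a).2 - (γ a).1) * c := by
  refine exists_pos_eq_mul (f := fun s => (γ s).2 - (γ s).1)
    (k := fun s => p * (γ s).1 + q * (γ s).2) hI (fun s hs => ?_) ?_ ha hb
  · refine ((h.snd hs).fun_sub (h.fst hs)).congr_deriv ?_
    simp only [triField]
    ring
  · have := h.continuousOn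
    fun_prop

end Tri

/-! ### The canonical field with `κ₁ > 0`. -/

theorem not_regularisable_canonical {κ₁ κ₂ : ℝ} (hκ : 0 < κ₁) :
    ¬ IsC0RegularisableAt (canonicalQuadratic κ₁ κ₂) 0 := by
  rintro ⟨B, hB, hinv, -⟩
  obtain ⟨γ, R, h1, h2, h3⟩ := exists_bounded_canonical hκ κ₂
  exact not_bounded_of_isolatingBlock (contDiff_canonicalQuadratic κ₁ κ₂)
    (canonicalQuadratic_smul κ₁ κ₂) hB hinv h1 (by rw [h2]; simp) h3

/-! ### One-sided sign lemmas and defining functions -/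

theorem eventually_pos_of_hasDerivWithinAt {f : ℝ → ℝ} {d a : ℝ}
    (h : HasDerivWithinAt f d (Ioi a) a) (hd : 0 < d) : ∀ᶠ t in 𝓝[>] a, f a < f t := by
  have h1 := (hasDerivWithinAt_iff_tendsto_slope' self_notMem_Ioi).1 h
  filter_upwards [h1.eventually (lt_mem_nhds hd), self_mem_nhdsWithin] with t ht hat
  rw [slope_def_field] at ht
  have : 0 < t - a := sub_pos.2 hat
  have := (div_pos_iff_of_pos_right this).1 ht
  linarith

theorem eventually_neg_of_hasDerivWithinAt {f : ℝ → ℝ} {d a : ℝ}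
    (h : HasDerivWithinAt f d (Iio a) a) (hd : 0 < d) : ∀ᶠ t in 𝓝[<] a, f t < f a := by
  have h1 := (hasDerivWithinAt_iff_tendsto_slope' self_notMem_Iio).1 h
  filter_upwards [h1.eventually (lt_mem_nhds hd), self_mem_nhdsWithin] with t ht hat
  rw [slope_def_field] at ht
  have h2 : t - a < 0 := sub_neg.2 hat
  rcases div_pos_iff.1 ht with h3 | h3 <;> linarith

section DefiningFunction

variable {B : Set (ℝ × ℝ)} {g : ℝ × ℝ → ℝ} {z : ℝ × ℝ}

theorem IsLocalDefiningFunction.hasFDerivAt (h : IsLocalDefiningFunction B g z) (w : ℝ × ℝ) :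
    HasFDerivAt g (fderiv ℝ g w) w :=
  (h.1.differentiable (by simp)).differentiableAt.hasFDerivAt

theorem IsLocalDefiningFunction.eq_zero (h : IsLocalDefiningFunction B g z)
    (hz : z ∈ frontier B) : g z = 0 := by
  obtain ⟨hg, -, hB⟩ := h
  rcases lt_trichotomy (g z) 0 with h0 | h0 | h0
  · exfalso
    refine hz.2 (mem_interior_iff_mem_nhds.2 ?_)
    filter_upwards [hB, hg.continuous.continuousAt.eventually_lt continuousAt_const h0] with w h1 h2
    exact h1.2 h2.le
  · exact h0
  · exfalso
    have h1 : ∀ᶠ w in 𝓝 z, w ∉ B := by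
      filter_upwards [hB, continuousAt_const.eventually_lt hg.continuous.continuousAt h0] with w h1 h2
      exact fun h3 => absurd (h1.1 h3) (not_le.2 h2)
    exact (mem_closure_iff_frequently.1 hz.1) h1

theorem IsLocalDefiningFunction.hasDerivAt_line (h : IsLocalDefiningFunction B g z) (v : ℝ × ℝ) :
    HasDerivAt (fun t : ℝ => g (z + t • v)) (fderiv ℝ g z v) 0 := by
  have h1 : HasDerivAt (fun t : ℝ => z + t • v) v 0 := by
    simpa using ((hasDerivAt_id (0 : ℝ)).smul_const v).const_add z
  have h2 : HasFDerivAt g (fderiv ℝ g z) (z + (0 : ℝ) • v) := by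
    simpa using h.hasFDerivAt z
  exact h2.comp_hasDerivAt 0 h1

theorem tendsto_line (z v : ℝ × ℝ) : Tendsto (fun t : ℝ => z + t • v) (𝓝 0) (𝓝 z) := by
  have : Continuous fun t : ℝ => z + t • v := by fun_prop
  simpa using this.tendsto 0

/-- Directions pointing to points of `B` do not increase a defining function. -/
theorem IsLocalDefiningFunction.fderiv_nonpos (h : IsLocalDefiningFunction B g z)
    (hz : g z = 0) {v : ℝ × ℝ} (hv : ∀ᶠ t : ℝ in 𝓝[>] 0, z + t • v ∈ B) :
    fderiv ℝ g z v ≤ 0 := by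
  by_contra hpos
  have h1 := eventually_pos_of_hasDerivWithinAt (h.hasDerivAt_line v).hasDerivWithinAt
    (not_le.1 hpos)
  have h2 : ∀ᶠ t : ℝ in 𝓝[>] 0, (z + t • v ∈ B ↔ g (z + t • v) ≤ 0) :=
    ((tendsto_line z v).mono_left nhdsWithin_le_nhds).eventually h.2.2
  obtain ⟨t, h3, h4, h5⟩ := (h1.and (h2.and hv)).exists
  have := h4.1 h5
  simp only [zero_smul, add_zero, hz] at h3
  linarith

end DefiningFunction

/-! ### The unit disc -/

/-- The closed Euclidean unit disc. -/
def disc : Set (ℝ × ℝ) := {z | z.1 ^ 2 + z.2 ^ 2 ≤ 1}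

theorem isCompact_disc : IsCompact disc := by
  refine Metric.isCompact_of_isClosed_isBounded ?_ ?_
  · exact isClosed_le (by fun_prop) continuous_const
  · refine (Metric.isBounded_closedBall (x := (0 : ℝ × ℝ)) (r := 1)).subset fun z hz => ?_
    simp only [disc, mem_ofPred_eq] at hz
    rw [mem_closedBall_zero_iff, Prod.norm_def, max_le_iff, Real.norm_eq_abs, Real.norm_eq_abs]
    constructor <;> refine abs_le_of_sq_le_sq ?_ (by positivity) <;>
      nlinarith [sq_nonneg z.1, sq_nonneg z.2]

theorem norm_le_one_of_mem_disc {z : ℝ × ℝ} (hz : z ∈ disc) : ‖z‖ ≤ 1 := by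
  simp only [disc, mem_ofPred_eq] at hz
  rw [Prod.norm_def, max_le_iff, Real.norm_eq_abs, Real.norm_eq_abs]
  constructor <;> refine abs_le_of_sq_le_sq ?_ (by positivity) <;>
    nlinarith [sq_nonneg z.1, sq_nonneg z.2]

theorem frontier_disc : frontier disc = {z | z.1 ^ 2 + z.2 ^ 2 = 1} := by
  refine subset_antisymm (frontier_le_subset_eq (by fun_prop) continuous_const) fun z hz => ?_
  simp only [mem_ofPred_eq] at hz
  refine ⟨subset_closure hz.le, fun hint => ?_⟩
  have h1 : ∀ᶠ t : ℝ in 𝓝[>] 0, z + t • z ∈ disc :=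
    ((tendsto_line z z).mono_left nhdsWithin_le_nhds).eventually (mem_interior_iff_mem_nhds.1 hint)
  obtain ⟨t, ht, h0⟩ := (h1.and self_mem_nhdsWithin).exists
  simp only [disc, mem_ofPred_eq, Prod.fst_add, Prod.snd_add, Prod.smul_fst, Prod.smul_snd,
    smul_eq_mul] at ht
  have h0' : 0 < t := h0
  have h2 : (z.1 + t * z.1) ^ 2 + (z.2 + t * z.2) ^ 2 = (1 + t) ^ 2 := by
    linear_combination (1 + t) ^ 2 * hz
  nlinarith

theorem hasFDerivAt_normSq (z : ℝ × ℝ) :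
    HasFDerivAt (fun w : ℝ × ℝ => w.1 ^ 2 + w.2 ^ 2 - 1)
      ((2 * z.1) • ContinuousLinearMap.fst ℝ ℝ ℝ + (2 * z.2) • ContinuousLinearMap.snd ℝ ℝ ℝ) z := by
  refine (((hasFDerivAt_fst.pow 2).add (hasFDerivAt_snd.pow 2)).sub_const 1).congr_fderiv ?_
  ext <;> simp

theorem isLocalDefiningFunction_disc {z : ℝ × ℝ} (hz : z.1 ^ 2 + z.2 ^ 2 = 1) :
    IsLocalDefiningFunction disc (fun w => w.1 ^ 2 + w.2 ^ 2 - 1) z := by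
  refine ⟨by fun_prop, fun h0 => ?_, Eventually.of_forall fun w => ?_⟩
  · rw [(hasFDerivAt_normSq z).fderiv] at h0
    have := DFunLike.congr_fun h0 z
    simp at this
    nlinarith
  · simp [disc]

/-- Tangency may be tested with any defining function, so the kernel must be identified for all of
them. If `v` in the kernel pointed strictly inwards, so would `v + t • u` with `dg(u) > 0` and `t >
0` small, but inward directions do not increase `g`; the same applies to `-v`. -/
theorem inner_eq_zero_of_fderiv_eq_zero {g : ℝ × ℝ → ℝ} {z v : ℝ × ℝ}
    (hg : IsLocalDefiningFunction disc g z) (hz : z.1 ^ 2 + z.2 ^ 2 = 1)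
    (hv : fderiv ℝ g z v = 0) : z.1 * v.1 + z.2 * v.2 = 0 := by
  have hfr : z ∈ frontier disc := by rw [frontier_disc]; exact hz
  have key : ∀ v : ℝ × ℝ, z.1 * v.1 + z.2 * v.2 < 0 → fderiv ℝ g z v ≤ 0 := by
    intro v hv
    refine hg.fderiv_nonpos (hg.eq_zero hfr) ?_
    have h1 : ∀ᶠ t : ℝ in 𝓝 0, 2 * (z.1 * v.1 + z.2 * v.2) + t * (v.1 ^ 2 + v.2 ^ 2) < 0 := by
      have : Continuous fun t : ℝ => 2 * (z.1 * v.1 + z.2 * v.2) + t * (v.1 ^ 2 + v.2 ^ 2) := by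
        fun_prop
      exact this.continuousAt.eventually_lt continuousAt_const (by simp only [zero_mul]; linarith)
    filter_upwards [h1.filter_mono nhdsWithin_le_nhds, self_mem_nhdsWithin] with t ht h0
    have h0' : 0 < t := h0
    simp only [disc, mem_ofPred_eq, Prod.fst_add, Prod.snd_add, Prod.smul_fst, Prod.smul_snd,
      smul_eq_mul]
    nlinarith [mul_neg_of_pos_of_neg h0' ht]
  obtain ⟨u, hu⟩ : ∃ u, 0 < fderiv ℝ g z u := by
    obtain ⟨u, hu⟩ := DFunLike.ne_iff.1 hg.2.1
    rcases lt_or_gt_of_ne hu with h | h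
    · exact ⟨-u, by simpa using h⟩
    · exact ⟨u, by simpa using h⟩
  have key2 : ∀ v : ℝ × ℝ, fderiv ℝ g z v = 0 → 0 ≤ z.1 * v.1 + z.2 * v.2 := by
    intro v hv
    by_contra hneg
    have h1 : ∀ᶠ t : ℝ in 𝓝 0,
        z.1 * (v.1 + t * u.1) + z.2 * (v.2 + t * u.2) < 0 := by
      have : Continuous fun t : ℝ => z.1 * (v.1 + t * u.1) + z.2 * (v.2 + t * u.2) := by fun_prop
      exact this.continuousAt.eventually_lt continuousAt_const
        (by simp only [zero_mul, add_zero]; linarith)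
    obtain ⟨t, ht, h0⟩ :=
      ((h1.filter_mono nhdsWithin_le_nhds).and (self_mem_nhdsWithin (s := Ioi 0))).exists
    have h2 := key (v + t • u) (by simpa using ht)
    rw [map_add, map_smul, hv, zero_add, smul_eq_mul] at h2
    exact absurd h2 (not_le.2 (mul_pos h0 hu))
  have h1 := key2 v hv
  have h2 := key2 (-v) (by simpa using hv)
  simp only [Prod.fst_neg, Prod.snd_neg] at h2
  linarith

/-! ### The disc as an isolating block for the canonical field -/

section CanonicalBlock

variable {κ₁ κ₂ : ℝ} {γ : ℝ → ℝ × ℝ} {z w : ℝ × ℝ}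

theorem canonicalQuadratic_neg (z : ℝ × ℝ) :
    canonicalQuadratic κ₁ κ₂ (-z) = canonicalQuadratic κ₁ κ₂ z := by
  simp [canonicalQuadratic]

theorem isSolutionOn_one_smul {I : Set ℝ} {X : ℝ × ℝ → ℝ × ℝ} (h : IsSolutionOn X γ I) :
    IsSolutionOn (fun w => (fun _ : ℝ × ℝ => (1 : ℝ)) w • X w) γ I :=
  h.congr_field fun _ _ => (one_smul _ _).symm

theorem hasDerivWithinAt_normSq {I : Set ℝ} (h : IsSolutionOn (canonicalQuadratic κ₁ κ₂) γ I)
    {t : ℝ} (ht : t ∈ I) : HasDerivWithinAt (fun s => (γ s).1 ^ 2 + (γ s).2 ^ 2)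
      (2 * (κ₁ * (γ t).1 + κ₂ * (γ t).2) * ((γ t).1 ^ 2 + (γ t).2 ^ 2)) I t :=
  (hasDerivWithinAt_normSq_canonical (isSolutionOn_one_smul h) ht).congr_deriv (by ring)

/-- Tangencies are exterior: where `κ₁x + κ₂y = 0` on the circle, `-κ₁` times the derivative of this
form along the field equals `(κ₁² + κ₂²)y² > 0`. -/
theorem eventually_radial_neg (hκ : κ₁ < 0) {ε : ℝ} (hε : 0 < ε)
    (h : IsSolutionOn (canonicalQuadratic κ₁ κ₂) γ (Ioo (-ε) ε))
    (h1 : (γ 0).1 ^ 2 + (γ 0).2 ^ 2 = 1) (hl : κ₁ * (γ 0).1 + κ₂ * (γ 0).2 ≤ 0) :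
    ∀ᶠ t in 𝓝[<] 0, κ₁ * (γ t).1 + κ₂ * (γ t).2 < 0 := by
  have h0 : (0 : ℝ) ∈ Ioo (-ε) ε := by simp [hε]
  have hd := ((h.fst h0).const_mul κ₁).fun_add ((h.snd h0).const_mul κ₂)
  have hd' := (hd.hasDerivAt (Ioo_mem_nhds h0.1 h0.2))
  rcases hl.lt_or_eq with hlt | heq
  · exact (hd'.continuousAt.eventually_lt continuousAt_const hlt).filter_mono nhdsWithin_le_nhds
  · have := eventually_neg_of_hasDerivWithinAt hd'.hasDerivWithinAt ?_
    · simpa only [heq] using this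
    · simp only [canonicalQuadratic]
      set x := (γ 0).1
      set y := (γ 0).2
      have hy : y ≠ 0 := by
        intro hy
        rw [hy] at heq h1
        simp only [mul_zero, add_zero, mul_eq_zero, hκ.ne, false_or] at heq
        rw [heq] at h1
        norm_num at h1
      have h2 : (-κ₁) * (κ₁ * (κ₁ * x ^ 2 + κ₂ * (x * y) - y ^ 2) +
          κ₂ * ((κ₁ + 1) * (x * y) + κ₂ * y ^ 2)) = (κ₁ ^ 2 + κ₂ ^ 2) * y ^ 2 := by
        linear_combination (-κ₁ * (κ₁ * x + κ₂ * y) - κ₂ * y) * heq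
      have hκ0 := hκ.ne
      have h3 : 0 < (κ₁ ^ 2 + κ₂ ^ 2) * y ^ 2 := by positivity
      rw [← h2] at h3
      exact (pos_iff_pos_of_mul_pos h3).1 (by linarith)

theorem entrySet_disc (hκ : κ₁ < 0) : entrySet (canonicalQuadratic κ₁ κ₂) disc =
    {z | z.1 ^ 2 + z.2 ^ 2 = 1 ∧ κ₁ * z.1 + κ₂ * z.2 ≤ 0} := by
  ext z
  simp only [entrySet, frontier_disc, mem_ofPred_eq]
  refine and_congr_right fun hz => ⟨?_, fun hl => ?_⟩
  · rintro ⟨ε, hε, γ, hγ, rfl, hout⟩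
    by_contra hpos
    have h0 : (0 : ℝ) ∈ Ioo (-ε) ε := by simp [hε]
    have hd := (hasDerivWithinAt_normSq hγ h0).hasDerivAt (Ioo_mem_nhds h0.1 h0.2)
    rw [hz, mul_one] at hd
    have h1 := eventually_neg_of_hasDerivWithinAt hd.hasDerivWithinAt
      (by linarith)
    obtain ⟨t, ht, ht'⟩ := (h1.and (Ioo_mem_nhdsLT (neg_lt_zero.2 hε))).exists
    refine hout t ht' ?_
    simp only [disc, mem_ofPred_eq]
    linarith
  · obtain ⟨ε, hε, γ, hγ, rfl⟩ := exists_isSolutionOn_Ioo (contDiff_canonicalQuadratic κ₁ κ₂) z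
    have hev := eventually_radial_neg hκ hε hγ hz hl
    obtain ⟨a, ha, hev⟩ := (mem_nhdsLT_iff_exists_Ioo_subset).1 hev
    have ha0 : a < 0 := ha
    refine ⟨min ε (-a), lt_min hε (by linarith), γ, hγ.mono ?_, rfl, fun t ht hin => ?_⟩
    · exact Ioo_subset_Ioo (neg_le_neg (min_le_left _ _)) (min_le_left _ _)
    · have hta : a < t := by linarith [ht.1, min_le_right ε (-a)]
      have hte : -ε < t := by linarith [ht.1, min_le_left ε (-a)]
      have hsub : Icc t 0 ⊆ Ioo (-ε) ε := fun s hs => ⟨by linarith [hs.1], by linarith [hs.2]⟩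
      have hNpos : ∀ s ∈ Icc t 0, 0 ≤ (γ s).1 ^ 2 + (γ s).2 ^ 2 := fun s _ => by positivity
      -- If `γ t` were in the disc, the nonincreasing squared norm would equal `1` on `[t, 0]`,
      -- against its strictly negative derivative at `t`.
      have hanti := antitoneOn_of_hasDerivWithinAt (ordConnected_Icc (a := t) (b := 0))
        (fun s hs => (hasDerivWithinAt_normSq (hγ.mono hsub) hs)) fun s hs => ?_
      · have hlt : ∀ s ∈ Icc t 0, (γ s).1 ^ 2 + (γ s).2 ^ 2 = 1 := fun s hs => by
          have h1 := hanti (left_mem_Icc.2 ht.2.le) hs hs.1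
          have h2 := hanti hs (right_mem_Icc.2 ht.2.le) hs.2
          simp only [disc, mem_ofPred_eq] at hin
          simp only [hz] at h1 h2
          linarith
        have hd1 := ((hasDerivWithinAt_normSq (hγ.mono hsub)
          (left_mem_Icc.2 ht.2.le)).mono (t := Icc t 0) subset_rfl)
        have hd2 : HasDerivWithinAt (fun s => (γ s).1 ^ 2 + (γ s).2 ^ 2) 0 (Icc t 0) t :=
          (hasDerivWithinAt_const t (Icc t 0) (1 : ℝ)).congr (fun s hs => hlt s hs)
            (hlt t (left_mem_Icc.2 ht.2.le))
        have hd3 := (uniqueDiffOn_Icc ht.2 t (left_mem_Icc.2 ht.2.le)).eq_deriv _ hd1 hd2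
        rw [hlt t (left_mem_Icc.2 ht.2.le), mul_one] at hd3
        have := hev ⟨hta, ht.2⟩
        simp only [mem_ofPred_eq] at this
        linarith
      · have h1 : κ₁ * (γ s).1 + κ₂ * (γ s).2 ≤ 0 := by
          rcases hs.2.lt_or_eq with h | h
          · exact le_of_lt (hev ⟨by linarith [hs.1], h⟩)
          · rw [h]; exact hl
        nlinarith [hNpos s hs]

theorem neg_mem_disc : -z ∈ disc ↔ z ∈ disc := by simp [disc]

/-- The field is even, so the central symmetry reverses time and exchanges entry and exit. -/
theorem IsSolutionOn.neg_comp_neg {I J : Set ℝ}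
    (h : IsSolutionOn (canonicalQuadratic κ₁ κ₂) γ I) (hJ : ∀ t ∈ J, -t ∈ I) :
    IsSolutionOn (canonicalQuadratic κ₁ κ₂) (fun t => -γ (-t)) J := fun t ht => by
  have h1 := ((h (-t) (hJ t ht)).scomp t ((hasDerivWithinAt_id t J).fun_neg) hJ).fun_neg
  refine h1.congr_deriv ?_
  simp only [canonicalQuadratic_neg]
  simp

theorem neg_mem_entrySet_disc : -z ∈ entrySet (canonicalQuadratic κ₁ κ₂) disc ↔
    z ∈ exitSet (canonicalQuadratic κ₁ κ₂) disc := by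
  simp only [entrySet, exitSet, frontier_disc, mem_ofPred_eq, Prod.fst_neg, Prod.snd_neg, neg_sq]
  refine and_congr_right fun hz => ⟨?_, ?_⟩
  · rintro ⟨ε, hε, γ, hγ, h0, hout⟩
    refine ⟨ε, hε, _, hγ.neg_comp_neg (J := Ioo (-ε) ε) fun t ht => ?_, by simp [h0], fun t ht => ?_⟩
    · exact ⟨by linarith [ht.2], by linarith [ht.1]⟩
    · rw [neg_mem_disc]
      exact hout _ ⟨by linarith [ht.2], by linarith [ht.1]⟩
  · rintro ⟨ε, hε, γ, hγ, h0, hout⟩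
    refine ⟨ε, hε, _, hγ.neg_comp_neg (J := Ioo (-ε) ε) fun t ht => ?_, by simp [h0], fun t ht => ?_⟩
    · exact ⟨by linarith [ht.2], by linarith [ht.1]⟩
    · rw [neg_mem_disc]
      exact hout _ ⟨by linarith [ht.2], by linarith [ht.1]⟩

theorem exitSet_disc (hκ : κ₁ < 0) : exitSet (canonicalQuadratic κ₁ κ₂) disc =
    {z | z.1 ^ 2 + z.2 ^ 2 = 1 ∧ 0 ≤ κ₁ * z.1 + κ₂ * z.2} := by
  ext z
  rw [← neg_mem_entrySet_disc, entrySet_disc hκ]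
  simp only [mem_ofPred_eq, Prod.fst_neg, Prod.snd_neg, neg_sq]
  refine and_congr_right fun hz => ?_
  constructor <;> intro h <;> linarith

theorem tangencySet_disc : tangencySet (canonicalQuadratic κ₁ κ₂) disc =
    {z | z.1 ^ 2 + z.2 ^ 2 = 1 ∧ κ₁ * z.1 + κ₂ * z.2 = 0} := by
  ext z
  simp only [tangencySet, frontier_disc, mem_ofPred_eq]
  refine and_congr_right fun hz => ?_
  have key : z.1 * (canonicalQuadratic κ₁ κ₂ z).1 + z.2 * (canonicalQuadratic κ₁ κ₂ z).2 =
      (κ₁ * z.1 + κ₂ * z.2) := by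
    simp only [canonicalQuadratic]
    linear_combination (κ₁ * z.1 + κ₂ * z.2) * hz
  constructor
  · rintro ⟨g, hg, h0⟩
    rw [← key]
    exact inner_eq_zero_of_fderiv_eq_zero hg hz h0
  · intro hl
    refine ⟨_, isLocalDefiningFunction_disc hz, ?_⟩
    rw [(hasFDerivAt_normSq z).fderiv]
    simp only [add_apply, smul_apply,
      ContinuousLinearMap.coe_fst', ContinuousLinearMap.coe_snd', smul_eq_mul]
    linear_combination 2 * key + 2 * hl

theorem isIsolatingBlock_disc (hκ : κ₁ < 0) :
    IsIsolatingBlock (canonicalQuadratic κ₁ κ₂) disc := by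
  refine ⟨⟨isCompact_disc, fun z hz => ?_⟩, ?_, ?_, ?_⟩
  · rw [frontier_disc] at hz
    exact ⟨_, isLocalDefiningFunction_disc hz⟩
  · rw [entrySet_disc hκ, exitSet_disc hκ, frontier_disc]
    ext z
    simp only [mem_union, mem_ofPred_eq, ← and_or_left]
    exact and_iff_left (le_total _ _)
  · rw [entrySet_disc hκ, exitSet_disc hκ, tangencySet_disc]
    ext z
    simp only [mem_inter_iff, mem_ofPred_eq]
    constructor
    · rintro ⟨⟨h1, h2⟩, -, h3⟩; exact ⟨h1, le_antisymm h2 h3⟩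
    · rintro ⟨h1, h2⟩; exact ⟨⟨h1, h2.le⟩, h1, h2.ge⟩
  · rw [tangencySet_disc]
    set r := Real.sqrt (κ₁ ^ 2 + κ₂ ^ 2)
    have hκ0 := hκ.ne
    have hpos : 0 < κ₁ ^ 2 + κ₂ ^ 2 := by positivity
    have hr : r ^ 2 = κ₁ ^ 2 + κ₂ ^ 2 := Real.sq_sqrt hpos.le
    have hr0 : r ≠ 0 := (Real.sqrt_pos.2 hpos).ne'
    refine (Set.toFinite {(-κ₂ / r, κ₁ / r), (κ₂ / r, -κ₁ / r)}).subset fun z hz => ?_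
    obtain ⟨h1, h2⟩ := hz
    have hx : κ₁ * z.1 = -κ₂ * z.2 := by linarith
    have h3 : (z.2 * r - κ₁) * (z.2 * r + κ₁) = 0 := by
      have : κ₁ ^ 2 * (z.1 ^ 2 + z.2 ^ 2) = κ₁ ^ 2 := by rw [h1, mul_one]
      linear_combination z.2 ^ 2 * hr + this - (κ₁ * z.1 - κ₂ * z.2) * hx
    have hx' : ∀ c : ℝ, z.2 = c * κ₁ → z.1 = -κ₂ * c := fun c hc => by
      rw [hc] at hx
      refine mul_left_cancel₀ hκ.ne ?_
      linear_combination hx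
    rcases mul_eq_zero.1 h3 with h | h
    · left
      have h2 : z.2 = (1 / r) * κ₁ := by field_simp; linarith
      ext
      · rw [hx' _ h2]; ring
      · rw [h2]; ring
    · right
      have h2 : z.2 = (-1 / r) * κ₁ := by field_simp; linarith
      ext
      · rw [hx' _ h2]; ring
      · rw [h2]; ring

end CanonicalBlock

/-! ### The map across the disc -/

section Crossing

variable {κ₁ κ₂ : ℝ} {γ : ℝ → ℝ × ℝ} {z w : ℝ × ℝ}

theorem abs_mul_arctan_le (κ w : ℝ) : |κ * Real.arctan w| ≤ |κ| * (Real.pi / 2) := by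
  have h1 : |Real.arctan w| ≤ Real.pi / 2 :=
    abs_le.2 ⟨(Real.neg_pi_div_two_lt_arctan _).le, (Real.arctan_lt_pi_div_two _).le⟩
  rw [abs_mul]; gcongr

theorem canonicalIntegral_eq' {I : Set ℝ} (hI : I.OrdConnected)
    (h : IsSolutionOn (canonicalQuadratic κ₁ κ₂) γ I) {a b : ℝ} (ha : a ∈ I)
    (hb : b ∈ I) (hy : (γ a).2 ≠ 0) :
    canonicalIntegral κ₁ κ₂ (γ a) = canonicalIntegral κ₁ κ₂ (γ b) :=
  canonicalIntegral_eq hI continuous_const (isSolutionOn_one_smul h) ha hb hy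

theorem snd_canonical_eq_mul' {I : Set ℝ} (hI : I.OrdConnected)
    (h : IsSolutionOn (canonicalQuadratic κ₁ κ₂) γ I) {a b : ℝ} (ha : a ∈ I)
    (hb : b ∈ I) : ∃ c > 0, (γ b).2 = (γ a).2 * c :=
  snd_canonical_eq_mul hI continuous_const (isSolutionOn_one_smul h) ha hb

/-- With `N = x² + y² ≤ 1`, bound `(1 + κ₁)/2 · log N` above by `0` if `1 + κ₁ ≥ 0`, and by `(1 +
κ₁) log |y|` otherwise. Either way a positive multiple of `log |y|`, with factor `-κ₁` or `1`, is
bounded below; hence the minimum in `δ`. -/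
theorem exists_le_abs_snd (hκ : κ₁ < 0) (G : ℝ) : ∃ δ > 0, ∀ z : ℝ × ℝ, z ∈ disc → z.2 ≠ 0 →
    canonicalIntegral κ₁ κ₂ z = G → δ ≤ |z.2| := by
  set C := G - |κ₂| * (Real.pi / 2) with hC
  refine ⟨Real.exp (min (C / (-κ₁)) C), Real.exp_pos _, fun z hz hy hG => ?_⟩
  have hy' : 0 < |z.2| := abs_pos.2 hy
  rw [← Real.le_log_iff_exp_le hy', Real.log_abs]
  have harc := (abs_le.1 (abs_mul_arctan_le κ₂ (z.1 / z.2))).2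
  rw [canonicalIntegral] at hG
  have hN0 : 0 < z.1 ^ 2 + z.2 ^ 2 := by positivity
  have hN : Real.log (z.1 ^ 2 + z.2 ^ 2) ≤ 0 := Real.log_nonpos hN0.le hz
  have hlog : 2 * Real.log z.2 ≤ Real.log (z.1 ^ 2 + z.2 ^ 2) := by
    have : Real.log (z.2 ^ 2) ≤ Real.log (z.1 ^ 2 + z.2 ^ 2) :=
      Real.log_le_log (by positivity) (by nlinarith)
    simpa using this
  rcases le_total 0 (1 + κ₁) with h | h
  · refine (min_le_left _ _).trans ?_
    rw [div_le_iff₀ (by linarith)]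
    nlinarith [mul_nonneg h (neg_nonneg.2 hN)]
  · refine (min_le_right _ _).trans ?_
    nlinarith [mul_nonneg (neg_nonneg.2 h) (sub_nonneg.2 hlog)]

/-- Off the invariant line every orbit leaves the disc in forward time. -/
theorem not_mem_disc_forever (hκ : κ₁ < 0)
    (h : IsSolutionOn (canonicalQuadratic κ₁ κ₂) γ (Ici 0)) (hy : (γ 0).2 ≠ 0)
    (hd : ∀ t ∈ Ici (0 : ℝ), γ t ∈ disc) : False := by
  have h0 : (0 : ℝ) ∈ Ici (0 : ℝ) := mem_Ici.2 le_rfl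
  obtain ⟨δ, hδ, hle⟩ := exists_le_abs_snd (κ₂ := κ₂) hκ (canonicalIntegral κ₁ κ₂ (γ 0))
  have hmul : ∀ t ∈ Ici (0 : ℝ), ∃ c > 0, (γ t).2 = (γ 0).2 * c := fun t ht =>
    snd_canonical_eq_mul' ordConnected_Ici h h0 ht
  have hne : ∀ t ∈ Ici (0 : ℝ), (γ t).2 ≠ 0 := fun t ht => by
    obtain ⟨c, hc, hct⟩ := hmul t ht
    rw [hct]; positivity
  have habs : ∀ t ∈ Ici (0 : ℝ), δ ≤ |(γ t).2| := fun t ht =>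
    hle _ (hd t ht) (hne t ht) (canonicalIntegral_eq' ordConnected_Ici h h0 ht hy).symm
  have harc : ∀ t ∈ Ici (0 : ℝ), HasDerivWithinAt (fun s => Real.arctan ((γ s).1 / (γ s).2))
      (-(γ t).2) (Ici 0) t := fun t ht =>
    (hasDerivWithinAt_arctan_canonical (isSolutionOn_one_smul h) ht (hne t ht)).congr_deriv
      (by simp)
  have hbd : ∀ w, |Real.arctan w| ≤ Real.pi / 2 := fun w =>
    abs_le.2 ⟨(Real.neg_pi_div_two_lt_arctan _).le, (Real.arctan_lt_pi_div_two _).le⟩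
  -- The bounded angle `arctan (x / y)` has derivative `-y`, of constant sign and modulus at least
  -- `δ`.
  rcases lt_or_gt_of_ne hy with hneg | hpos
  · refine not_bounded_of_le_hasDerivWithinAt hδ harc (fun t ht => ?_) fun t _ => hbd _
    obtain ⟨c, hc, hct⟩ := hmul t ht
    have : (γ t).2 < 0 := by rw [hct]; exact mul_neg_of_neg_of_pos hneg hc
    rw [← abs_of_neg this]; exact habs t ht
  · refine not_bounded_of_le_hasDerivWithinAt hδ (fun t ht => (harc t ht).fun_neg)
      (fun t ht => ?_) fun t _ => (abs_neg _).trans_le (hbd ((γ t).1 / (γ t).2))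
    obtain ⟨c, hc, hct⟩ := hmul t ht
    have : 0 < (γ t).2 := by rw [hct]; exact mul_pos hpos hc
    rw [neg_neg, ← abs_of_pos this]; exact habs t ht

theorem exists_crossesTo_disc (hκ : κ₁ < 0) (hz : z ∈ entrySet (canonicalQuadratic κ₁ κ₂) disc)
    (hy : z.2 ≠ 0) : ∃ w, CrossesTo (canonicalQuadratic κ₁ κ₂) disc z w := by
  obtain ⟨χ, K, L, -, hχ1, hK, hL⟩ :=
    exists_lipschitz_cutoff (contDiff_canonicalQuadratic κ₁ κ₂) 1
  obtain ⟨γ, hγ, h0⟩ := exists_isSolutionOn_univ_of_lipschitz hK hL z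
  have hχd : ∀ w ∈ disc, χ w = 1 := fun w hw => hχ1 w (norm_le_one_of_mem_disc hw)
  have hcont : Continuous γ := continuousOn_univ.1 hγ.continuousOn
  have hzd : z ∈ disc := by
    rw [entrySet_disc hκ] at hz
    exact hz.1.le
  -- The crossing ends at `sInf S`: if the radius there were below one, or the radial rate negative,
  -- the orbit would remain in the disc a little longer.
  set S : Set ℝ := {t | 0 ≤ t ∧ γ t ∉ disc} with hS
  have hne : S.Nonempty := by
    by_contra hemp
    rw [not_nonempty_iff_eq_empty] at hemp
    have hin : ∀ t ∈ Ici (0 : ℝ), γ t ∈ disc := fun t ht => by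
      by_contra hout
      have : t ∈ S := ⟨ht, hout⟩
      rw [hemp] at this
      exact this
    refine not_mem_disc_forever (κ₂ := κ₂) hκ ((hγ.mono (subset_univ (Ici 0))).congr_field fun t ht => ?_)
      (by rwa [h0]) hin
    rw [hχd _ (hin t ht), one_smul]
  have hbdd : BddBelow S := ⟨0, fun t ht => ht.1⟩
  set τ := sInf S with hτ
  have hτ0 : 0 ≤ τ := le_csInf hne fun t ht => ht.1
  have hbefore : ∀ t, 0 ≤ t → t < τ → γ t ∈ disc := fun t ht htτ => by
    by_contra hout
    exact absurd (csInf_le hbdd (show t ∈ S from ⟨ht, hout⟩)) (not_le.2 htτ)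
  have hτd : γ τ ∈ disc := by
    rcases hτ0.eq_or_lt with h | h
    · rw [← h, h0]; exact hzd
    · refine isCompact_disc.isClosed.mem_of_frequently_of_tendsto (b := 𝓝[<] τ) (f := γ) ?_
        (hcont.continuousAt.tendsto.mono_left nhdsWithin_le_nhds)
      refine Eventually.frequently ?_
      filter_upwards [Ioo_mem_nhdsLT h] with t ht
      exact hbefore t ht.1.le ht.2
  have hall : ∀ t ∈ Icc 0 τ, γ t ∈ disc := fun t ht => by
    rcases ht.2.lt_or_eq with h | h
    · exact hbefore t ht.1 h
    · rw [h]; exact hτd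
  have hfreq : ∃ᶠ t in 𝓝[>] τ, γ t ∉ disc := by
    intro hev
    obtain ⟨b, hb, hsub⟩ := mem_nhdsGT_iff_exists_Ioo_subset.1 hev
    obtain ⟨t, ht, htb⟩ := exists_lt_of_csInf_lt hne (show sInf S < b from hb)
    rcases (csInf_le hbdd ht).lt_or_eq with h | h
    · exact hsub ⟨h, htb⟩ ht.2
    · exact ht.2 (h ▸ hτd)
  have hd := (hasDerivWithinAt_normSq_canonical hγ (mem_univ τ)).hasDerivAt univ_mem
  rw [hχd _ hτd, mul_one] at hd
  have hτ1 : (γ τ).1 ^ 2 + (γ τ).2 ^ 2 = 1 := by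
    rcases (show (γ τ).1 ^ 2 + (γ τ).2 ^ 2 ≤ 1 from hτd).lt_or_eq with h | h
    · exfalso
      refine hfreq ?_
      have := hd.continuousAt.eventually_lt continuousAt_const h
      filter_upwards [this.filter_mono nhdsWithin_le_nhds] with t ht
      exact not_not.2 ht.le
    · exact h
  have hτl : 0 ≤ κ₁ * (γ τ).1 + κ₂ * (γ τ).2 := by
    by_contra hneg
    refine hfreq ?_
    have := eventually_pos_of_hasDerivWithinAt hd.fun_neg.hasDerivWithinAt
      (by rw [hτ1]; linarith)
    filter_upwards [this] with t ht
    rw [hτ1] at ht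
    refine not_not.2 (show (γ t).1 ^ 2 + (γ t).2 ^ 2 ≤ 1 from ?_)
    linarith
  refine ⟨γ τ, hz, ?_, τ, hτ0, γ, ?_, h0, rfl, hall⟩
  · rw [exitSet_disc hκ]
    exact ⟨hτ1, hτl⟩
  · refine (hγ.mono (subset_univ _)).congr_field fun t ht => ?_
    rw [hχd _ (hall t ht), one_smul]

/-- A continuous function whose level sets on the unit circle are preserved by the map across
the disc. -/
noncomputable def crossingFun (κ₁ κ₂ : ℝ) (z : ℝ × ℝ) : ℝ :=
  z.2 / |z.2| * (|z.2| ^ (-κ₁) * Real.exp (κ₂ * Real.arctan (z.1 / z.2)))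

theorem crossingFun_neg (z : ℝ × ℝ) : crossingFun κ₁ κ₂ (-z) = -crossingFun κ₁ κ₂ z := by
  rw [crossingFun, crossingFun, Prod.fst_neg, Prod.snd_neg, neg_div_neg_eq, abs_neg, neg_div,
    neg_mul]

theorem crossingFun_of_snd_eq_zero (hy : z.2 = 0) : crossingFun κ₁ κ₂ z = 0 := by
  simp [crossingFun, hy]

theorem crossingFun_of_circle (hz : z.1 ^ 2 + z.2 ^ 2 = 1) (hy : z.2 ≠ 0) :
    crossingFun κ₁ κ₂ z = z.2 / |z.2| * Real.exp (canonicalIntegral κ₁ κ₂ z) := by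
  rw [crossingFun, canonicalIntegral, hz, Real.rpow_def_of_pos (abs_pos.2 hy), ← Real.exp_add,
    Real.log_abs]
  congr 2
  simp
  ring

theorem crossingFun_pos_iff : 0 < crossingFun κ₁ κ₂ z ↔ 0 < z.2 := by
  rcases lt_trichotomy z.2 0 with h | h | h
  · rw [crossingFun, abs_of_neg h, div_neg_self h.ne]
    have : 0 < (-z.2) ^ (-κ₁) := Real.rpow_pos_of_pos (by linarith) _
    have h2 : 0 < (-z.2) ^ (-κ₁) * Real.exp (κ₂ * Real.arctan (z.1 / z.2)) := by positivity
    constructor <;> intro _ <;> linarith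
  · rw [crossingFun_of_snd_eq_zero h, h]
  · rw [crossingFun, abs_of_pos h, div_self h.ne', one_mul]
    have : 0 < z.2 ^ (-κ₁) := Real.rpow_pos_of_pos h _
    exact iff_of_true (by positivity) h

/-- The sign factor jumps at `y = 0`, but `|y| ^ (-κ₁)` tends to `0` there and the exponential
factor is bounded. -/
theorem continuous_crossingFun (hκ : κ₁ < 0) : Continuous (crossingFun κ₁ κ₂) := by
  rw [continuous_iff_continuousAt]
  intro z
  by_cases hy : z.2 = 0
  · rw [ContinuousAt, crossingFun_of_snd_eq_zero hy]
    have hlim : Tendsto (fun w : ℝ × ℝ => |w.2| ^ (-κ₁) * Real.exp (|κ₂| * (Real.pi / 2)))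
        (𝓝 z) (𝓝 0) := by
      have : Continuous fun w : ℝ × ℝ => |w.2| ^ (-κ₁) * Real.exp (|κ₂| * (Real.pi / 2)) :=
        (continuous_snd.abs.rpow_const fun _ => Or.inr (by linarith)).mul continuous_const
      have h := this.tendsto z
      simp only [hy, abs_zero] at h
      rwa [Real.zero_rpow (by linarith), zero_mul] at h
    refine squeeze_zero_norm (fun w => ?_) hlim
    rw [crossingFun, Real.norm_eq_abs, abs_mul, abs_mul, abs_div, abs_abs, Real.abs_exp,
      abs_of_nonneg (Real.rpow_nonneg (abs_nonneg w.2) _)]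
    have h1 : |w.2| / |w.2| ≤ 1 := div_self_le_one _
    have h2 : Real.exp (κ₂ * Real.arctan (w.1 / w.2)) ≤ Real.exp (|κ₂| * (Real.pi / 2)) :=
      Real.exp_le_exp.2 (abs_le.1 (abs_mul_arctan_le _ _)).2
    have h3 : 0 ≤ |w.2| ^ (-κ₁) := Real.rpow_nonneg (abs_nonneg w.2) _
    calc |w.2| / |w.2| * (|w.2| ^ (-κ₁) * Real.exp (κ₂ * Real.arctan (w.1 / w.2)))
        ≤ 1 * (|w.2| ^ (-κ₁) * Real.exp (|κ₂| * (Real.pi / 2))) := by gcongr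
      _ = _ := one_mul _
  · have hy' : |z.2| ≠ 0 := abs_ne_zero.2 hy
    have h1 : ContinuousAt (fun w : ℝ × ℝ => |w.2| ^ (-κ₁)) z :=
      (continuous_snd.abs.continuousAt).rpow_const (Or.inl hy')
    have h2 : ContinuousAt (fun w : ℝ × ℝ => w.2 / |w.2|) z :=
      continuous_snd.continuousAt.div continuous_snd.abs.continuousAt hy'
    have h3 : ContinuousAt (fun w : ℝ × ℝ => Real.exp (κ₂ * Real.arctan (w.1 / w.2))) z := by
      have : ContinuousAt (fun w : ℝ × ℝ => w.1 / w.2) z :=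
        continuous_fst.continuousAt.div continuous_snd.continuousAt hy
      exact (continuousAt_const.mul (Real.continuous_arctan.continuousAt.comp this)).rexp
    exact h2.mul (h1.mul h3)

/-- The logarithm of `crossingFun` on the unit circle, as a function of the slope `x / y`. -/
noncomputable def slopeFun (κ₁ κ₂ w : ℝ) : ℝ :=
  κ₁ / 2 * Real.log (1 + w ^ 2) + κ₂ * Real.arctan w

theorem hasDerivAt_slopeFun (w : ℝ) :
    HasDerivAt (slopeFun κ₁ κ₂) ((κ₁ * w + κ₂) / (1 + w ^ 2)) w := by
  have h1 : (1 : ℝ) + w ^ 2 ≠ 0 := by positivity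
  refine (((((hasDerivAt_id w).fun_pow 2).const_add 1).log h1).const_mul (κ₁ / 2)
    |>.fun_add ((Real.hasDerivAt_arctan w).const_mul κ₂)).congr_deriv ?_
  simp
  field_simp

theorem slopeFun_strictAntiOn (hκ : κ₁ < 0) :
    StrictAntiOn (slopeFun κ₁ κ₂) (Ici (κ₂ / (-κ₁))) := by
  refine strictAntiOn_of_hasDerivWithinAt_neg (convex_Ici _)
    (fun w _ => (hasDerivAt_slopeFun w).continuousAt.continuousWithinAt)
    (fun w _ => (hasDerivAt_slopeFun w).hasDerivWithinAt) fun w hw => ?_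
  rw [interior_Ici, mem_Ioi, div_lt_iff₀ (by linarith)] at hw
  exact div_neg_of_neg_of_pos (by linarith) (by positivity)

theorem slopeFun_strictMonoOn (hκ : κ₁ < 0) :
    StrictMonoOn (slopeFun κ₁ κ₂) (Iic (κ₂ / (-κ₁))) := by
  refine strictMonoOn_of_hasDerivWithinAt_pos (convex_Iic _)
    (fun w _ => (hasDerivAt_slopeFun w).continuousAt.continuousWithinAt)
    (fun w _ => (hasDerivAt_slopeFun w).hasDerivWithinAt) fun w hw => ?_
  rw [interior_Iic, mem_Iio, lt_div_iff₀ (by linarith)] at hw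
  exact div_pos (by linarith) (by positivity)

theorem canonicalIntegral_of_circle (hz : z.1 ^ 2 + z.2 ^ 2 = 1) (hy : z.2 ≠ 0) :
    canonicalIntegral κ₁ κ₂ z = slopeFun κ₁ κ₂ (z.1 / z.2) := by
  have h1 : 1 + (z.1 / z.2) ^ 2 = (z.2 ^ 2)⁻¹ := by
    field_simp; linarith
  rw [canonicalIntegral, slopeFun, hz, h1, Real.log_inv, Real.log_pow, Real.log_one]
  push_cast
  ring

/-- The value determines the sign of `y`. On each of the two signs, entry points have slopes `x / y`
on one side of the tangency slope `κ₂ / (-κ₁)`, where `slopeFun` is strictly monotone; on `y = 0`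
there is a single entry point. -/
theorem injOn_crossingFun_entrySet (hκ : κ₁ < 0) :
    InjOn (crossingFun κ₁ κ₂) (entrySet (canonicalQuadratic κ₁ κ₂) disc) := by
  rw [entrySet_disc hκ]
  intro z hz w hw h
  obtain ⟨hz1, hzl⟩ := hz
  obtain ⟨hw1, hwl⟩ := hw
  have hpos : 0 < z.2 ↔ 0 < w.2 := by
    rw [← crossingFun_pos_iff (κ₁ := κ₁) (κ₂ := κ₂), h, crossingFun_pos_iff]
  have hneg : z.2 < 0 ↔ w.2 < 0 := by
    have h1 := crossingFun_pos_iff (κ₁ := κ₁) (κ₂ := κ₂) (z := -z)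
    have h2 := crossingFun_pos_iff (κ₁ := κ₁) (κ₂ := κ₂) (z := -w)
    rw [crossingFun_neg, h, ← crossingFun_neg, h2] at h1
    simpa using h1.symm
  have key : z.2 ≠ 0 → w.2 ≠ 0 → z.2 / |z.2| = w.2 / |w.2| → z.1 / z.2 = w.1 / w.2 → z = w := by
    intro hz0 hw0 hs hr
    have h1 : z.2 ^ 2 = w.2 ^ 2 := by
      have e1 : 1 + (z.1 / z.2) ^ 2 = (z.2 ^ 2)⁻¹ := by field_simp; linarith
      have e2 : 1 + (w.1 / w.2) ^ 2 = (w.2 ^ 2)⁻¹ := by field_simp; linarith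
      rw [hr, e2] at e1
      exact inv_injective e1.symm
    have h2 : |z.2| = |w.2| := (sq_eq_sq_iff_abs_eq_abs _ _).1 h1
    have h3 : z.2 = w.2 := by
      rw [h2] at hs
      exact (div_left_inj' (abs_ne_zero.2 hw0)).1 hs
    ext
    · rw [h3] at hr
      exact (div_left_inj' hw0).1 hr
    · exact h3
  have hslope : z.2 ≠ 0 → w.2 ≠ 0 → z.2 / |z.2| = w.2 / |w.2| →
      slopeFun κ₁ κ₂ (z.1 / z.2) = slopeFun κ₁ κ₂ (w.1 / w.2) := by
    intro hz0 hw0 hs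
    rw [crossingFun_of_circle hz1 hz0, crossingFun_of_circle hw1 hw0, hs] at h
    have : w.2 / |w.2| ≠ 0 := div_ne_zero hw0 (abs_ne_zero.2 hw0)
    have := Real.exp_injective (mul_left_cancel₀ this h)
    rwa [canonicalIntegral_of_circle hz1 hz0, canonicalIntegral_of_circle hw1 hw0] at this
  rcases lt_trichotomy z.2 0 with hz2 | hz2 | hz2
  · have hw2 := hneg.1 hz2
    have hs : z.2 / |z.2| = w.2 / |w.2| := by
      rw [abs_of_neg hz2, abs_of_neg hw2, div_neg_self hz2.ne, div_neg_self hw2.ne]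
    refine key hz2.ne hw2.ne hs ((slopeFun_strictMonoOn hκ).injOn ?_ ?_ (hslope hz2.ne hw2.ne hs))
    · rw [mem_Iic, le_div_iff₀ (by linarith), div_mul_eq_mul_div, div_le_iff_of_neg hz2]
      linarith
    · rw [mem_Iic, le_div_iff₀ (by linarith), div_mul_eq_mul_div, div_le_iff_of_neg hw2]
      linarith
  · have hw2 : w.2 = 0 :=
      le_antisymm (not_lt.1 fun h => (hpos.2 h).ne' hz2) (not_lt.1 fun h => (hneg.2 h).ne hz2)
    have h1 : ∀ u : ℝ × ℝ, u.1 ^ 2 + u.2 ^ 2 = 1 → κ₁ * u.1 + κ₂ * u.2 ≤ 0 → u.2 = 0 →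
        u.1 = 1 := by
      intro u h1 h2 h3
      rw [h3] at h1 h2
      have : 0 ≤ u.1 := by nlinarith
      nlinarith
    ext
    · rw [h1 z hz1 hzl hz2, h1 w hw1 hwl hw2]
    · rw [hz2, hw2]
  · have hw2 := hpos.1 hz2
    have hs : z.2 / |z.2| = w.2 / |w.2| := by
      rw [abs_of_pos hz2, abs_of_pos hw2, div_self hz2.ne', div_self hw2.ne']
    refine key hz2.ne' hw2.ne' hs
      ((slopeFun_strictAntiOn hκ).injOn ?_ ?_ (hslope hz2.ne' hw2.ne' hs))
    · rw [mem_Ici, div_le_iff₀ (by linarith), div_mul_eq_mul_div, le_div_iff₀ hz2]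
      linarith
    · rw [mem_Ici, div_le_iff₀ (by linarith), div_mul_eq_mul_div, le_div_iff₀ hw2]
      linarith

theorem injOn_crossingFun_exitSet (hκ : κ₁ < 0) :
    InjOn (crossingFun κ₁ κ₂) (exitSet (canonicalQuadratic κ₁ κ₂) disc) := by
  intro z hz w hw h
  refine neg_injective (injOn_crossingFun_entrySet hκ (neg_mem_entrySet_disc.2 hz)
    (neg_mem_entrySet_disc.2 hw) ?_)
  rw [crossingFun_neg, crossingFun_neg, h]

theorem CrossesTo.crossingFun_eq (hκ : κ₁ < 0)
    (h : CrossesTo (canonicalQuadratic κ₁ κ₂) disc z w) (hy : z.2 ≠ 0) :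
    crossingFun κ₁ κ₂ w = crossingFun κ₁ κ₂ z := by
  obtain ⟨hz, hw, τ, hτ, γ, hγ, rfl, rfl, -⟩ := h
  rw [entrySet_disc hκ] at hz
  rw [exitSet_disc hκ] at hw
  obtain ⟨c, hc, hcτ⟩ := snd_canonical_eq_mul' ordConnected_Icc hγ
    (left_mem_Icc.2 hτ) (right_mem_Icc.2 hτ)
  have hint := canonicalIntegral_eq' ordConnected_Icc hγ
    (left_mem_Icc.2 hτ) (right_mem_Icc.2 hτ) hy
  have hy' : (γ τ).2 ≠ 0 := by rw [hcτ]; positivity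
  rw [crossingFun_of_circle hz.1 hy, crossingFun_of_circle hw.1 hy', hint, hcτ, abs_mul,
    abs_of_pos hc, mul_div_mul_right _ _ hc.ne']

theorem fst_eq_one_of_entrySet (hκ : κ₁ < 0)
    (hz : z ∈ entrySet (canonicalQuadratic κ₁ κ₂) disc) (hy : z.2 = 0) : z = (1, 0) := by
  rw [entrySet_disc hκ] at hz
  obtain ⟨h1, h2⟩ := hz
  rw [hy] at h1 h2
  have : 0 ≤ z.1 := by nlinarith
  ext
  · simp only; nlinarith
  · exact hy

theorem one_zero_mem_asymptoticEntrySet (hκ : κ₁ < 0) :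
    ((1, 0) : ℝ × ℝ) ∈ asymptoticEntrySet (canonicalQuadratic κ₁ κ₂) disc := by
  refine ⟨?_, fun t => ((1 - κ₁ * t)⁻¹, 0), fun t ht => ?_, by simp, fun t ht => ?_⟩
  · rw [entrySet_disc hκ]
    simp [hκ.le]
  · have ht' : 0 ≤ t := ht
    have h1 : 1 - κ₁ * t ≠ 0 := by nlinarith
    have h2 := (((hasDerivAt_id t).const_mul κ₁).const_sub 1).fun_inv h1
    refine ((h2.hasDerivWithinAt (s := Ici 0)).prodMk
      (hasDerivWithinAt_const t _ (0 : ℝ))).congr_deriv ?_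
    ext
    · simp [canonicalQuadratic]
      field_simp
    · simp [canonicalQuadratic]
  · have ht' : 0 ≤ t := ht
    have h1 : 1 ≤ 1 - κ₁ * t := by nlinarith
    have h2 : (1 - κ₁ * t)⁻¹ ≤ 1 := inv_le_one_of_one_le₀ h1
    have h3 : 0 ≤ (1 - κ₁ * t)⁻¹ := inv_nonneg.2 (by linarith)
    simp only [disc, mem_ofPred_eq]
    nlinarith

theorem exists_crossingFun_eq (hκ : κ₁ < 0)
    (hz : z ∈ entrySet (canonicalQuadratic κ₁ κ₂) disc) :
    ∃ w ∈ exitSet (canonicalQuadratic κ₁ κ₂) disc,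
      crossingFun κ₁ κ₂ w = crossingFun κ₁ κ₂ z := by
  by_cases hy : z.2 = 0
  · refine ⟨(-1, 0), ?_, ?_⟩
    · rw [exitSet_disc hκ]
      simp [hκ.le]
    · rw [crossingFun_of_snd_eq_zero hy, crossingFun_of_snd_eq_zero rfl]
  · obtain ⟨w, hw⟩ := exists_crossesTo_disc hκ hz hy
    exact ⟨w, hw.2.1, hw.crossingFun_eq hκ hy⟩

/-- Two compact sets on which a continuous function is injective with the same image are
homeomorphic. -/
theorem exists_homeomorph_of_injOn {E F : Type*} [TopologicalSpace E] [TopologicalSpace F]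
    [T2Space F] {s t : Set E} {f : E → F} (hf : Continuous f) (hs : IsCompact s)
    (ht : IsCompact t) (his : InjOn f s) (hit : InjOn f t) (h : f '' s = f '' t) :
    ∃ e : s ≃ₜ t, ∀ z, f (e z) = f z := by
  have hcs : CompactSpace s := isCompact_iff_compactSpace.1 hs
  have hct : CompactSpace t := isCompact_iff_compactSpace.1 ht
  let es := ((hf.comp continuous_subtype_val).isClosedEmbedding
    (his.injective)).isEmbedding.toHomeomorph
  let et := ((hf.comp continuous_subtype_val).isClosedEmbedding
    (hit.injective)).isEmbedding.toHomeomorph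
  have hr : range (f ∘ ((↑) : s → E)) = range (f ∘ ((↑) : t → E)) := by
    rw [range_comp, range_comp, Subtype.range_coe, Subtype.range_coe, h]
  refine ⟨es.trans ((Homeomorph.setCongr hr).trans et.symm), fun z => ?_⟩
  have : et (et.symm (Homeomorph.setCongr hr (es z))) = Homeomorph.setCongr hr (es z) :=
    et.apply_symm_apply _
  exact congrArg Subtype.val this

theorem isC0Trivialisable_disc (hκ : κ₁ < 0) :
    IsC0Trivialisable (canonicalQuadratic κ₁ κ₂) disc := by
  have hEc : IsCompact (entrySet (canonicalQuadratic κ₁ κ₂) disc) := by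
    rw [entrySet_disc hκ]
    refine isCompact_disc.of_isClosed_subset ?_ fun z hz => hz.1.le
    exact (isClosed_eq (f := fun z : ℝ × ℝ => z.1 ^ 2 + z.2 ^ 2) (by fun_prop)
      continuous_const).inter (isClosed_le (f := fun z : ℝ × ℝ => κ₁ * z.1 + κ₂ * z.2)
      (by fun_prop) continuous_const)
  have hXc : IsCompact (exitSet (canonicalQuadratic κ₁ κ₂) disc) := by
    rw [exitSet_disc hκ]
    refine isCompact_disc.of_isClosed_subset ?_ fun z hz => hz.1.le
    exact (isClosed_eq (f := fun z : ℝ × ℝ => z.1 ^ 2 + z.2 ^ 2) (by fun_prop)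
      continuous_const).inter (isClosed_le (g := fun z : ℝ × ℝ => κ₁ * z.1 + κ₂ * z.2)
      continuous_const (by fun_prop))
  have himg : crossingFun κ₁ κ₂ '' entrySet (canonicalQuadratic κ₁ κ₂) disc =
      crossingFun κ₁ κ₂ '' exitSet (canonicalQuadratic κ₁ κ₂) disc := by
    refine subset_antisymm ?_ ?_
    · rintro _ ⟨z, hz, rfl⟩
      obtain ⟨w, hw, h⟩ := exists_crossingFun_eq hκ hz
      exact ⟨w, hw, h⟩
    -- The reverse inclusion is the forward one applied to `-w`, by the central symmetry.
    · rintro _ ⟨w, hw, rfl⟩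
      obtain ⟨u, hu, h⟩ := exists_crossingFun_eq hκ (neg_mem_entrySet_disc.2 hw)
      refine ⟨-u, neg_mem_entrySet_disc.2 hu, ?_⟩
      rw [crossingFun_neg, h, crossingFun_neg, neg_neg]
  obtain ⟨e, he⟩ := exists_homeomorph_of_injOn (continuous_crossingFun hκ) hEc hXc
    (injOn_crossingFun_entrySet hκ) (injOn_crossingFun_exitSet hκ) himg
  refine ⟨e, fun z hz => ?_, fun k hk => ?_⟩
  · have hy : (z : ℝ × ℝ).2 ≠ 0 := fun hy => hz <| by
      rw [fst_eq_one_of_entrySet hκ z.2 hy]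
      exact one_zero_mem_asymptoticEntrySet hκ
    obtain ⟨w, hw⟩ := exists_crossesTo_disc hκ z.2 hy
    have : w = e z := injOn_crossingFun_exitSet hκ hw.2.1 (e z).2
      (by rw [hw.crossingFun_eq hκ hy, he])
    rwa [← this]
  · have hoff : ∀ z : entrySet (canonicalQuadratic κ₁ κ₂) disc, (z : ℝ × ℝ).2 ≠ 0 →
        k z = e z := fun z hy => by
      have hza : (z : ℝ × ℝ) ∉ asymptoticEntrySet (canonicalQuadratic κ₁ κ₂) disc := by
        rintro ⟨-, γ, hγ, h0, hin⟩
        exact not_mem_disc_forever hκ hγ (by rwa [h0]) hin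
      refine Subtype.ext (injOn_crossingFun_exitSet hκ (k z).2 (e z).2 ?_)
      rw [(hk z hza).crossingFun_eq hκ hy, he]
    refine Homeomorph.ext fun z => ?_
    -- Only `(1, 0)` remains; two bijections agreeing at all other points agree there as well.
    by_cases hy : (z : ℝ × ℝ).2 = 0
    · obtain ⟨u, hu⟩ := e.surjective (k z)
      by_cases huy : (u : ℝ × ℝ).2 = 0
      · have : u = z := Subtype.ext (by
          rw [fst_eq_one_of_entrySet hκ u.2 huy, fst_eq_one_of_entrySet hκ z.2 hy])
        rw [← hu, this]
      · rw [← hoff u huy] at hu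
        have := k.injective hu
        rw [this] at huy
        exact absurd hy huy
    · exact hoff z hy

/-! ### The disc isolates the origin. -/

theorem maximalInvariantSet_disc (hκ : κ₁ < 0) :
    maximalInvariantSet (canonicalQuadratic κ₁ κ₂) disc = {0} := by
  ext z
  rw [mem_singleton_iff]
  constructor
  · rintro ⟨γ, hγ, rfl, hin⟩
    by_contra hne
    have hy : (γ 0).2 = 0 := by
      by_contra hy
      exact not_mem_disc_forever hκ (hγ.mono (subset_univ _)) hy fun t _ => hin t
    have hy' : ∀ t, (γ t).2 = 0 := fun t => by
      obtain ⟨c, -, hc⟩ := snd_canonical_eq_mul' ordConnected_univ hγ (mem_univ 0) (mem_univ t)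
      rw [hc, hy, zero_mul]
    have hx : (γ 0).1 ≠ 0 := fun hx => hne (Prod.ext hx hy)
    have hd : ∀ t, HasDerivAt (fun s => (γ s).1) (κ₁ * (γ t).1 ^ 2) t := fun t => by
      refine ((hγ.fst (mem_univ t)).hasDerivAt univ_mem).congr_deriv ?_
      simp [canonicalQuadratic, hy']
    have hanti : Antitone fun s => (γ s).1 := by
      rw [← antitoneOn_univ]
      exact antitoneOn_of_hasDerivWithinAt ordConnected_univ
        (fun s _ => (hd s).hasDerivWithinAt) fun s _ => by nlinarith [sq_nonneg (γ s).1]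
    have hbd : ∀ t, |(γ t).1| ≤ 1 := fun t => by
      have := norm_le_one_of_mem_disc (hin t)
      rw [Prod.norm_def, max_le_iff] at this
      exact this.1
    have hc : 0 < -κ₁ * (γ 0).1 ^ 2 := by
      have : 0 < (γ 0).1 ^ 2 := by positivity
      nlinarith
    -- On the axis `x' = κ₁x²`: the orbit is unbounded forwards if `x < 0` and backwards if `x > 0`.
    rcases lt_or_gt_of_ne hx with hx | hx
    · refine not_bounded_of_le_hasDerivWithinAt hc
        (fun t _ => (hd t).fun_neg.hasDerivWithinAt) (fun t ht => ?_)
        fun t _ => (abs_neg _).trans_le (hbd t)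
      have := hanti (show (0 : ℝ) ≤ t from ht)
      simp only at this
      have : (γ 0).1 ^ 2 ≤ (γ t).1 ^ 2 := by nlinarith
      nlinarith
    · have hd2 : ∀ t, HasDerivAt (fun s => (γ (-s)).1) (-(κ₁ * (γ (-t)).1 ^ 2)) t := fun t => by
        have := (hd (-t)).comp t (hasDerivAt_neg t)
        refine this.congr_deriv (by ring)
      refine not_bounded_of_le_hasDerivWithinAt hc
        (fun t _ => (hd2 t).hasDerivWithinAt) (fun t ht => ?_) fun t _ => hbd (-t)
      have := hanti (show -t ≤ 0 from neg_nonpos.2 ht)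
      simp only at this
      have : (γ 0).1 ^ 2 ≤ (γ (-t)).1 ^ 2 := by nlinarith
      nlinarith
  · rintro rfl
    refine ⟨fun _ => 0, fun t _ => ?_, rfl, fun t => by simp [disc]⟩
    have : canonicalQuadratic κ₁ κ₂ 0 = 0 := by simp [canonicalQuadratic]
    simp only [this]
    exact hasDerivWithinAt_const _ _ _

theorem isC0RegularisableAt_canonical (hκ : κ₁ < 0) :
    IsC0RegularisableAt (canonicalQuadratic κ₁ κ₂) 0 :=
  ⟨disc, isIsolatingBlock_disc hκ, maximalInvariantSet_disc hκ, isC0Trivialisable_disc hκ⟩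

end Crossing

/-! ### Boundary points where the field enters transversally -/

section Transversal

variable {X : ℝ × ℝ → ℝ × ℝ} {B : Set (ℝ × ℝ)} {g : ℝ × ℝ → ℝ} {z : ℝ × ℝ}

/-- The inequality `dg(X) < 0` persists nearby. There zeros of `g` are frontier points, and none is
an exit point because `g` decreases along its orbit. -/
theorem eventually_mem_entrySet_iff (hX : Continuous X) (hB : IsIsolatingBlock X B)
    (hg : IsLocalDefiningFunction B g z) (hneg : fderiv ℝ g z (X z) < 0) :
    ∀ᶠ w in 𝓝 z, (w ∈ entrySet X B ↔ g w = 0) := by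
  have hcont : Continuous fun w => fderiv ℝ g w (X w) :=
    (hg.1.continuous_fderiv (by simp)).clm_apply hX
  filter_upwards [eventually_eventually_nhds.2 hg.2.2,
    hcont.continuousAt.eventually_lt continuousAt_const hneg] with w hw hwneg
  have hgw : IsLocalDefiningFunction B g w :=
    ⟨hg.1, fun h0 => by rw [h0] at hwneg; simp at hwneg, hw⟩
  refine ⟨fun h => hgw.eq_zero h.1, fun h0 => ?_⟩
  have hwB : w ∈ B := hw.self_of_nhds.2 h0.le
  have hfr : w ∈ frontier B := by
    refine ⟨subset_closure hwB, fun hint => ?_⟩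
    have h1 : ∀ᶠ t : ℝ in 𝓝[>] 0, w + t • (-X w) ∈ B :=
      ((tendsto_line w (-X w)).mono_left nhdsWithin_le_nhds).eventually
        (mem_interior_iff_mem_nhds.1 hint)
    have h2 := hgw.fderiv_nonpos h0 h1
    rw [map_neg] at h2
    linarith
  rw [← hB.2.1] at hfr
  rcases hfr with h | ⟨-, ε, hε, γ, hγ, rfl, hout⟩
  · exact h
  · exfalso
    have h0I : Ioo (-ε) ε ∈ 𝓝 (0 : ℝ) := Ioo_mem_nhds (by linarith) hε
    have hd := (hgw.hasFDerivAt (γ 0)).comp_hasDerivAt 0 (hγ.hasDerivAt h0I)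
    have h1 := eventually_pos_of_hasDerivWithinAt hd.fun_neg.hasDerivWithinAt (by linarith)
    have h2 : ∀ᶠ t in 𝓝[>] 0, (γ t ∈ B ↔ g (γ t) ≤ 0) :=
      ((hγ.hasDerivAt h0I).continuousAt.tendsto.mono_left nhdsWithin_le_nhds).eventually hw
    obtain ⟨t, ht1, ht2, ht3⟩ := (h1.and (h2.and (Ioo_mem_nhdsGT hε))).exists
    refine hout t ht3 (ht2.2 ?_)
    simp only [Function.comp, h0] at ht1
    linarith

/-- Near a zero of `g` with `∂g/∂x ≠ 0` there are zeros of `g` of every nearby ordinate. -/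
theorem eventually_exists_zero (hg : Continuous g) {d : ℝ}
    (hd : HasDerivAt (fun t : ℝ => g (z + t • (1, 0))) d 0) (hd0 : d ≠ 0) (h0 : g z = 0)
    {δ : ℝ} (hδ : 0 < δ) : ∀ᶠ y in 𝓝 z.2, ∃ x, |x - z.1| < δ ∧ g (x, y) = 0 := by
  wlog hpos : 0 < d generalizing g d
  · have := this (g := fun w => -g w) hg.neg hd.fun_neg (neg_ne_zero.2 hd0) (by simp [h0])
      (neg_pos.2 (lt_of_le_of_ne (not_lt.1 hpos) hd0))
    simpa using this
  have h1 := eventually_pos_of_hasDerivWithinAt hd.hasDerivWithinAt hpos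
  have h2 := eventually_neg_of_hasDerivWithinAt hd.hasDerivWithinAt hpos
  obtain ⟨a, ha, haδ⟩ := (h1.and (Ioo_mem_nhdsGT hδ)).exists
  obtain ⟨b, hb, hbδ⟩ := (h2.and (Ioo_mem_nhdsLT (neg_lt_zero.2 hδ))).exists
  have hz : ∀ t : ℝ, z + t • ((1, 0) : ℝ × ℝ) = (z.1 + t, z.2) := fun t => by ext <;> simp
  simp only [hz, add_zero] at ha hb
  rw [show g (z.1, z.2) = 0 from h0] at ha hb
  have ha' : ∀ᶠ y in 𝓝 z.2, 0 < g (z.1 + a, y) := by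
    have : Continuous fun y => g (z.1 + a, y) := by fun_prop
    exact continuousAt_const.eventually_lt this.continuousAt ha
  have hb' : ∀ᶠ y in 𝓝 z.2, g (z.1 + b, y) < 0 := by
    have : Continuous fun y => g (z.1 + b, y) := by fun_prop
    exact this.continuousAt.eventually_lt continuousAt_const hb
  filter_upwards [ha', hb'] with y hya hyb
  have hcont : Continuous fun x => g (x, y) := by fun_prop
  obtain ⟨x, hx, hx0⟩ := intermediate_value_Icc (a := z.1 + b) (b := z.1 + a)
    (by linarith [haδ.1, hbδ.2]) hcont.continuousOn ⟨hyb.le, hya.le⟩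
  refine ⟨x, abs_lt.2 ⟨?_, ?_⟩, hx0⟩
  · linarith [hx.1, hbδ.1]
  · linarith [hx.2, haδ.2]

/-- Supplies boundary points on a prescribed side of an invariant ray, accumulating at `z`. -/
theorem frequently_zero (hg : Continuous g) {d : ℝ}
    (hd : HasDerivAt (fun t : ℝ => g (z + t • (1, 0))) d 0) (hd0 : d ≠ 0) (h0 : g z = 0)
    {P : ℝ → Prop} (hP : ∃ᶠ y in 𝓝 z.2, P y) : ∃ᶠ w in 𝓝 z, g w = 0 ∧ P w.2 := by
  rw [frequently_iff]
  intro U hU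
  obtain ⟨δ, hδ, hsub⟩ := Metric.mem_nhds_iff.1 hU
  have h1 := eventually_exists_zero hg hd hd0 h0 hδ
  have h2 : ∀ᶠ y in 𝓝 z.2, |y - z.2| < δ := Metric.ball_mem_nhds z.2 hδ
  obtain ⟨y, hy, ⟨x, hx, hgx⟩, hyδ⟩ := (hP.and_eventually (h1.and h2)).exists
  refine ⟨(x, y), hsub ?_, hgx, hy⟩
  rw [Metric.mem_ball, Prod.dist_eq, max_lt_iff]
  exact ⟨hx, hyδ⟩

end Transversal

/-! ### Time maps of Lipschitz fields -/

section TimeMap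

variable {V : ℝ × ℝ → ℝ × ℝ} {K : NNReal} {γ γ' : ℝ → ℝ × ℝ}

theorem IsSolutionOn.hasDerivAt_of_univ (h : IsSolutionOn V γ univ) (t : ℝ) :
    HasDerivAt γ (V (γ t)) t := h.hasDerivAt univ_mem

theorem dist_le_of_isSolutionOn (hV : LipschitzWith K V) (h : IsSolutionOn V γ univ)
    (h' : IsSolutionOn V γ' univ) {s : ℝ} (hs : 0 ≤ s) :
    dist (γ s) (γ' s) ≤ dist (γ 0) (γ' 0) * Real.exp (K * s) := by
  have := dist_le_of_trajectories_ODE (v := fun _ => V) (K := K) (fun _ => hV)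
    (f := γ) (g := γ') (a := 0) (b := s) (δ := dist (γ 0) (γ' 0))
    (continuousOn_univ.1 h.continuousOn).continuousOn
    (fun t _ => (h.hasDerivAt_of_univ t).hasDerivWithinAt)
    (continuousOn_univ.1 h'.continuousOn).continuousOn
    (fun t _ => (h'.hasDerivAt_of_univ t).hasDerivWithinAt) le_rfl s ⟨hs, le_rfl⟩
  simpa using this

theorem IsSolutionOn.comp_neg (h : IsSolutionOn V γ univ) :
    IsSolutionOn (fun w => -V w) (fun t => γ (-t)) univ := fun t _ => by
  have := (h.hasDerivAt_of_univ (-t)).scomp t (hasDerivAt_neg t)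
  exact (this.congr_deriv (by simp)).hasDerivWithinAt

theorem IsSolutionOn.comp_add (h : IsSolutionOn V γ univ) (a : ℝ) :
    IsSolutionOn V (fun t => γ (t + a)) univ := fun t _ =>
  ((h.hasDerivAt_of_univ (t + a)).comp_add_const t a).hasDerivWithinAt

theorem IsSolutionOn.eq_of_eq (hV : LipschitzWith K V) (h : IsSolutionOn V γ univ)
    (h' : IsSolutionOn V γ' univ) (h0 : γ 0 = γ' 0) : γ = γ' :=
  ODE_solution_unique_univ (v := fun _ => V) (s := fun _ => univ) (K := K) (t₀ := 0)
    (fun _ => hV.lipschitzOnWith) (fun t => ⟨h.hasDerivAt_of_univ t, mem_univ _⟩)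
    (fun t => ⟨h'.hasDerivAt_of_univ t, mem_univ _⟩) h0

/-- Grönwall's inequality makes the time map Lipschitz; its inverse is the time map of `-V`. -/
theorem exists_timeMap (hV : LipschitzWith K V) {L : ℝ} (hL : ∀ w, ‖V w‖ ≤ L) {s : ℝ}
    (hs : 0 ≤ s) : ∃ φ : (ℝ × ℝ) ≃ₜ (ℝ × ℝ), ∀ γ, IsSolutionOn V γ univ → γ s = φ (γ 0) := by
  choose Γ hΓ hΓ0 using exists_isSolutionOn_univ_of_lipschitz hV hL
  have key : ∀ γ, IsSolutionOn V γ univ → γ = Γ (γ 0) := fun γ hγ =>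
    hγ.eq_of_eq hV (hΓ _) (hΓ0 _).symm
  have hgroup : ∀ w a b, Γ (Γ w a) b = Γ w (b + a) := fun w a b => by
    have := key _ ((hΓ w).comp_add a)
    rw [zero_add] at this
    exact (congrFun this b).symm
  have hneg : LipschitzWith K fun w => -V w := by
    intro x y
    rw [edist_neg_neg]
    exact hV x y
  refine ⟨⟨⟨fun w => Γ w s, fun w => Γ w (-s), fun w => ?_, fun w => ?_⟩, ?_, ?_⟩, fun γ hγ => ?_⟩
  · beta_reduce
    rw [hgroup, neg_add_cancel, hΓ0]
  · beta_reduce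
    rw [hgroup, add_neg_cancel, hΓ0]
  · have : LipschitzWith ⟨Real.exp (K * s), (Real.exp_pos _).le⟩ fun w => Γ w s :=
      LipschitzWith.of_dist_le_mul fun w u => by
        have := dist_le_of_isSolutionOn hV (hΓ w) (hΓ u) hs
        rw [hΓ0, hΓ0, mul_comm] at this
        exact this
    exact this.continuous
  · have : LipschitzWith ⟨Real.exp (K * s), (Real.exp_pos _).le⟩ fun w => Γ w (-s) :=
      LipschitzWith.of_dist_le_mul fun w u => by
        have := dist_le_of_isSolutionOn hneg (hΓ w).comp_neg (hΓ u).comp_neg hs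
        simp only [neg_zero, hΓ0] at this
        rw [mul_comm] at this
        exact this
    exact this.continuous
  · exact congrFun (key γ hγ) s

end TimeMap

/-- If the asymptotic entry set contains a neighbourhood, in the entry set, of a point where the
field enters transversally, then the extension of the map across the block is not unique. -/
theorem not_isC0Trivialisable_of_eventually {X : ℝ × ℝ → ℝ × ℝ} {B : Set (ℝ × ℝ)}
    {g : ℝ × ℝ → ℝ} {z : ℝ × ℝ} (hX : Continuous X) (hB : IsIsolatingBlock X B)
    (hg : IsLocalDefiningFunction B g z) (hz : z ∈ entrySet X B)
    (hneg : fderiv ℝ g z (X z) < 0)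
    (ha : ∀ᶠ w in 𝓝 z, w ∈ entrySet X B → w ∈ asymptoticEntrySet X B) :
    ¬ IsC0Trivialisable X B := by
  rintro ⟨h, hh, huniq⟩
  obtain ⟨r, hr, hball⟩ := Metric.eventually_nhds_iff_ball.1
    ((eventually_mem_entrySet_iff hX hB hg hneg).and ha)
  let η : ContDiffBump z := ⟨r / 2, r, by linarith, by linarith⟩
  have hη0 : ∀ w ∉ Metric.ball z r, η w = 0 := fun w hw =>
    η.zero_of_le_dist (not_lt.1 hw)
  have hsmooth : ∀ v : ℝ × ℝ, ContDiff ℝ ∞ fun w => fderiv ℝ g w v := fun v =>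
    (hg.1.fderiv_right (m := ∞) (by simp)).clm_apply contDiff_const
  -- The Hamiltonian field of `g` cut off by a bump: its flow preserves `g`, hence the entry set
  -- near `z`, moves `z`, and is trivial off the ball.
  let V : ℝ × ℝ → ℝ × ℝ := fun w =>
    η w • ((-fderiv ℝ g w (0, 1), fderiv ℝ g w (1, 0)) : ℝ × ℝ)
  have hVs : ContDiff ℝ ∞ V := η.contDiff.smul ((hsmooth _).neg.prodMk (hsmooth _))
  have hVc : HasCompactSupport V := η.hasCompactSupport.smul_right
  obtain ⟨K, hK⟩ := hVs.lipschitzWith_of_hasCompactSupport hVc (by simp)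
  obtain ⟨L, hL⟩ := hVc.exists_bound_of_continuous hVs.continuous
  have hV0 : ∀ w ∉ Metric.ball z r, V w = 0 := fun w hw => by
    simp only [V, hη0 w hw, zero_smul]
  have hlin : ∀ w v, fderiv ℝ g w v = v.1 * fderiv ℝ g w (1, 0) + v.2 * fderiv ℝ g w (0, 1) := by
    intro w v
    have hv : v = v.1 • ((1, 0) : ℝ × ℝ) + v.2 • ((0, 1) : ℝ × ℝ) := by ext <;> simp
    conv_lhs => rw [hv]
    rw [map_add, map_smul, map_smul, smul_eq_mul, smul_eq_mul]
  have hgV : ∀ w, fderiv ℝ g w (V w) = 0 := fun w => by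
    rw [hlin]
    simp only [V, Prod.smul_fst, Prod.smul_snd, smul_eq_mul]
    ring
  have hVz : V z ≠ 0 := by
    intro h0
    have hηz : η z = 1 := η.one_of_mem_closedBall (Metric.mem_closedBall_self (by positivity))
    simp only [V, hηz, one_smul, Prod.mk_eq_zero, neg_eq_zero] at h0
    refine hg.2.1 ?_
    ext
    · simpa using h0.2
    · simpa using h0.1
  have hgc : ∀ γ, IsSolutionOn V γ univ → ∀ t, g (γ 0) = g (γ t) := fun γ hγ t =>
    eq_of_hasDerivWithinAt_zero (f := fun s => g (γ s)) ordConnected_univ (fun s hs =>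
      (((hg.hasFDerivAt (γ s)).comp_hasDerivAt s (hγ.hasDerivAt_of_univ s)).congr_deriv
        (hgV _)).hasDerivWithinAt) (mem_univ 0) (mem_univ t)
  obtain ⟨γz, hγz, hγz0⟩ := exists_isSolutionOn_univ_of_lipschitz hK hL z
  obtain ⟨s, hs, hsz⟩ : ∃ s, 0 ≤ s ∧ γz s ≠ z := by
    by_contra hall
    push Not at hall
    have h1 := (hγz.hasDerivAt_of_univ 0).hasDerivWithinAt (s := Ici 0)
    have h2 : HasDerivWithinAt γz 0 (Ici 0) 0 :=
      (hasDerivWithinAt_const 0 (Ici 0) z).congr (fun t ht => hall t ht) (hall 0 le_rfl)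
    have := (uniqueDiffOn_Ici (0 : ℝ) 0 (mem_Ici.2 le_rfl)).eq_deriv _ h1 h2
    rw [hγz0] at this
    exact hVz this
  obtain ⟨φ, hφ⟩ := exists_timeMap hK hL hs
  have hfix : ∀ w ∉ Metric.ball z r, φ w = w := fun w hw => by
    refine (hφ (fun _ => w) fun t _ => ?_).symm
    simp only [hV0 w hw]
    exact hasDerivWithinAt_const _ _ _
  have hin : ∀ w ∈ Metric.ball z r, φ w ∈ Metric.ball z r := fun w hw => by
    by_contra hout
    rw [φ.injective (hfix _ hout)] at hout
    exact hout hw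
  have hgφ : ∀ w, g (φ w) = g w := fun w => by
    obtain ⟨γ, hγ, rfl⟩ := exists_isSolutionOn_univ_of_lipschitz hK hL w
    rw [← hφ γ hγ, ← hgc γ hγ]
  have hiff : ∀ w, w ∈ entrySet X B ↔ φ w ∈ entrySet X B := fun w => by
    by_cases hw : w ∈ Metric.ball z r
    · rw [(hball w hw).1, (hball _ (hin w hw)).1, hgφ]
    · rw [hfix w hw]
  let ψ : entrySet X B ≃ₜ entrySet X B := φ.subtype hiff
  have hψ : ∀ w, (ψ w : ℝ × ℝ) = φ w := fun w => rfl
  -- `ψ` moves asymptotic entry points only, so `h ∘ ψ` extends the same map; uniqueness then forces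
  -- `ψ` to fix `z`.
  have heq := huniq (ψ.trans h) fun w hw => by
    have hwb : (w : ℝ × ℝ) ∉ Metric.ball z r := fun hwb => hw ((hball w hwb).2 w.2)
    have : ψ w = w := Subtype.ext (by rw [hψ, hfix _ hwb])
    rw [Homeomorph.trans_apply, this]
    exact hh w hw
  have h1 := DFunLike.congr_fun heq ⟨z, hz⟩
  have h2 : φ z = z := congrArg Subtype.val (h.injective h1)
  rw [hφ γz hγz, hγz0] at hsz
  exact hsz h2

/-! ### Orbits near an invariant ray of `triField` along which the field points inwards -/

/-- The first point at which a ray from an interior point of a bounded closed set meets the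
frontier. -/
theorem exists_first_frontier {B : Set (ℝ × ℝ)} (hB : IsCompact B) (h0 : 0 ∈ interior B)
    {a : ℝ × ℝ} (ha : a ≠ 0) : ∃ s : ℝ, 0 < s ∧ s • a ∈ frontier B ∧
      ∀ t : ℝ, 0 ≤ t → t < s → t • a ∈ interior B := by
  set S : Set ℝ := {s | 0 ≤ s ∧ s • a ∉ interior B} with hS
  have hcont : Continuous fun t : ℝ => t • a := by fun_prop
  have hclosed : IsClosed S := by
    have : S = Ici 0 ∩ (fun t : ℝ => t • a) ⁻¹' (interior B)ᶜ := rfl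
    rw [this]
    exact isClosed_Ici.inter (isOpen_interior.isClosed_compl.preimage hcont)
  have hne : S.Nonempty := by
    obtain ⟨R, hR⟩ := hB.isBounded.exists_norm_le
    have ha' : 0 < ‖a‖ := norm_pos_iff.2 ha
    refine ⟨(|R| + 1) / ‖a‖, by positivity, fun hin => ?_⟩
    have := hR _ (interior_subset hin)
    rw [norm_smul, Real.norm_of_nonneg (by positivity), div_mul_cancel₀ _ ha'.ne'] at this
    linarith [le_abs_self R]
  have hbdd : BddBelow S := ⟨0, fun t ht => ht.1⟩
  have hmem := hclosed.csInf_mem hne hbdd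
  have hbefore : ∀ t, 0 ≤ t → t < sInf S → t • a ∈ interior B := fun t ht hts => by
    by_contra hout
    exact absurd (csInf_le hbdd (show t ∈ S from ⟨ht, hout⟩)) (not_le.2 hts)
  have hpos : 0 < sInf S := by
    refine lt_of_le_of_ne hmem.1 fun h => hmem.2 ?_
    rw [← h, zero_smul]; exact h0
  refine ⟨sInf S, hpos, ⟨?_, hmem.2⟩, hbefore⟩
  refine mem_closure_of_tendsto (b := 𝓝[<] (sInf S)) (f := fun t : ℝ => t • a)
    (hcont.continuousAt.tendsto.mono_left nhdsWithin_le_nhds) ?_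
  filter_upwards [Ioo_mem_nhdsLT hpos] with t ht
  exact interior_subset (hbefore t ht.1.le ht.2)

section InwardRay

variable {p q σ : ℝ} {γ : ℝ → ℝ × ℝ} {I : Set ℝ} {B : Set (ℝ × ℝ)} {z w : ℝ × ℝ}

/-- The open cone of the plane bounded by invariant lines that contains the ray through
`(-σ, 0)`. -/
def rayCone (σ : ℝ) : Set (ℝ × ℝ) := {z | 0 < -σ * z.1 ∧ 0 < σ * (z.2 - z.1)}

theorem isOpen_rayCone : IsOpen (rayCone σ) :=
  (isOpen_lt (f := fun _ : ℝ × ℝ => (0 : ℝ)) (g := fun z : ℝ × ℝ => -σ * z.1) continuous_const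
    (by fun_prop)).inter (isOpen_lt (f := fun _ : ℝ × ℝ => (0 : ℝ))
      (g := fun z : ℝ × ℝ => σ * (z.2 - z.1)) continuous_const (by fun_prop))

theorem mem_rayCone_of_mem (hI : I.OrdConnected) (h : IsSolutionOn (triField p q) γ I) {a b : ℝ}
    (ha : a ∈ I) (hb : b ∈ I) (hC : γ a ∈ rayCone σ) : γ b ∈ rayCone σ := by
  obtain ⟨c, hc, h1⟩ := fst_tri_eq_mul hI h ha hb
  obtain ⟨d, hd, h2⟩ := snd_sub_fst_tri_eq_mul hI h ha hb
  refine ⟨?_, ?_⟩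
  · rw [h1, ← mul_assoc]; exact mul_pos hC.1 hc
  · rw [h2, ← mul_assoc]; exact mul_pos hC.2 hd

/-- A function decreasing along the orbits of `triField` in `rayCone`. -/
noncomputable def rayFun (p q σ : ℝ) (z : ℝ × ℝ) : ℝ :=
  (p + q) * Real.log (-σ * z.1) + (1 - p - q) * Real.log (σ * (z.2 - z.1))

theorem continuousAt_rayFun (hz : z ∈ rayCone σ) : ContinuousAt (rayFun p q σ) z := by
  have h1 : ContinuousAt (fun w : ℝ × ℝ => -σ * w.1) z := by fun_prop
  have h2 : ContinuousAt (fun w : ℝ × ℝ => σ * (w.2 - w.1)) z := by fun_prop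
  exact ((h1.log hz.1.ne').const_mul _).add ((h2.log hz.2.ne').const_mul _)

theorem rayFun_of_snd_eq_zero (hz : z.2 = 0) : rayFun p q σ z = Real.log (-σ * z.1) := by
  rw [rayFun, hz, zero_sub, mul_neg, ← neg_mul]; ring

/-- The weights `p + q` and `1 - p - q` make the derivative collapse to `-p(y - x)`, of constant
sign in the cone. No `log y` occurs, so the function stays finite on the ray itself. -/
theorem rayFun_antitoneOn (hσ : 0 < p * σ) (hI : I.OrdConnected)
    (h : IsSolutionOn (triField p q) γ I) (hC : ∀ t ∈ I, γ t ∈ rayCone σ) :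
    AntitoneOn (fun t => rayFun p q σ (γ t)) I := by
  have hσ0 : σ ≠ 0 := fun h0 => by simp [h0] at hσ
  refine antitoneOn_of_hasDerivWithinAt (f' := fun t => -(p * ((γ t).2 - (γ t).1))) hI
    (fun t ht => ?_) fun t ht => ?_
  · have h1 := (hC t ht).1.ne'
    have h2 := (hC t ht).2.ne'
    have hx : (γ t).1 ≠ 0 := fun h0 => by simp [h0] at h1
    have hd : (γ t).2 - (γ t).1 ≠ 0 := fun h0 => by simp [h0] at h2
    refine (((((h.fst ht).const_mul (-σ)).log h1).const_mul (p + q)).fun_add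
      (((((h.snd ht).fun_sub (h.fst ht)).const_mul σ).log h2).const_mul (1 - p - q))).congr_deriv ?_
    simp only [triField]
    field_simp
    ring
  · have h2 := (hC t ht).2
    have : 0 < p * σ * (σ * ((γ t).2 - (γ t).1)) := mul_pos hσ h2
    have hσ2 : 0 < σ ^ 2 := by positivity
    have : 0 < p * ((γ t).2 - (γ t).1) := by
      refine (pos_iff_pos_of_mul_pos (a := σ ^ 2) ?_).1 hσ2
      linarith
    linarith

theorem CrossesTo.mem_rayCone (h : CrossesTo (triField p q) B z w) (hz : z ∈ rayCone σ) :
    w ∈ rayCone σ := by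
  obtain ⟨-, -, τ, hτ, γ, hγ, rfl, rfl, -⟩ := h
  exact mem_rayCone_of_mem ordConnected_Icc hγ (left_mem_Icc.2 hτ) (right_mem_Icc.2 hτ) hz

theorem CrossesTo.snd_eq_mul (h : CrossesTo (triField p q) B z w) : ∃ c > 0, w.2 = z.2 * c := by
  obtain ⟨-, -, τ, hτ, γ, hγ, rfl, rfl, -⟩ := h
  exact snd_tri_eq_mul ordConnected_Icc hγ (left_mem_Icc.2 hτ) (right_mem_Icc.2 hτ)

theorem CrossesTo.rayFun_le (hσ : 0 < p * σ) (h : CrossesTo (triField p q) B z w)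
    (hz : z ∈ rayCone σ) : rayFun p q σ w ≤ rayFun p q σ z := by
  obtain ⟨-, -, τ, hτ, γ, hγ, rfl, rfl, -⟩ := h
  exact rayFun_antitoneOn hσ ordConnected_Icc hγ (fun t ht => mem_rayCone_of_mem ordConnected_Icc hγ
    (left_mem_Icc.2 hτ) ht hz) (left_mem_Icc.2 hτ) (right_mem_Icc.2 hτ) hτ

/-- On the cone around a nodal ray, orbits approach the ray in slope. -/
theorem CrossesTo.sq_mul_le (h : CrossesTo (triField p q) B z w) (hz : z ∈ rayCone (-1)) :
    w.2 ^ 2 * z.1 ^ 2 ≤ z.2 ^ 2 * w.1 ^ 2 := by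
  have hw := h.mem_rayCone hz
  obtain ⟨-, -, τ, hτ, γ, hγ, rfl, rfl, -⟩ := h
  have h0 := left_mem_Icc.2 hτ
  have hC : ∀ t ∈ Icc 0 τ, γ t ∈ rayCone (-1) := fun t ht =>
    mem_rayCone_of_mem ordConnected_Icc hγ h0 ht hz
  have hx : ∀ t ∈ Icc 0 τ, 0 < (γ t).1 := fun t ht => by simpa using (hC t ht).1
  -- The slope satisfies `(y/x)' = (y/x)(y - x)`, and `y < x` in this cone.
  have hanti := antitoneOn_of_hasDerivWithinAt (f := fun t => ((γ t).2 / (γ t).1) ^ 2)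
    (f' := fun t => 2 * ((γ t).2 / (γ t).1) ^ 2 * ((γ t).2 - (γ t).1)) ordConnected_Icc
    (fun t ht => by
      have hxt := (hx t ht).ne'
      refine (((hγ.snd ht).fun_div (hγ.fst ht) hxt).fun_pow 2).congr_deriv ?_
      simp only [triField, Nat.cast_ofNat, Nat.reduceSub, pow_one]
      field_simp
      ring) (fun t ht => by
      have h1 : (γ t).2 - (γ t).1 < 0 := by
        have := (hC t ht).2
        linarith
      exact mul_nonpos_of_nonneg_of_nonpos (by positivity) h1.le)
  have h1 := hanti h0 (right_mem_Icc.2 hτ) hτ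
  simp only [div_pow] at h1
  have hx0 := hx 0 h0
  have hxτ := hx τ (right_mem_Icc.2 hτ)
  rwa [div_le_div_iff₀ (by positivity) (by positivity)] at h1

/-- A boundary point on the inward ray through `(-σ, 0)` such that the open segment from it to
the origin is interior to the block. -/
structure IsFirstRayPoint (B : Set (ℝ × ℝ)) (σ : ℝ) (z : ℝ × ℝ) : Prop where
  mem_frontier : z ∈ frontier B
  snd_eq_zero : z.2 = 0
  mem_rayCone : z ∈ rayCone σ
  mem_interior : ∀ w : ℝ × ℝ, w.2 = 0 → 0 ≤ -σ * w.1 → -σ * w.1 < -σ * z.1 → w ∈ interior B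

theorem exists_isFirstRayPoint (hB : IsCompact B) (h0 : 0 ∈ interior B) (hσ : σ ^ 2 = 1) :
    ∃ z, IsFirstRayPoint B σ z := by
  have hσ0 : σ ≠ 0 := fun h => by norm_num [h] at hσ
  obtain ⟨s, hs, hfr, hint⟩ := exists_first_frontier hB h0 (a := (-σ, 0)) (by simpa using hσ0)
  refine ⟨_, hfr, by simp, ⟨?_, ?_⟩, fun w hw h1 h2 => ?_⟩
  · simp only [Prod.smul_fst, smul_eq_mul]; nlinarith
  · simp only [Prod.smul_fst, Prod.smul_snd, smul_eq_mul]; nlinarith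
  · have hw' : w = (-σ * w.1) • ((-σ, 0) : ℝ × ℝ) := by
      ext
      · simp only [Prod.smul_fst, smul_eq_mul]; linear_combination -w.1 * hσ
      · simp [hw]
    rw [hw']
    refine hint _ h1 ?_
    simp only [Prod.smul_fst, smul_eq_mul] at h2
    nlinarith

/-- The orbit of `z` moves along the ray towards the origin, through interior points of `B`. -/
theorem IsFirstRayPoint.notMem_exitSet (hz : IsFirstRayPoint B σ z) (hσ : 0 < p * σ) :
    z ∉ exitSet (triField p q) B := by
  rintro ⟨-, ε, hε, γ, hγ, rfl, hout⟩
  have h0 : (0 : ℝ) ∈ Ioo (-ε) ε := by simp [hε]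
  have hd := (((hγ.fst h0).const_mul (-σ)).hasDerivAt (Ioo_mem_nhds h0.1 h0.2)).fun_neg
  have hx : (γ 0).1 ≠ 0 := fun h => by have := hz.mem_rayCone.1; simp [h] at this
  have hpos : 0 < -(-σ * (triField p q (γ 0)).1) := by
    simp only [triField, hz.snd_eq_zero]
    have : 0 < p * σ * (γ 0).1 ^ 2 := mul_pos hσ (by positivity)
    linarith
  have h1 := eventually_pos_of_hasDerivWithinAt hd.hasDerivWithinAt hpos
  obtain ⟨t, ht, htε⟩ := (h1.and (Ioo_mem_nhdsGT hε)).exists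
  have htI : t ∈ Ioo (-ε) ε := ⟨by linarith [htε.1], htε.2⟩
  obtain ⟨c, -, hc⟩ := snd_tri_eq_mul ordConnected_Ioo hγ h0 htI
  refine hout t htε (interior_subset (hz.mem_interior _ ?_ ?_ ?_))
  · rw [hc, hz.snd_eq_zero, zero_mul]
  · exact (mem_rayCone_of_mem ordConnected_Ioo hγ h0 htI hz.mem_rayCone).1.le
  · linarith

theorem IsFirstRayPoint.mem_entrySet (hz : IsFirstRayPoint B σ z) (hσ : 0 < p * σ)
    (hB : IsIsolatingBlock (triField p q) B) : z ∈ entrySet (triField p q) B := by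
  have := hz.mem_frontier
  rw [← hB.2.1] at this
  exact this.resolve_right (hz.notMem_exitSet hσ)

/-- The field at `z` points into `B`, so the derivative is nonpositive; if it vanished, `z` would be
a tangency and hence an exit point. -/
theorem IsFirstRayPoint.fderiv_neg (hz : IsFirstRayPoint B σ z) (hσ : 0 < p * σ)
    (hB : IsIsolatingBlock (triField p q) B) {g : ℝ × ℝ → ℝ}
    (hg : IsLocalDefiningFunction B g z) : fderiv ℝ g z (triField p q z) < 0 := by
  refine lt_of_le_of_ne (hg.fderiv_nonpos (hg.eq_zero hz.mem_frontier) ?_) fun h0 => ?_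
  · have hcont : Continuous fun t : ℝ => -σ * (z + t • triField p q z).1 := by
      simp only [Prod.fst_add, Prod.smul_fst]
      fun_prop
    have h1 : ∀ᶠ t in 𝓝 (0 : ℝ), 0 < -σ * (z + t • triField p q z).1 :=
      continuousAt_const.eventually_lt hcont.continuousAt (by simpa using hz.mem_rayCone.1)
    filter_upwards [h1.filter_mono nhdsWithin_le_nhds, self_mem_nhdsWithin] with t ht ht0
    have ht0' : 0 < t := ht0
    have hx : z.1 ≠ 0 := fun h => by have := hz.mem_rayCone.1; simp [h] at this
    refine interior_subset (hz.mem_interior _ ?_ ht.le ?_)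
    · simp [triField, hz.snd_eq_zero]
    · simp only [triField, hz.snd_eq_zero, Prod.fst_add, Prod.smul_fst, smul_eq_mul]
      have : 0 < p * σ * (t * z.1 ^ 2) := mul_pos hσ (by positivity)
      linarith
  · have : z ∈ tangencySet (triField p q) B := ⟨hz.mem_frontier, g, hg, h0⟩
    rw [← hB.2.2.1] at this
    exact hz.notMem_exitSet hσ this.2

/-- The image of a first ray point under an extension of the map across the block is not on the
line of that ray, if nearby points cross the block. -/
theorem IsFirstRayPoint.snd_ne_zero (hz : IsFirstRayPoint B σ z) (hσ : 0 < p * σ)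
    (h0 : 0 ∈ interior B) (hzE : z ∈ entrySet (triField p q) B)
    {h : entrySet (triField p q) B → exitSet (triField p q) B} (hcont : Continuous h)
    (hfreq : ∃ᶠ u : entrySet (triField p q) B in 𝓝 ⟨z, hzE⟩,
      CrossesTo (triField p q) B u (h u)) :
    (h ⟨z, hzE⟩ : ℝ × ℝ).2 ≠ 0 := by
  intro hy
  set ζ : entrySet (triField p q) B := ⟨z, hzE⟩ with hζ
  obtain ⟨w, hw⟩ : ∃ w, w = (h ζ : ℝ × ℝ) := ⟨_, rfl⟩
  have hwX : w ∈ exitSet (triField p q) B := hw ▸ (h ζ).2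
  rw [← hw] at hy
  have hth : Tendsto (fun u => (h u : ℝ × ℝ)) (𝓝 ζ) (𝓝 w) := by
    rw [hw]
    exact (continuous_subtype_val.comp hcont).tendsto ζ
  have htz : Tendsto (fun u : entrySet (triField p q) B => (u : ℝ × ℝ)) (𝓝 ζ) (𝓝 z) :=
    continuous_subtype_val.tendsto ζ
  have hC : ∀ᶠ u : entrySet (triField p q) B in 𝓝 ζ, (u : ℝ × ℝ) ∈ rayCone σ :=
    htz.eventually (isOpen_rayCone.mem_nhds hz.mem_rayCone)
  have hfreq' := hfreq.and_eventually hC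
  -- The image is a limit of points of the cone, so it lies on the closed ray; it is not the origin,
  -- which is interior to `B`.
  have hξ : 0 ≤ -σ * w.1 := by
    have hcl : IsClosed {u : ℝ × ℝ | 0 ≤ -σ * u.1} :=
      isClosed_le continuous_const (by fun_prop)
    exact hcl.mem_of_frequently_of_tendsto
      (hfreq'.mono fun u hu => ((hu.1.mem_rayCone hu.2).1.le : 0 ≤ -σ * (h u : ℝ × ℝ).1)) hth
  have hσ0 : σ ≠ 0 := fun h0 => by simp [h0] at hσ
  have hξ' : 0 < -σ * w.1 := by
    refine lt_of_le_of_ne hξ fun heq => ?_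
    have hw1 : w.1 = 0 := by
      rcases mul_eq_zero.1 heq.symm with h1 | h1
      · exact absurd (neg_eq_zero.1 h1) hσ0
      · exact h1
    have : w = 0 := Prod.ext hw1 hy
    rw [this] at hwX
    exact hwX.1.2 h0
  have hwC : w ∈ rayCone σ := by
    refine ⟨hξ', ?_⟩
    rw [hy]; linarith
  -- Monotonicity passes to the limit. On the ray `rayFun` is `log (-σx)`, so `w` is no farther out
  -- than `z`: it is interior or equals `z`, and neither is an exit point.
  have hle : rayFun p q σ w ≤ rayFun p q σ z := by
    by_contra hlt
    have h1 := ((continuousAt_rayFun (p := p) (q := q) hz.mem_rayCone).tendsto.comp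
      htz).eventually_lt ((continuousAt_rayFun (p := p) (q := q) hwC).tendsto.comp hth)
      (not_le.1 hlt)
    obtain ⟨u, ⟨hu1, hu2⟩, hu3⟩ := (hfreq'.and_eventually h1).exists
    exact absurd (hu1.rayFun_le hσ hu2) (not_le.2 hu3)
  rw [rayFun_of_snd_eq_zero hy, rayFun_of_snd_eq_zero hz.snd_eq_zero,
    Real.log_le_log_iff hξ' hz.mem_rayCone.1] at hle
  rcases hle.lt_or_eq with hlt | heq
  · exact hwX.1.2 (hz.mem_interior w hy hξ hlt)
  · have : w = z := by
      refine Prod.ext (mul_left_cancel₀ (neg_ne_zero.2 hσ0) heq) ?_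
      rw [hy, hz.snd_eq_zero]
    exact hz.notMem_exitSet hσ (this ▸ hwX)

end InwardRay

/-! ### Three invariant lines: no block is trivialisable -/

section Obstruction

variable {p q : ℝ} {γ : ℝ → ℝ × ℝ} {z : ℝ × ℝ} {B : Set (ℝ × ℝ)}

/-- At least one nodal line: the asymptotic entry set has interior points in the entry set. -/
theorem not_regularisable_tri_node (hp : p < 0) :
    ¬ IsC0RegularisableAt (triField p q) 0 := by
  rintro ⟨B, hB, hinv, htriv⟩
  have hX := contDiff_triField p q
  have h0 := hB.mem_interior hX (by simp [triField]) (mem_of_maximalInvariantSet_eq hinv)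
  have hσ : 0 < p * (-1) := by linarith
  obtain ⟨z, hz⟩ := exists_isFirstRayPoint (σ := -1) hB.1.1 h0 (by norm_num)
  obtain ⟨g, hg⟩ := hB.1.2 z hz.mem_frontier
  have hzE := hz.mem_entrySet hσ hB
  refine not_isC0Trivialisable_of_eventually hX.continuous hB hg hzE
    (hz.fderiv_neg hσ hB hg) ?_ htriv
  obtain ⟨h, hh, -⟩ := htriv
  set ζ : entrySet (triField p q) B := ⟨z, hzE⟩ with hζ
  -- If crossing points accumulated at `z`, the slope inequality would pass to the limit and put the
  -- image of `z` on the axis.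
  have key : ∀ᶠ u : entrySet (triField p q) B in 𝓝 ζ, (u : ℝ × ℝ) ∈ asymptoticEntrySet (triField p q) B := by
    by_contra hnot
    have hfreq : ∃ᶠ u : entrySet (triField p q) B in 𝓝 ζ, CrossesTo (triField p q) B u (h u) :=
      (not_eventually.1 hnot).mono fun u hu => hh u hu
    refine hz.snd_ne_zero hσ h0 hzE h.continuous hfreq ?_
    have hC : ∀ᶠ u : entrySet (triField p q) B in 𝓝 ζ, (u : ℝ × ℝ) ∈ rayCone (-1) :=
      (continuous_subtype_val.tendsto ζ).eventually (isOpen_rayCone.mem_nhds hz.mem_rayCone)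
    have hcl : IsClosed {u : entrySet (triField p q) B |
        (h u : ℝ × ℝ).2 ^ 2 * (u : ℝ × ℝ).1 ^ 2 ≤ (u : ℝ × ℝ).2 ^ 2 * (h u : ℝ × ℝ).1 ^ 2} := by
      have := h.continuous
      exact isClosed_le (by fun_prop) (by fun_prop)
    have hle := hcl.mem_of_frequently_of_tendsto
      ((hfreq.and_eventually hC).mono fun u hu => hu.1.sq_mul_le hu.2) tendsto_id
    have hle' : (h ζ : ℝ × ℝ).2 ^ 2 * z.1 ^ 2 ≤ z.2 ^ 2 * (h ζ : ℝ × ℝ).1 ^ 2 := hle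
    have hx : 0 < z.1 := by simpa using hz.mem_rayCone.1
    rw [hz.snd_eq_zero] at hle'
    have h1 : 0 < z.1 ^ 2 := by positivity
    have h2 : (h ζ : ℝ × ℝ).2 ^ 2 ≤ 0 := by nlinarith
    exact pow_eq_zero_iff (two_ne_zero) |>.1 (le_antisymm h2 (sq_nonneg _))
  rw [nhds_subtype_eq_comap, eventually_comap] at key
  exact key.mono fun w hw hwE => hw ⟨w, hwE⟩ rfl

/-- In the cone `|y|' ≥ q y²` when `y > 0` and `|y|' ≥ (1 - p - q) y²` when `y < 0`, so `y` is
unbounded in any orbit staying forward in `B`. -/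
theorem tri_saddle_notMem_asymptoticEntrySet (hp : 0 < p) (hq : 0 < q) (hr : 0 < 1 - p - q)
    (hB : IsCompact B) (hz : z ∈ rayCone 1) (hy : z.2 ≠ 0) :
    z ∉ asymptoticEntrySet (triField p q) B := by
  rintro ⟨-, γ, hγ, rfl, hin⟩
  obtain ⟨M, hM⟩ := hB.isBounded.exists_norm_le
  have h0 : (0 : ℝ) ∈ Ici (0 : ℝ) := mem_Ici.2 le_rfl
  have hC : ∀ t ∈ Ici (0 : ℝ), γ t ∈ rayCone 1 := fun t ht =>
    mem_rayCone_of_mem ordConnected_Ici hγ h0 ht hz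
  have hmul : ∀ t ∈ Ici (0 : ℝ), ∃ c > 0, (γ t).2 = (γ 0).2 * c := fun t ht =>
    snd_tri_eq_mul ordConnected_Ici hγ h0 ht
  have hbd : ∀ t ∈ Ici (0 : ℝ), |(γ t).2| ≤ M := fun t ht =>
    (norm_snd_le (γ t)).trans (hM _ (hin t ht))
  rcases lt_or_gt_of_ne hy with hneg | hpos
  · have hyt : ∀ t ∈ Ici (0 : ℝ), (γ t).2 < 0 := fun t ht => by
      obtain ⟨c, hc, hct⟩ := hmul t ht
      rw [hct]; exact mul_neg_of_neg_of_pos hneg hc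
    have hd : ∀ t ∈ Ici (0 : ℝ), (1 - p - q) * (γ t).2 ^ 2 ≤ -(triField p q (γ t)).2 := by
      intro t ht
      have h1 := (hC t ht).2
      have h2 := hyt t ht
      simp only [triField]
      nlinarith [mul_pos (mul_pos (show 0 < 1 - p by linarith) (neg_pos.2 h2)) h1]
    have hmono := monotoneOn_of_hasDerivWithinAt ordConnected_Ici
      (fun t ht => (hγ.snd ht).fun_neg) fun t ht => le_trans (by positivity) (hd t ht)
    refine not_bounded_of_le_hasDerivWithinAt (c := (1 - p - q) * (γ 0).2 ^ 2)
      (by positivity) (fun t ht => (hγ.snd ht).fun_neg) (fun t ht => le_trans ?_ (hd t ht))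
      fun t ht => (abs_neg _).trans_le (hbd t ht)
    have := hmono h0 ht ht
    simp only at this
    have h3 : (γ 0).2 ^ 2 ≤ (γ t).2 ^ 2 := by nlinarith
    gcongr
  · have hyt : ∀ t ∈ Ici (0 : ℝ), 0 < (γ t).2 := fun t ht => by
      obtain ⟨c, hc, hct⟩ := hmul t ht
      rw [hct]; exact mul_pos hpos hc
    have hd : ∀ t ∈ Ici (0 : ℝ), q * (γ t).2 ^ 2 ≤ (triField p q (γ t)).2 := by
      intro t ht
      have h1 := (hC t ht).1
      have h2 := hyt t ht
      simp only [triField]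
      nlinarith [mul_pos (mul_pos (show 0 < 1 - p by linarith) h2) h1]
    have hmono := monotoneOn_of_hasDerivWithinAt ordConnected_Ici
      (fun t ht => hγ.snd ht) fun t ht => le_trans (by positivity) (hd t ht)
    refine not_bounded_of_le_hasDerivWithinAt (c := q * (γ 0).2 ^ 2)
      (by positivity) (fun t ht => hγ.snd ht) (fun t ht => le_trans ?_ (hd t ht)) hbd
    have := hmono h0 ht ht
    simp only at this
    gcongr

/-- Three saddle lines: the map across the block has no continuous extension. -/
theorem not_regularisable_tri_saddle (hp : 0 < p) (hq : 0 < q) (hr : 0 < 1 - p - q) :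
    ¬ IsC0RegularisableAt (triField p q) 0 := by
  rintro ⟨B, hB, hinv, h, hh, -⟩
  have hX := contDiff_triField p q
  have h0 := hB.mem_interior hX (by simp [triField]) (mem_of_maximalInvariantSet_eq hinv)
  have hσ : 0 < p * 1 := by linarith
  obtain ⟨z, hz⟩ := exists_isFirstRayPoint (σ := 1) hB.1.1 h0 (by norm_num)
  obtain ⟨g, hg⟩ := hB.1.2 z hz.mem_frontier
  have hzE := hz.mem_entrySet hσ hB
  have hneg := hz.fderiv_neg hσ hB hg
  set ζ : entrySet (triField p q) B := ⟨z, hzE⟩ with hζ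
  have hd0 : fderiv ℝ g z (1, 0) ≠ 0 := by
    intro hd
    have : triField p q z = (p * z.1 ^ 2) • ((1, 0) : ℝ × ℝ) := by
      ext
      · simp [triField, hz.snd_eq_zero]; ring
      · simp [triField, hz.snd_eq_zero]
    rw [this, map_smul, hd, smul_zero] at hneg
    exact lt_irrefl _ hneg
  have hiff := eventually_mem_entrySet_iff hX.continuous hB hg hneg
  have hC : ∀ᶠ u in 𝓝 z, u ∈ rayCone 1 := isOpen_rayCone.mem_nhds hz.mem_rayCone
  -- Entry points accumulate at `z` from either side of the axis, and all of them cross.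
  have hside : ∀ P : ℝ → Prop, (∀ y, P y → y ≠ 0) → (∃ᶠ y in 𝓝 z.2, P y) →
      ∃ᶠ u : entrySet (triField p q) B in 𝓝 ζ, CrossesTo (triField p q) B u (h u) ∧ P (u : ℝ × ℝ).2 := by
    intro P hP hfreq
    have h1 := (frequently_zero hg.1.continuous (hg.hasDerivAt_line (1, 0)) hd0
      (hg.eq_zero hz.mem_frontier) hfreq).and_eventually (hiff.and hC)
    rw [nhds_subtype_eq_comap, frequently_comap]
    refine h1.mono fun w hw => ?_
    obtain ⟨⟨hgw, hPw⟩, hwE, hwC⟩ := hw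
    refine ⟨⟨w, hwE.2 hgw⟩, rfl, hh _ ?_, hPw⟩
    exact tri_saddle_notMem_asymptoticEntrySet hp hq hr hB.1.1 hwC (hP _ hPw)
  have hth : Tendsto (fun u => (h u : ℝ × ℝ).2) (𝓝 ζ) (𝓝 (h ζ : ℝ × ℝ).2) :=
    (continuous_snd.comp (continuous_subtype_val.comp h.continuous)).tendsto ζ
  have hpos := hside (fun y => 0 < y) (fun y hy => hy.ne') (by
    rw [hz.snd_eq_zero]
    have : ∃ᶠ y in 𝓝[>] (0 : ℝ), 0 < y :=
      Eventually.frequently self_mem_nhdsWithin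
    exact this.filter_mono nhdsWithin_le_nhds)
  have hlt := hside (fun y => y < 0) (fun y hy => hy.ne) (by
    rw [hz.snd_eq_zero]
    have : ∃ᶠ y in 𝓝[<] (0 : ℝ), y < 0 :=
      Eventually.frequently self_mem_nhdsWithin
    exact this.filter_mono nhdsWithin_le_nhds)
  -- Crossing preserves the sign of `y`, so the image of `z` is a limit of points from both sides.
  refine hz.snd_ne_zero hσ h0 hzE h.continuous (hpos.mono fun u hu => hu.1) (le_antisymm ?_ ?_)
  · refine isClosed_Iic.mem_of_frequently_of_tendsto (hlt.mono fun u hu => ?_) hth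
    obtain ⟨c, hc, hcu⟩ := hu.1.snd_eq_mul
    exact hcu ▸ (mul_neg_of_neg_of_pos hu.2 hc).le
  · refine isClosed_Ici.mem_of_frequently_of_tendsto (hpos.mono fun u hu => ?_) hth
    obtain ⟨c, hc, hcu⟩ := hu.1.snd_eq_mul
    exact hcu ▸ (mul_pos hu.2 hc).le

/-- A quadratic field with three real characteristic directions is not regularisable. -/
theorem not_regularisable_tri (hp : p ≠ 0) (hq : q ≠ 0) (hr : 1 - p - q ≠ 0) :
    ¬ IsC0RegularisableAt (triField p q) 0 := by
  intro h
  -- A negative coefficient among `p`, `q`, `1 - p - q` is moved to the first place by exchanging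
  -- invariant lines.
  rcases lt_or_gt_of_ne hp with hp | hp
  · exact not_regularisable_tri_node hp h
  rcases lt_or_gt_of_ne hq with hq | hq
  · obtain ⟨T, hT⟩ := exists_linearPush_triField_swap p q
    exact not_regularisable_tri_node hq (hT ▸ h.linearPush T)
  rcases lt_or_gt_of_ne hr with hr | hr
  · obtain ⟨T, hT⟩ := exists_linearPush_triField_rotate p q
    exact not_regularisable_tri_node hr (hT ▸ h.linearPush T)
  · exact not_regularisable_tri_saddle hp hq hr h

end Obstruction

end PlanarReg

/-! ### The characterisation of regularisable quadratic fields. -/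

theorem mainTheorem8 (X : ℝ × ℝ → ℝ × ℝ) (hV : PlanarReg.MemV X)
    (hquad : PlanarReg.IsHomogeneousField 2 X) :
    PlanarReg.IsC0RegularisableAt X 0 ↔
      ∃ (T : (ℝ × ℝ) ≃ₗ[ℝ] (ℝ × ℝ)) (κ₁ κ₂ : ℝ), κ₁ < 0 ∧
        PlanarReg.linearPush T X = PlanarReg.canonicalQuadratic κ₁ κ₂ := by
  constructor
  · intro h
    obtain ⟨T, ⟨κ₁, κ₂, hκ, hT⟩ | ⟨p, q, hp, hq, hr, hT⟩⟩ :=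
      PlanarReg.exists_normalForm (hV.isSimpleQuad hquad)
    · have h' := h.linearPush T
      rw [hT] at h'
      refine ⟨T, κ₁, κ₂, lt_of_le_of_ne (not_lt.1 fun hpos => ?_) hκ, hT⟩
      exact PlanarReg.not_regularisable_canonical hpos h'
    · have h' := h.linearPush T
      rw [hT] at h'
      exact absurd h' (PlanarReg.not_regularisable_tri hp hq hr)
  · rintro ⟨T, κ₁, κ₂, hκ, hT⟩
    have h := (PlanarReg.isC0RegularisableAt_canonical (κ₂ := κ₂) hκ).linearPush T.symm
    rwa [← hT, PlanarReg.linearPush_symm_linearPush] at h
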